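/- Fix $N\ge 0$. Let $\mathcal M_{2N+1}$ be the set of polynomials $f(\zeta)=\sum_{k=0}^{N}a_k\zeta^{k+1}$ with $a_0>0$, $a_1,\dots,a_N\in\mathbb C$, that are univalent in a neighbourhood of the closed unit disk $\overline{\mathbb D}$; identify it with a subset of $\mathbb R\times\mathbb C^N$ through $(a_0;a_1,\dots,a_N)$, and $f$ with the domain $\Omega=f(\mathbb D)$. Put $$M_k(\Omega)=\frac1\pi\int_\Omega z^k\,dm(z)\quad(k\ge 0),\qquad M_{-k}(\Omega)=\frac1{2\pi i}\int_{\partial\Omega}z^{-k}\,\bar z\,dz\quad(k\ge1),$$ where $m$ is Lebesgue measure and $\partial\Omega$ is traversed counterclockwise as $\theta\mapsto f(e^{i\theta})$, and, for $R>0$, $$\mathcal F_R(\Omega)=\frac1{\pi^2}\int_{\mathbb D(0,R)\setminus\Omega}\int_{\mathbb D(0,R)\setminus\Omega}\log\frac1{|z-\zeta|}\,dm(z)\,dm(\zeta).$$ Then the moments $(M_0;M_1,\dots,M_N)\in\mathbb R\times\mathbb C^N$ are smooth local coordinates near every point of $\mathcal M_{2N+1}$. In any such local coordinates, with $\frac{\partial}{\partial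 M_k}=\frac12\big(\frac{\partial}{\partial\operatorname{Re}M_k}-i\frac{\partial}{\partial\operatorname{Im}M_k}\big)$ for $1\le k\le N$, the following hold. 1. If $\overline\Omega\subset\mathbb D(0,R)$, then the double integral defining $\mathcal F_R(\Omega)$ converges absolutely, $\mathcal F_R$ is (real) differentiable at $\Omega$ as a function of the moments, and $$\frac{\partial\mathcal F_R(\Omega)}{\partial M_k}=\frac1k\,M_{-k}(\Omega)\qquad(1\le k\le N).$$ 2. The negative moments $M_{-k}$, $1\le k\le N$, are (real) differentiable functions of $(M_0;M_1,\dots,M_N)$, and $$\frac1k\,\frac{\partial M_{-k}}{\partial M_j}=\frac1j\,\frac{\partial M_{-j}}{\partial M_k}\qquad(1\le k,j\le N).$$ -/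

import Mathlib

open MeasureTheory Set Metric
open scoped ContDiff ComplexConjugate

noncomputable section

namespace MomentCoordinates

/-- The real vector space `ℝ × ℂ^N` of dimension `2N+1`. It carries both the coefficients
`(a₀; a₁, …, a_N)` of a polynomial map (with `a₀` real) and the moments `(M₀; M₁, …, M_N)`
(with `M₀` real). The entry with index `k : Fin N` of the second component is `a_{k+1}`,
respectively `M_{k+1}`. -/
abbrev Coord (N : ℕ) : Type := ℝ × (Fin N → ℂ)

/-- The polynomial `f(ζ) = a₀ ζ + a₁ ζ² + ⋯ + a_N ζ^{N+1}`. -/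
def polyMap {N : ℕ} (a : Coord N) (ζ : ℂ) : ℂ :=
  (a.1 : ℂ) * ζ + ∑ k : Fin N, a.2 k * ζ ^ ((k : ℕ) + 2)

/-- The manifold of polynomial conformal maps, as a subset of `ℝ × ℂ^N`: the coefficient vectors
with `a₀ > 0` whose polynomial is univalent in a full neighbourhood of the closed unit disk. -/
def univalentSet (N : ℕ) : Set (Coord N) :=
  {a | 0 < a.1 ∧ ∃ U : Set ℂ, IsOpen U ∧ closedBall (0 : ℂ) 1 ⊆ U ∧ InjOn (polyMap a) U}

/-- The domain `Ω = f(𝔻)`. -/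
def domainOf {N : ℕ} (a : Coord N) : Set ℂ := polyMap a '' ball (0 : ℂ) 1

/-- The boundary curve `θ ↦ f(e^{iθ})` of `Ω = f(𝔻)`, counterclockwise for `0 ≤ θ ≤ 2π`. -/
def boundaryCurve {N : ℕ} (a : Coord N) (θ : ℝ) : ℂ :=
  polyMap a (Complex.exp (θ * Complex.I))

/-- The harmonic moment `M_k(Ω) = (1/π) ∫_Ω z^k dm`, for `k ≥ 0`. -/
def harmonicMoment (Ω : Set ℂ) (k : ℕ) : ℂ :=
  (1 / (Real.pi : ℂ)) * ∫ z in Ω, z ^ k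

/-- The contour moment `(1/(2πi)) ∫_γ z^k conj(z) dz`, for an integer `k`, along a closed curve
`γ : [0, 2π] → ℂ`. -/
def contourMoment (γ : ℝ → ℂ) (k : ℤ) : ℂ :=
  (1 / (2 * (Real.pi : ℂ) * Complex.I)) *
    ∫ θ in (0 : ℝ)..(2 * Real.pi), γ θ ^ k * conj (γ θ) * deriv γ θ

/-- The negative moment `M_{-k}(Ω) = (1/(2πi)) ∫_{∂Ω} z^{-k} conj(z) dz` of `Ω = f(𝔻)`. -/
def negMoment {N : ℕ} (a : Coord N) (k : ℕ) : ℂ :=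
  contourMoment (boundaryCurve a) (-(k : ℤ))

/-- The map `(a₀; a₁, …, a_N) ↦ (M₀; M₁, …, M_N)`, the moments being those of `Ω = f(𝔻)`. -/
def momentMap {N : ℕ} (a : Coord N) : Coord N :=
  ((harmonicMoment (domainOf a) 0).re, fun k => harmonicMoment (domainOf a) ((k : ℕ) + 1))

/-- `e` is a smooth local coordinate chart on the manifold of polynomial conformal maps whose
coordinates are the moments `(M₀; M₁, …, M_N)`. -/
structure IsMomentChart {N : ℕ} (e : OpenPartialHomeomorph (Coord N) (Coord N)) : Prop where
  source_subset : e.source ⊆ univalentSet N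
  eqOn : EqOn e momentMap e.source
  contDiffOn : ContDiffOn ℝ ∞ e e.source
  contDiffOn_symm : ContDiffOn ℝ ∞ e.symm e.target

/-- The Wirtinger derivative `∂G/∂M_{k+1} = (1/2) (∂G/∂(Re M_{k+1}) - i ∂G/∂(Im M_{k+1}))` of a
complex-valued function `G` of `(M₀; M₁, …, M_N)`, at the point `p`. -/
def wirtinger {N : ℕ} (G : Coord N → ℂ) (k : Fin N) (p : Coord N) : ℂ :=
  (1 / 2) * (fderiv ℝ G p (0, Pi.single k 1) - Complex.I * fderiv ℝ G p (0, Pi.single k Complex.I))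

/-- The energy `F_R(Ω) = (1/π²) ∫_{D(0,R)∖Ω} ∫_{D(0,R)∖Ω} log (1/|z - ζ|) dm(z) dm(ζ)`. -/
def energy (R : ℝ) (Ω : Set ℂ) : ℝ :=
  (1 / Real.pi ^ 2) *
    ∫ ζ in ball (0 : ℂ) R \ Ω, ∫ z in ball (0 : ℂ) R \ Ω, Real.log (1 / ‖z - ζ‖)

end MomentCoordinates

end

namespace MomentCoordinates

variable {N : ℕ}


/-! Everything is pulled back to the unit disk by `f = polyMap a`. When the coefficients move with
velocity `b`, put `ḟ = polyMap b`; then `∫_Ω φ dm` varies at the rate `∫ n φ(f) dθ` over the unit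
circle, where `n = Re (ḟ · conj (ζ f'))` is `normalVar a b`. The theorem rests on one algebraic
fact: on the circle `ζ^(N+1) n` is a polynomial without constant term (`pow_mul_normalVar`,
`normalPoly_zero_right`). By the mean value property, `n` is therefore orthogonal to `ζ^(N+1) r` for
every `r` holomorphic in the disk and continuous up to the circle.

Coordinates. If the variation of `M_0, …, M_N` vanishes, then `n` is orthogonal to `1, f, …, f^N`.
As `f^k = a_0^k ζ^k + …` with `a_0 ≠ 0`, a triangular argument makes `n` orthogonal to all entire
functions, and, `n` being real, finally to itself; so `n = 0` (`normalVar_eq_zero`). Then `ḟ / (ζ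
f')` is holomorphic in the disk, has zero real part on the circle and a real value at the origin, so
it vanishes (`eq_zero_of_normalVar_eq_zero`). The differential of the moment map is thus injective,
and the inverse function theorem applies.

Energy. The logarithmic potential of a disk is quadratic inside the disk, so expanding the double
integral over the complement of `Ω` gives `F_R = C + c M_0 + prepot`, where `prepot` combines `∫_Ω
|z|² dm` with the logarithmic energy of `Ω` and does not involve `R` (`exists_energy_eq`). The
energy of `Ω` varies at twice the rate `∫ n V dθ`, where `V = logPot a` is the integral of `log |z -
f(w)|` over `Ω` (`exists_hasFDerivAt_selfEnergy`). Inside `Ω` the gradient of `V - (π/2) |f|²` is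
given by the Cauchy transform of `conj z` along the boundary, whose Taylor coefficients at the
origin are the negative moments. Subtracting the first `N` Taylor terms leaves a gradient of the
form `Re (w^N q(w) dw)` with `q` holomorphic, and by the algebraic fact such a remainder pairs with
`n` as if it were constant (`integral_normalVar_mul_eq`). Hence, up to a multiple of `dM_0`, the
differential of `prepot` is `2 Re ∑ (M_{-k} / k) dM_k` (`exists_hasFDerivAt_prepot`).

Both conclusions are read off from this formula: the Wirtinger derivative of the energy is `M_{-k} /
k`, and the symmetry of the second derivative of `prepot` gives the integrability relations
(`wirtinger_comm`). -/

/-! ### Polar coordinates and the divergence theorem on the unit disk. -/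

theorem hasFDerivAt_polar (x : ℝ × ℝ) :
    HasFDerivAt (fun x : ℝ × ℝ => (x.1 : ℂ) * Complex.exp (x.2 * Complex.I))
      ((ContinuousLinearMap.fst ℝ ℝ ℝ).smulRight (Complex.exp (x.2 * Complex.I)) +
        (ContinuousLinearMap.snd ℝ ℝ ℝ).smulRight
          ((x.1 : ℂ) * (Complex.I * Complex.exp (x.2 * Complex.I)))) x := by
  have h1 : HasFDerivAt (fun x : ℝ × ℝ => (x.1 : ℂ))
      (Complex.ofRealCLM.comp (ContinuousLinearMap.fst ℝ ℝ ℝ)) x :=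
    (Complex.ofRealCLM.hasFDerivAt).comp x hasFDerivAt_fst
  have h2 : HasFDerivAt (fun x : ℝ × ℝ => (x.2 : ℂ) * Complex.I)
      ((Complex.ofRealCLM.comp (ContinuousLinearMap.snd ℝ ℝ ℝ)).smulRight Complex.I) x := by
    have := ((Complex.ofRealCLM.hasFDerivAt).comp x (hasFDerivAt_snd (𝕜 := ℝ) (p := x))).mul_const
      Complex.I
    convert! this using 1
    ext <;> simp
  convert! h1.mul h2.cexp using 1
  ext <;> simp [mul_comm]

theorem polar_coord_symm_eq (x : ℝ × ℝ) :
    Complex.measurableEquivRealProd.symm (polarCoord.symm x) =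
      (x.1 : ℂ) * Complex.exp (x.2 * Complex.I) := by
  rw [Complex.measurableEquivRealProd_symm_polarCoord_symm_apply, Complex.polarCoord_symm_apply,
    Complex.exp_mul_I]
  simp

theorem norm_polar (r θ : ℝ) : ‖(r : ℂ) * Complex.exp (θ * Complex.I)‖ = |r| := by
  rw [norm_mul, Complex.norm_exp_ofReal_mul_I, mul_one, Complex.norm_real, Real.norm_eq_abs]

theorem integral_polar_ball_one {E : Type*} [NormedAddCommGroup E] [NormedSpace ℝ E]
    {g : ℂ → E} (hg : IntegrableOn g (ball 0 1)) :
    IntegrableOn (fun x : ℝ × ℝ => x.1 • g (x.1 * Complex.exp (x.2 * Complex.I)))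
        (Icc 0 1 ×ˢ Icc (-Real.pi) Real.pi) ∧
    ∫ z in ball (0 : ℂ) 1, g z = ∫ r in (0 : ℝ)..1, ∫ θ in (-Real.pi)..Real.pi,
      r • g (r * Complex.exp (θ * Complex.I)) := by
  have hpi := Real.pi_pos
  set G : ℝ × ℝ → E := fun x => x.1 • g (x.1 * Complex.exp (x.2 * Complex.I)) with hG
  have hset : (Icc (0 : ℝ) 1 ×ˢ Icc (-Real.pi) Real.pi : Set (ℝ × ℝ)) =ᵐ[volume]
      (Ioo (0 : ℝ) 1 ×ˢ Ioo (-Real.pi) Real.pi : Set (ℝ × ℝ)) :=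
    Measure.set_prod_ae_eq Ioo_ae_eq_Icc.symm Ioo_ae_eq_Icc.symm
  have hT : (Ioo (0 : ℝ) 1 ×ˢ Ioo (-Real.pi) Real.pi : Set (ℝ × ℝ)) ⊆ polarCoord.target := by
    rintro x ⟨h1, h2⟩
    exact ⟨h1.1, h2⟩
  have hind : ∀ x ∈ polarCoord.target, x.1 • (ball (0 : ℂ) 1).indicator g
      (x.1 * Complex.exp (x.2 * Complex.I)) =
      (Ioo (0 : ℝ) 1 ×ˢ Ioo (-Real.pi) Real.pi : Set (ℝ × ℝ)).indicator G x := by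
    rintro x ⟨h1, h2⟩
    have h1' : 0 < x.1 := h1
    by_cases hx : x.1 < 1
    · rw [indicator_of_mem, indicator_of_mem]
      · exact ⟨⟨h1, hx⟩, h2⟩
      · rw [mem_ball_zero_iff, norm_polar, abs_of_pos h1']; exact hx
    · rw [indicator_of_notMem, indicator_of_notMem, smul_zero]
      · exact fun h => hx h.1.2
      · rw [mem_ball_zero_iff, norm_polar, abs_of_pos h1']; exact hx
  have hint : IntegrableOn G (Ioo 0 1 ×ˢ Ioo (-Real.pi) Real.pi) := by
    have h1 : Integrable ((ball (0 : ℂ) 1).indicator g) :=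
      (integrable_indicator_iff measurableSet_ball).2 hg
    have h2 := (Complex.volume_preserving_equiv_real_prod.symm).integrable_comp_of_integrable h1
    have h3 := (integrableOn_image_iff_integrableOn_abs_det_fderiv_smul volume
      polarCoord.open_target.measurableSet
      (fun p _ => (hasFDerivAt_polarCoord_symm p).hasFDerivWithinAt) polarCoord.symm.injOn _).1
      (h2.integrableOn (s := polarCoord.symm '' polarCoord.target))
    have h4 : IntegrableOn ((Ioo (0 : ℝ) 1 ×ˢ Ioo (-Real.pi) Real.pi : Set (ℝ × ℝ)).indicator G)
        polarCoord.target := by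
      refine h3.congr_fun (fun x hx => ?_) polarCoord.open_target.measurableSet
      have h1' : 0 < x.1 := hx.1
      rw [← hind x hx]
      simp only [det_fderivPolarCoordSymm, Function.comp, polar_coord_symm_eq, abs_of_pos h1']
    refine (h4.mono_set hT).congr_fun (fun x hx => ?_)
      (measurableSet_Ioo.prod measurableSet_Ioo)
    rw [indicator_of_mem hx]
  have hint2 : IntegrableOn G (Icc 0 1 ×ˢ Icc (-Real.pi) Real.pi) := hint.congr_set_ae hset
  refine ⟨hint2, ?_⟩
  rw [← integral_indicator measurableSet_ball, ← Complex.integral_comp_polarCoord_symm]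
  have h5 : ∀ x ∈ polarCoord.target, x.1 • (ball (0 : ℂ) 1).indicator g
      (Complex.polarCoord.symm x) =
      (Ioo (0 : ℝ) 1 ×ˢ Ioo (-Real.pi) Real.pi : Set (ℝ × ℝ)).indicator G x := by
    intro x hx
    rw [← Complex.measurableEquivRealProd_symm_polarCoord_symm_apply, polar_coord_symm_eq,
      hind x hx]
  rw [setIntegral_congr_fun polarCoord.open_target.measurableSet h5,
    setIntegral_indicator (measurableSet_Ioo.prod measurableSet_Ioo),
    inter_eq_right.2 hT, ← setIntegral_congr_set hset, Measure.volume_eq_prod,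
    setIntegral_prod _ hint2, intervalIntegral.integral_of_le zero_le_one,
    integral_Icc_eq_integral_Ioc]
  refine setIntegral_congr_fun measurableSet_Ioc fun r _ => ?_
  simp only [intervalIntegral.integral_of_le (by linarith : -Real.pi ≤ Real.pi),
    integral_Icc_eq_integral_Ioc, hG]

theorem countable_polar_preimage {s : Set ℂ} (hs : s.Countable) :
    ((Ioo (0 : ℝ) 1 ×ˢ Ioo (-Real.pi) Real.pi) ∩
      (fun x : ℝ × ℝ => (x.1 : ℂ) * Complex.exp (x.2 * Complex.I)) ⁻¹' s).Countable := by
  refine MapsTo.countable_of_injOn (f := fun x : ℝ × ℝ => (x.1 : ℂ) * Complex.exp (x.2 * Complex.I))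
    (t := s) (fun x hx => hx.2) ?_ hs
  rintro x ⟨hx, -⟩ y ⟨hy, -⟩ hxy
  simp only [← polar_coord_symm_eq] at hxy
  exact polarCoord.symm.injOn ⟨hx.1.1, hx.2⟩ ⟨hy.1.1, hy.2⟩
    (Complex.measurableEquivRealProd.symm.injective hxy)

/-- The divergence theorem on the unit disk. -/
theorem integral_divergence_ball_one {E : Type*} [NormedAddCommGroup E] [NormedSpace ℝ E]
    [CompleteSpace E] {P Q : ℂ → E} {P' Q' : ℂ → ℂ →L[ℝ] E} {s : Set ℂ} (hs : s.Countable)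
    (hP : ContinuousOn P (closedBall 0 1)) (hQ : ContinuousOn Q (closedBall 0 1))
    (hP' : ∀ z ∈ ball (0 : ℂ) 1 \ s, HasFDerivAt P (P' z) z)
    (hQ' : ∀ z ∈ ball (0 : ℂ) 1 \ s, HasFDerivAt Q (Q' z) z)
    (hi : IntegrableOn (fun z => P' z 1 + Q' z Complex.I) (ball 0 1)) :
    ∫ z in ball (0 : ℂ) 1, (P' z 1 + Q' z Complex.I) =
      ∫ θ in (0 : ℝ)..2 * Real.pi, (Real.cos θ • P (Complex.exp (θ * Complex.I)) +
        Real.sin θ • Q (Complex.exp (θ * Complex.I))) := by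
  have hpi := Real.pi_pos
  obtain ⟨hint, heq⟩ := integral_polar_ball_one hi
  set z : ℝ × ℝ → ℂ := fun x => (x.1 : ℂ) * Complex.exp (x.2 * Complex.I) with hz
  set z' : ℝ × ℝ → ℝ × ℝ →L[ℝ] ℂ := fun x =>
    (ContinuousLinearMap.fst ℝ ℝ ℝ).smulRight (Complex.exp (x.2 * Complex.I)) +
        (ContinuousLinearMap.snd ℝ ℝ ℝ).smulRight
          ((x.1 : ℂ) * (Complex.I * Complex.exp (x.2 * Complex.I))) with hz'
  have hzc : Continuous z := by fun_prop
  have hzm : MapsTo z (uIcc 0 1 ×ˢ uIcc (-Real.pi) Real.pi) (closedBall 0 1) := by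
    rintro x ⟨h1, -⟩
    rw [uIcc_of_le zero_le_one] at h1
    rw [mem_closedBall_zero_iff, norm_polar, abs_of_nonneg h1.1]
    exact h1.2
  have hPz := hP.comp hzc.continuousOn hzm
  have hQz := hQ.comp hzc.continuousOn hzm
  -- `f` is `r` times the radial component of the field and `g` its angular component, so that `∂_r
  -- f + ∂_θ g` is `r` times the divergence. On the boundary of the rectangle the side `r = 0`
  -- contributes nothing because of the factor `r`, the sides `θ = ±π` cancel by periodicity, and `r
  -- = 1` gives the flux. The countable set `s` leaves room for the pole of a logarithm.
  let f : ℝ × ℝ → E := fun x => x.1 • (Real.cos x.2 • P (z x) + Real.sin x.2 • Q (z x))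
  let g : ℝ × ℝ → E := fun x => (-Real.sin x.2) • P (z x) + Real.cos x.2 • Q (z x)
  have hd : ∀ x ∈ (Ioo (0 : ℝ) 1 ×ˢ Ioo (-Real.pi) Real.pi) \
      ((Ioo (0 : ℝ) 1 ×ˢ Ioo (-Real.pi) Real.pi) ∩ z ⁻¹' s), z x ∈ ball (0 : ℂ) 1 \ s := by
    rintro x ⟨hx, hxs⟩
    refine ⟨?_, fun h => hxs ⟨hx, h⟩⟩
    rw [mem_ball_zero_iff, norm_polar, abs_of_pos hx.1.1]
    exact hx.1.2
  have hsnd : ∀ x : ℝ × ℝ, HasFDerivAt (fun x : ℝ × ℝ => x.2) (ContinuousLinearMap.snd ℝ ℝ ℝ) x :=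
    fun x => hasFDerivAt_snd
  let f' : ℝ × ℝ → ℝ × ℝ →L[ℝ] E := fun x =>
    x.1 • ((Real.cos x.2 • (P' (z x)).comp (z' x) +
      (-Real.sin x.2 • ContinuousLinearMap.snd ℝ ℝ ℝ).smulRight (P (z x))) +
      (Real.sin x.2 • (Q' (z x)).comp (z' x) +
      (Real.cos x.2 • ContinuousLinearMap.snd ℝ ℝ ℝ).smulRight (Q (z x)))) +
    (ContinuousLinearMap.fst ℝ ℝ ℝ).smulRight (Real.cos x.2 • P (z x) + Real.sin x.2 • Q (z x))
  let g' : ℝ × ℝ → ℝ × ℝ →L[ℝ] E := fun x =>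
    ((-Real.sin x.2) • (P' (z x)).comp (z' x) +
      (-(Real.cos x.2 • ContinuousLinearMap.snd ℝ ℝ ℝ)).smulRight (P (z x))) +
      (Real.cos x.2 • (Q' (z x)).comp (z' x) +
      (-Real.sin x.2 • ContinuousLinearMap.snd ℝ ℝ ℝ).smulRight (Q (z x)))
  have hsum : ∀ x : ℝ × ℝ, f' x (1, 0) + g' x (0, 1) =
      x.1 • (P' (z x) 1 + Q' (z x) Complex.I) := by
    intro x
    have e1 : z' x (1, 0) = Real.cos x.2 • (1 : ℂ) + Real.sin x.2 • Complex.I := by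
      simp [hz', Complex.exp_mul_I]
    have e2 : z' x (0, 1) = x.1 • ((-Real.sin x.2) • (1 : ℂ) + Real.cos x.2 • Complex.I) := by
      simp [hz', Complex.exp_mul_I]
      ring_nf
      simp [sub_eq_add_neg]
    have e3 := Real.sin_sq_add_cos_sq x.2
    simp only [f', g', add_apply, smul_apply,
      ContinuousLinearMap.comp_apply, ContinuousLinearMap.smulRight_apply, e1, e2, map_add,
      map_smul, neg_apply, ContinuousLinearMap.coe_fst',
      ContinuousLinearMap.coe_snd']
    have e4 : Real.sin x.2 ^ 2 = 1 - Real.cos x.2 ^ 2 := by linarith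
    match_scalars <;> ring_nf <;> rw [e4] <;> ring
  have key := integral2_divergence_prod_of_hasFDerivAt_off_countable f g f' g' 0 (-Real.pi) 1
    Real.pi _ (countable_polar_preimage hs)
    (by
      refine continuousOn_fst.smul (ContinuousOn.add (ContinuousOn.smul ?_ hPz)
        (ContinuousOn.smul ?_ hQz)) <;> fun_prop)
    (by
      refine (ContinuousOn.add (ContinuousOn.smul ?_ hPz)
        (ContinuousOn.smul ?_ hQz)) <;> fun_prop)
    (by
      intro x hx
      simp only [min_eq_left zero_le_one, max_eq_right zero_le_one,
        min_eq_left (by linarith : -Real.pi ≤ Real.pi),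
        max_eq_right (by linarith : -Real.pi ≤ Real.pi)] at hx
      have h1 := (hP' _ (hd x hx)).comp x (hasFDerivAt_polar x)
      have h2 := (hQ' _ (hd x hx)).comp x (hasFDerivAt_polar x)
      exact hasFDerivAt_fst.smul (((hsnd x).cos.smul h1).add ((hsnd x).sin.smul h2)))
    (by
      intro x hx
      simp only [min_eq_left zero_le_one, max_eq_right zero_le_one,
        min_eq_left (by linarith : -Real.pi ≤ Real.pi),
        max_eq_right (by linarith : -Real.pi ≤ Real.pi)] at hx
      have h1 := (hP' _ (hd x hx)).comp x (hasFDerivAt_polar x)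
      have h2 := (hQ' _ (hd x hx)).comp x (hasFDerivAt_polar x)
      exact ((hsnd x).sin.neg.smul h1).add ((hsnd x).cos.smul h2))
    (by
      simp only [hsum]
      rw [uIcc_of_le zero_le_one, uIcc_of_le (by linarith : -Real.pi ≤ Real.pi)]
      exact hint)
  simp only [hsum] at key
  rw [heq]
  refine key.trans ?_
  have hgp : ∀ x : ℝ, g (x, Real.pi) = g (x, -Real.pi) := by
    intro x
    have : z (x, Real.pi) = z (x, -Real.pi) := by
      simp [hz, Complex.exp_mul_I]
    simp [g, this]
  have hper : Function.Periodic (fun θ : ℝ => (Real.cos θ • P (Complex.exp (θ * Complex.I)) +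
        Real.sin θ • Q (Complex.exp (θ * Complex.I)))) (2 * Real.pi) := by
    intro θ
    have : Complex.exp (((θ + 2 * Real.pi : ℝ) : ℂ) * Complex.I) = Complex.exp (θ * Complex.I) := by
      push_cast
      rw [add_mul, Complex.exp_periodic]
    simp only [this, Real.cos_add_two_pi, Real.sin_add_two_pi]
  have hp := hper.intervalIntegral_add_eq 0 (-Real.pi)
  rw [zero_add, show -Real.pi + 2 * Real.pi = Real.pi by ring] at hp
  rw [hp]
  simp [hgp, f, hz]

/-! ### Differentiation under the integral sign, and integrability of the logarithm. -/

theorem aestronglyMeasurable_smul_of_isCompact {F X : Type*} [NormedAddCommGroup F]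
    [NormedSpace ℝ F] [TopologicalSpace X] [MeasurableSpace X] [OpensMeasurableSpace X]
    [SecondCountableTopology X] [TopologicalSpace.PseudoMetrizableSpace X]
    {μ : Measure X} {K : Set X} (hK : IsCompact K) (hKm : MeasurableSet K)
    (hμ : ∀ᵐ x ∂μ, x ∈ K) {ρ : X → ℝ} (hρ : AEStronglyMeasurable ρ μ) {g : X → F}
    (hg : ContinuousOn g K) : AEStronglyMeasurable (fun x => ρ x • g x) μ := by
  have := hg.aestronglyMeasurable_of_isCompact (μ := μ) hK hKm
  rw [Measure.restrict_eq_self_of_ae_mem hμ] at this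
  exact hρ.smul this

/-- Differentiation under the integral sign, for an integrable weight times a family that is
continuously differentiable in the parameter, uniformly on a compact set. -/
theorem hasFDerivAt_integral_weight {𝕜 H E X : Type*} [RCLike 𝕜] [NormedAddCommGroup H]
    [NormedSpace 𝕜 H] [NormedAddCommGroup E] [NormedSpace ℝ E] [NormedSpace 𝕜 E]
    [SMulCommClass 𝕜 ℝ E] [TopologicalSpace X] [MeasurableSpace X] [OpensMeasurableSpace X]
    [SecondCountableTopology X] [TopologicalSpace.PseudoMetrizableSpace X]
    {μ : Measure X} {K : Set X} (hK : IsCompact K) (hKm : MeasurableSet K)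
    (hμ : ∀ᵐ x ∂μ, x ∈ K) {ρ : X → ℝ} (hρ : Integrable ρ μ) {a : H} {O : Set (H × X)}
    (hO : IsOpen O) (hsub : ∀ x ∈ K, (a, x) ∈ O) {k : H × X → E} {k' : H × X → H →L[𝕜] E}
    (hd : ∀ p ∈ O, HasFDerivAt (fun b => k (b, p.2)) (k' p) p.1)
    (hc : ContinuousOn k O) (hc' : ContinuousOn k' O) :
    HasFDerivAt (fun b => ∫ x, ρ x • k (b, x) ∂μ) (∫ x, ρ x • k' (a, x) ∂μ) a := by
  obtain ⟨C, hC⟩ := hK.exists_bound_of_continuousOn (f := fun x => k' (a, x))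
    (hc'.comp (by fun_prop) hsub)
  obtain ⟨C₁, hC₁⟩ := hK.exists_bound_of_continuousOn (f := fun x => k (a, x))
    (hc.comp (by fun_prop) hsub)
  -- The tube lemma turns the bound `C` at the single parameter `a` into the bound `C + 1` on a
  -- neighbourhood of `a`, uniformly over `K`.
  have hO' : IsOpen (O ∩ k' ⁻¹' ball 0 (C + 1)) := hc'.isOpen_inter_preimage hO isOpen_ball
  obtain ⟨u, v, hu, -, hau, hKv, huv⟩ := generalized_tube_lemma (isCompact_singleton (x := a)) hK
    hO' (by
      rintro ⟨b, x⟩ ⟨rfl, hx⟩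
      refine ⟨hsub x hx, ?_⟩
      rw [mem_preimage, mem_ball_zero_iff]
      linarith [hC x hx])
  have huO : ∀ b ∈ u, ∀ x ∈ K, (b, x) ∈ O ∩ k' ⁻¹' ball 0 (C + 1) := fun b hb x hx =>
    huv ⟨hb, hKv hx⟩
  have hs : u ∈ nhds a := hu.mem_nhds (hau rfl)
  refine hasFDerivAt_integral_of_dominated_of_fderiv_le (F := fun b x => ρ x • k (b, x))
    (F' := fun b x => ρ x • k' (b, x)) (bound := fun x => ‖ρ x‖ * (C + 1)) hs ?_ ?_ ?_ ?_ ?_ ?_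
  · filter_upwards [hs] with b hb
    exact aestronglyMeasurable_smul_of_isCompact hK hKm hμ hρ.aestronglyMeasurable
      (hc.comp (by fun_prop) fun x hx => (huO b hb x hx).1)
  · refine (hρ.norm.mul_const C₁).mono' (aestronglyMeasurable_smul_of_isCompact hK hKm hμ
      hρ.aestronglyMeasurable (hc.comp (by fun_prop) hsub)) ?_
    filter_upwards [hμ] with x hx
    rw [norm_smul]
    exact mul_le_mul_of_nonneg_left (hC₁ x hx) (norm_nonneg _)
  · exact aestronglyMeasurable_smul_of_isCompact hK hKm hμ hρ.aestronglyMeasurable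
      (hc'.comp (by fun_prop) hsub)
  · filter_upwards [hμ] with x hx b hb
    rw [norm_smul]
    have := (huO b hb x hx).2
    rw [mem_preimage, mem_ball_zero_iff] at this
    exact mul_le_mul_of_nonneg_left this.le (norm_nonneg _)
  · exact hρ.norm.mul_const _
  · filter_upwards [hμ] with x hx b hb
    exact (hd (b, x) (huO b hb x hx).1).const_smul (ρ x)

theorem integrableOn_log_norm (r : ℝ) : IntegrableOn (fun z : ℂ => Real.log ‖z‖) (ball 0 r) := by
  rw [integrableOn_fun_norm_addHaar volume (f := Real.log)]
  simp only [Complex.finrank_real_complex]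
  refine IntegrableOn.mono_set (t := Icc 0 r) ?_ (fun x hx => ⟨hx.1.le, hx.2.le⟩)
  refine ContinuousOn.integrableOn_compact isCompact_Icc ?_
  simpa using Real.continuous_mul_log.continuousOn

/-- By translation invariance the inner integral is bounded independently of `y`. The general
parameter space allows for points of the disk, points of the circle and a single point. -/
theorem integrable_log_norm_sub_prod {Y : Type*} [MeasurableSpace Y] {ν : Measure Y}
    [IsFiniteMeasure ν] {g : Y → ℂ} (hg : Measurable g) {R : ℝ} (hR : ∀ᵐ y ∂ν, ‖g y‖ ≤ R) (r : ℝ) :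
    Integrable (fun p : Y × ℂ => Real.log ‖g p.1 - p.2‖)
      (ν.prod (volume.restrict (ball 0 r))) := by
  -- The logarithm cut off at radius `R + r` is integrable on the whole plane and agrees with the
  -- kernel for all the points involved, so that its translates may be integrated over the plane.
  set L : ℂ → ℝ := (ball (0 : ℂ) (R + r)).indicator fun z => Real.log ‖z‖ with hL
  have hLi : Integrable L := (integrable_indicator_iff measurableSet_ball).2 (integrableOn_log_norm _)
  have hmem : ∀ y, ‖g y‖ ≤ R → ∀ w ∈ ball (0 : ℂ) r, Real.log ‖g y - w‖ = L (g y - w) := by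
    intro y hy w hw
    rw [hL, indicator_of_mem]
    rw [mem_ball_zero_iff] at hw ⊢
    linarith [norm_sub_le (g y) w]
  have hm : AEStronglyMeasurable (fun p : Y × ℂ => Real.log ‖g p.1 - p.2‖)
      (ν.prod (volume.restrict (ball 0 r))) :=
    (Real.measurable_log.comp ((hg.comp measurable_fst).sub measurable_snd).norm).aestronglyMeasurable
  rw [integrable_prod_iff hm]
  constructor
  · filter_upwards [hR] with y hy
    exact ((hLi.comp_sub_left (g y)).integrableOn.congr_fun
      (fun w hw => (hmem y hy w hw).symm) measurableSet_ball)
  · refine (integrable_const (∫ z, ‖L z‖)).mono' hm.norm.integral_prod_right' ?_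
    filter_upwards [hR] with y hy
    rw [Real.norm_of_nonneg (integral_nonneg fun _ => norm_nonneg _)]
    calc ∫ w in ball 0 r, ‖Real.log ‖g y - w‖‖ = ∫ w in ball 0 r, ‖L (g y - w)‖ :=
          setIntegral_congr_fun measurableSet_ball fun w hw => by simp only [hmem y hy w hw]
      _ ≤ ∫ w, ‖L (g y - w)‖ := setIntegral_le_integral (hLi.comp_sub_left (g y)).norm
          (Filter.Eventually.of_forall fun _ => norm_nonneg _)
      _ = ∫ z, ‖L z‖ := integral_sub_left_eq_self (fun z => ‖L z‖) volume (g y)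

/-- Differentiation under the integral sign with the derivative given along lines. -/
theorem exists_hasFDerivAt_integral {H X E : Type*} [NormedAddCommGroup H] [NormedSpace ℝ H]
    [NormedAddCommGroup X] [NormedSpace ℝ X] [MeasurableSpace X] [OpensMeasurableSpace X]
    [SecondCountableTopology X] [NormedAddCommGroup E] [NormedSpace ℝ E] [CompleteSpace E]
    {μ : Measure X} {K : Set X} (hK : IsCompact K) (hKm : MeasurableSet K)
    (hμ : ∀ᵐ x ∂μ, x ∈ K) {ρ : X → ℝ} (hρ : Integrable ρ μ) {a : H} {O : Set (H × X)}
    (hO : IsOpen O) (hsub : ∀ x ∈ K, (a, x) ∈ O) {k : H × X → E} (hk : ContDiffOn ℝ 1 k O)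
    {d : H → X → E}
    (hd : ∀ v, ∀ x ∈ K, HasDerivAt (fun t : ℝ => k (a + t • v, x)) (d v x) 0) :
    ∃ L : H →L[ℝ] E, HasFDerivAt (fun b => ∫ x, ρ x • k (b, x) ∂μ) L a ∧
      ∀ v, L v = ∫ x, ρ x • d v x ∂μ := by
  set k' : H × X → H →L[ℝ] E := fun p => (fderiv ℝ k p).comp (ContinuousLinearMap.inl ℝ H X)
  have hk' : ∀ p ∈ O, HasFDerivAt (fun b => k (b, p.2)) (k' p) p.1 := by
    intro p hp
    have h1 := ((hk.differentiableOn one_ne_zero).differentiableAt (hO.mem_nhds hp)).hasFDerivAt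
    exact HasFDerivAt.comp (g := k) (f := fun b : H => (b, p.2)) p.1 h1
      (hasFDerivAt_prodMk_left p.1 p.2)
  have hc' : ContinuousOn k' O := by
    have h1 := hk.continuousOn_fderiv_of_isOpen hO le_rfl
    exact h1.clm_comp continuousOn_const
  refine ⟨_, hasFDerivAt_integral_weight hK hKm hμ hρ hO hsub hk' hk.continuousOn hc', fun v => ?_⟩
  have hcK : ContinuousOn (fun x => k' (a, x)) K := hc'.comp (by fun_prop) hsub
  obtain ⟨C, hC⟩ := hK.exists_bound_of_continuousOn hcK
  have hint : Integrable (fun x => ρ x • k' (a, x)) μ := by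
    refine (hρ.norm.mul_const C).mono' (aestronglyMeasurable_smul_of_isCompact hK hKm hμ
      hρ.aestronglyMeasurable hcK) ?_
    filter_upwards [hμ] with x hx
    rw [norm_smul]
    exact mul_le_mul_of_nonneg_left (hC x hx) (norm_nonneg _)
  rw [ContinuousLinearMap.integral_apply hint]
  refine integral_congr_ae ?_
  filter_upwards [hμ] with x hx
  -- The derivative within a direction is identified by restricting to a line. This suits kernels
  -- built from `polyMap`, which is real-linear in the coefficients.
  have h1 : HasDerivAt (fun t : ℝ => a + t • v) v 0 := by
    simpa using ((hasDerivAt_id (0 : ℝ)).smul_const v).const_add a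
  have h2 := HasFDerivAt.comp_hasDerivAt_of_eq (0 : ℝ) (hk' (a, x) (hsub x hx)) h1 (by simp)
  rw [smul_apply, h2.unique (hd v x hx)]

theorem exists_hasFDerivAt_intervalIntegral {H E : Type*} [NormedAddCommGroup H] [NormedSpace ℝ H]
    [NormedAddCommGroup E] [NormedSpace ℝ E] [CompleteSpace E] {a : H} {s t : ℝ} (hst : s ≤ t)
    {O : Set (H × ℝ)} (hO : IsOpen O) (hsub : ∀ x ∈ Icc s t, (a, x) ∈ O) {k : H × ℝ → E}
    (hk : ContDiffOn ℝ 1 k O) {d : H → ℝ → E}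
    (hd : ∀ v, ∀ x ∈ Icc s t, HasDerivAt (fun r : ℝ => k (a + r • v, x)) (d v x) 0) :
    ∃ L : H →L[ℝ] E, HasFDerivAt (fun b => ∫ x in s..t, k (b, x)) L a ∧
      ∀ v, L v = ∫ x in s..t, d v x := by
  have := exists_hasFDerivAt_integral (μ := volume.restrict (Ioc s t)) (ρ := fun _ => (1 : ℝ))
    isCompact_Icc measurableSet_Icc
    ((ae_restrict_mem measurableSet_Ioc).mono fun x hx => ⟨hx.1.le, hx.2⟩)
    (integrable_const 1) hO hsub hk hd
  simpa only [one_smul, intervalIntegral.integral_of_le hst] using this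


/-! ### Divided differences and univalence up to the boundary. -/

/-- The derivative of `polyMap a`. -/
noncomputable def polyDeriv (a : Coord N) (ζ : ℂ) : ℂ :=
  (a.1 : ℂ) + ∑ k : Fin N, a.2 k * (((k : ℂ) + 2) * ζ ^ ((k : ℕ) + 1))

/-- The divided difference `(f(z) - f(w)) / (z - w)` of `f = polyMap a`. -/
noncomputable def divDiff (a : Coord N) (z w : ℂ) : ℂ :=
  (a.1 : ℂ) + ∑ k : Fin N, a.2 k *
    ∑ i ∈ Finset.range ((k : ℕ) + 2), z ^ i * w ^ ((k : ℕ) + 2 - 1 - i)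

theorem divDiff_mul_sub (a : Coord N) (z w : ℂ) :
    divDiff a z w * (z - w) = polyMap a z - polyMap a w := by
  have : ∀ k : Fin N, (∑ i ∈ Finset.range ((k : ℕ) + 2), z ^ i * w ^ ((k : ℕ) + 2 - 1 - i)) *
      (z - w) = z ^ ((k : ℕ) + 2) - w ^ ((k : ℕ) + 2) := fun k =>
    (Commute.all z w).geom_sum₂_mul _
  rw [divDiff, polyMap, polyMap, add_mul, Finset.sum_mul]
  simp only [mul_assoc, this]
  simp only [mul_sub, Finset.sum_sub_distrib]
  ring

theorem divDiff_self (a : Coord N) (z : ℂ) : divDiff a z z = polyDeriv a z := by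
  simp only [divDiff, polyDeriv]
  congr 1
  refine Finset.sum_congr rfl fun k _ => ?_
  congr 1
  rw [Finset.sum_congr rfl (g := fun _ => z ^ ((k : ℕ) + 1))]
  · simp
  · intro i hi
    rw [Finset.mem_range] at hi
    rw [← pow_add]
    congr 1
    omega

theorem polyMap_zero_right (a : Coord N) : polyMap a 0 = 0 := by simp [polyMap]

theorem divDiff_zero_right_mul (a : Coord N) (z : ℂ) : divDiff a z 0 * z = polyMap a z := by
  simpa [polyMap_zero_right] using divDiff_mul_sub a z 0

theorem polyDeriv_zero_right (a : Coord N) : polyDeriv a 0 = a.1 := by simp [polyDeriv]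

theorem contDiff_ofReal_comp {E : Type*} [NormedAddCommGroup E] [NormedSpace ℝ E] {f : E → ℝ}
    {n : WithTop ℕ∞} (hf : ContDiff ℝ n f) : ContDiff ℝ n (fun x => (f x : ℂ)) :=
  Complex.ofRealCLM.contDiff.comp hf

theorem contDiff_polyMap {n : WithTop ℕ∞} :
    ContDiff ℝ n (fun p : Coord N × ℂ => polyMap p.1 p.2) := by
  unfold polyMap
  have := contDiff_ofReal_comp (E := Coord N × ℂ) (f := fun p => p.1.1) (n := n) (by fun_prop)
  fun_prop

theorem contDiff_polyDeriv {n : WithTop ℕ∞} :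
    ContDiff ℝ n (fun p : Coord N × ℂ => polyDeriv p.1 p.2) := by
  unfold polyDeriv
  have := contDiff_ofReal_comp (E := Coord N × ℂ) (f := fun p => p.1.1) (n := n) (by fun_prop)
  fun_prop

theorem contDiff_divDiff {n : WithTop ℕ∞} :
    ContDiff ℝ n (fun p : Coord N × ℂ × ℂ => divDiff p.1 p.2.1 p.2.2) := by
  unfold divDiff
  have := contDiff_ofReal_comp (E := Coord N × ℂ × ℂ) (f := fun p => p.1.1) (n := n) (by fun_prop)
  fun_prop

theorem hasDerivAt_polyMap (a : Coord N) (z : ℂ) :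
    HasDerivAt (polyMap a) (polyDeriv a z) z := by
  unfold polyMap polyDeriv
  refine HasDerivAt.add ?_ (HasDerivAt.fun_sum fun k _ => ?_)
  · simpa using (hasDerivAt_id z).const_mul (a.1 : ℂ)
  · have := (hasDerivAt_pow ((k : ℕ) + 2) z).const_mul (a.2 k)
    simpa using this

theorem differentiable_polyMap (a : Coord N) : Differentiable ℂ (polyMap a) := fun z =>
  (hasDerivAt_polyMap a z).differentiableAt

theorem differentiable_polyDeriv (a : Coord N) : Differentiable ℂ (polyDeriv a) := by
  unfold polyDeriv
  fun_prop

theorem differentiable_divDiff_left (a : Coord N) (w : ℂ) :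
    Differentiable ℂ (fun z => divDiff a z w) := by
  unfold divDiff
  fun_prop

theorem differentiable_divDiff_right (a : Coord N) (z : ℂ) :
    Differentiable ℂ (fun w => divDiff a z w) := by
  unfold divDiff
  fun_prop

theorem continuous_polyMap (a : Coord N) : Continuous (polyMap a) :=
  (differentiable_polyMap a).continuous

theorem continuous_polyDeriv (a : Coord N) : Continuous (polyDeriv a) :=
  (differentiable_polyDeriv a).continuous

theorem continuous_divDiff (a : Coord N) : Continuous (fun p : ℂ × ℂ => divDiff a p.1 p.2) := by
  unfold divDiff
  fun_prop

theorem coord_sum_add_smul (a b : Coord N) (t : ℝ) (c : Fin N → ℂ) :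
    ∑ k, (a + t • b).2 k * c k = ∑ k, a.2 k * c k + t * ∑ k, b.2 k * c k := by
  rw [Finset.mul_sum, ← Finset.sum_add_distrib]
  refine Finset.sum_congr rfl fun k _ => ?_
  simp only [Prod.snd_add, Prod.smul_snd, Pi.add_apply, Pi.smul_apply, Complex.real_smul]
  ring

theorem polyMap_add_smul (a b : Coord N) (t : ℝ) (z : ℂ) :
    polyMap (a + t • b) z = polyMap a z + t * polyMap b z := by
  simp only [polyMap, coord_sum_add_smul]
  push_cast [Prod.fst_add, Prod.smul_fst, smul_eq_mul]
  ring

theorem polyDeriv_add_smul (a b : Coord N) (t : ℝ) (z : ℂ) :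
    polyDeriv (a + t • b) z = polyDeriv a z + t * polyDeriv b z := by
  simp only [polyDeriv, coord_sum_add_smul]
  push_cast [Prod.fst_add, Prod.smul_fst, smul_eq_mul]
  ring

theorem divDiff_add_smul (a b : Coord N) (t : ℝ) (z w : ℂ) :
    divDiff (a + t • b) z w = divDiff a z w + t * divDiff b z w := by
  simp only [divDiff, coord_sum_add_smul]
  push_cast [Prod.fst_add, Prod.smul_fst, smul_eq_mul]
  ring

/-- The divided difference of `polyMap a` has no zero on the closed bidisk. -/
def DivDiffNeZero (a : Coord N) : Prop :=
  ∀ z ∈ closedBall (0 : ℂ) 1, ∀ w ∈ closedBall (0 : ℂ) 1, divDiff a z w ≠ 0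

/-- A Hurwitz-type argument. Suppose `f'(z₀) = 0`. For `w` near `z₀` with `f'(w) ≠ 0`, the divided
difference `F(·, w)` has no zero near `z₀`, so `|F(z₀, w)|` is at least its minimum on a small
circle, which stays away from `0`; but `F(z₀, w)` tends to `f'(z₀) = 0`. So `f'` vanishes near `z₀`,
hence everywhere, against `f'(0) = a₀`. -/
theorem polyDeriv_ne_zero_of_injOn {a : Coord N} (ha : a.1 ≠ 0) {U : Set ℂ} (hU : IsOpen U)
    (hinj : InjOn (polyMap a) U) {z₀ : ℂ} (hz₀ : z₀ ∈ U) : polyDeriv a z₀ ≠ 0 := by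
  intro h0
  obtain ⟨r, hr, hrU⟩ := nhds_basis_closedBall.mem_iff.1 (hU.mem_nhds hz₀)
  have hne : ∀ z ∈ U, ∀ w ∈ U, z ≠ w → divDiff a z w ≠ 0 := by
    intro z hz w hw hzw h
    have := divDiff_mul_sub a z w
    rw [h, zero_mul, eq_comm, sub_eq_zero] at this
    exact hzw (hinj hz hw this)
  have hsph : ∀ z ∈ sphere z₀ r, z ∈ U ∧ z ≠ z₀ := fun z hz =>
    ⟨hrU (sphere_subset_closedBall hz), ne_of_mem_sphere hz hr.ne'⟩
  obtain ⟨m, hm, hmS⟩ : ∃ m > 0, ∀ z ∈ sphere z₀ r, m < ‖divDiff a z z₀‖ := by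
    have hc : ContinuousOn (fun z => ‖divDiff a z z₀‖) (sphere z₀ r) :=
      (differentiable_divDiff_left a z₀).continuous.norm.continuousOn
    obtain ⟨x, hx, hmin⟩ := (isCompact_sphere z₀ r).exists_isMinOn
      (NormedSpace.sphere_nonempty.2 hr.le) hc
    have hpos : 0 < ‖divDiff a x z₀‖ :=
      norm_pos_iff.2 (hne x (hsph x hx).1 z₀ hz₀ (hsph x hx).2)
    exact ⟨‖divDiff a x z₀‖ / 2, by positivity, fun z hz => by
      have : ‖divDiff a x z₀‖ ≤ ‖divDiff a z z₀‖ := hmin hz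
      linarith⟩
  have hev1 : ∀ᶠ w in nhds z₀, ∀ z ∈ sphere z₀ r, m < ‖divDiff a z w‖ := by
    refine (isCompact_sphere z₀ r).eventually_forall_of_forall_eventually fun z hz => ?_
    have hc : Continuous (fun p : ℂ × ℂ => ‖divDiff a p.2 p.1‖) :=
      ((continuous_divDiff a).comp continuous_swap).norm
    exact hc.continuousAt.eventually (lt_mem_nhds (hmS z hz))
  have hev2 : ∀ᶠ w in nhds z₀, ‖divDiff a z₀ w‖ < m := by
    have hc : Continuous (fun w => ‖divDiff a z₀ w‖) :=
      (differentiable_divDiff_right a z₀).continuous.norm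
    refine hc.continuousAt.eventually (gt_mem_nhds ?_)
    simpa only [divDiff_self, h0, norm_zero] using hm
  have hev3 : ∀ᶠ w in nhds z₀, polyDeriv a w = 0 := by
    filter_upwards [hev1, hev2, hU.mem_nhds hz₀] with w h1 h2 hwU
    by_contra hw
    have hnz : ∀ z ∈ closedBall z₀ r, divDiff a z w ≠ 0 := by
      intro z hz
      by_cases hzw : z = w
      · rwa [hzw, divDiff_self]
      · exact hne z (hrU hz) w hwU hzw
    have hcl : closure (ball z₀ r) = closedBall z₀ r := closure_ball z₀ hr.ne'
    -- The minimum modulus principle, in the form of the maximum principle for the reciprocal.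
    have hd : DiffContOnCl ℂ (fun z => (divDiff a z w)⁻¹) (ball z₀ r) :=
      DiffContOnCl.inv (differentiable_divDiff_left a w).diffContOnCl
        (by rw [hcl]; exact hnz)
    have := Complex.norm_le_of_forall_mem_frontier_norm_le isBounded_ball hd (C := m⁻¹)
      (by
        intro z hz
        rw [frontier_ball z₀ hr.ne'] at hz
        rw [norm_inv]
        exact inv_anti₀ hm (h1 z hz).le) (subset_closure (mem_ball_self hr))
    rw [norm_inv] at this
    have h3 := norm_pos_iff.2 (hnz z₀ (mem_closedBall_self hr.le))
    have := (inv_le_inv₀ h3 hm).1 this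
    linarith
  have hz : polyDeriv a = fun _ => 0 :=
    (((differentiable_polyDeriv a).differentiableOn.analyticOnNhd isOpen_univ).eq_of_eventuallyEq
      (analyticOnNhd_const) hev3)
  have := polyDeriv_zero_right a
  rw [hz] at this
  exact ha (Complex.ofReal_eq_zero.1 this.symm)

/-- This trades univalence near the closed disk for the nonvanishing of a polynomial on a compact
set, which is an open condition and also what keeps logarithms and quotients smooth. Conversely, the
tube lemma gives open sets `U` and `V` around the closed disk such that the divided difference is
nonzero on `U × V`, and `U ∩ V` is a neighbourhood of injectivity. -/
theorem mem_univalentSet_iff {a : Coord N} : a ∈ univalentSet N ↔ 0 < a.1 ∧ DivDiffNeZero a := by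
  refine and_congr_right fun ha => ⟨?_, fun h => ?_⟩
  · rintro ⟨U, hU, hKU, hinj⟩ z hz w hw h
    by_cases hzw : z = w
    · subst hzw
      rw [divDiff_self] at h
      exact polyDeriv_ne_zero_of_injOn ha.ne' hU hinj (hKU hz) h
    · have := divDiff_mul_sub a z w
      rw [h, zero_mul, eq_comm, sub_eq_zero] at this
      exact hzw (hinj (hKU hz) (hKU hw) this)
  · have hO : IsOpen {p : ℂ × ℂ | divDiff a p.1 p.2 ≠ 0} :=
      isOpen_ne_fun (continuous_divDiff a) continuous_const
    obtain ⟨U, V, hU, hV, hKU, hKV, hUV⟩ := generalized_tube_lemma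
      (isCompact_closedBall (0 : ℂ) 1) (isCompact_closedBall (0 : ℂ) 1) hO
      (fun p hp => h p.1 hp.1 p.2 hp.2)
    refine ⟨U ∩ V, hU.inter hV, subset_inter hKU hKV, fun z hz w hw hzw => ?_⟩
    have h1 := divDiff_mul_sub a z w
    rw [hzw, sub_self, mul_eq_zero] at h1
    have h2 : divDiff a z w ≠ 0 := @hUV (z, w) (mk_mem_prod hz.1 hw.2)
    exact sub_eq_zero.1 (h1.resolve_left h2)

theorem isOpen_divDiffNeZero : IsOpen {a : Coord N | DivDiffNeZero a} := by
  rw [isOpen_iff_eventually]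
  intro a ha
  have hc : Continuous (fun p : Coord N × ℂ × ℂ => divDiff p.1 p.2.1 p.2.2) :=
    (contDiff_divDiff (n := 0)).continuous
  have h := ((isCompact_closedBall (0 : ℂ) 1).prod (isCompact_closedBall (0 : ℂ) 1)
    ).eventually_forall_of_forall_eventually (x₀ := a)
      (P := fun b p => divDiff b p.1 p.2 ≠ 0) (fun p hp =>
      hc.continuousAt.eventually_ne (ha p.1 hp.1 p.2 hp.2))
  filter_upwards [h] with b hb z hz w hw
  exact hb (z, w) ⟨hz, hw⟩

theorem isOpen_univalentSet : IsOpen (univalentSet N) := by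
  have : univalentSet N = {a | 0 < a.1} ∩ {a | DivDiffNeZero a} := by
    ext a
    exact mem_univalentSet_iff
  rw [this]
  exact (isOpen_lt continuous_const continuous_fst).inter isOpen_divDiffNeZero

/-! ### The first variation of integrals over the moving domain. -/

theorem integral_exp_mul_I_of_diffContOnCl {g : ℂ → ℂ} (hg : DiffContOnCl ℂ g (ball 0 1)) :
    ∫ θ in (0 : ℝ)..2 * Real.pi, g (Complex.exp (θ * Complex.I)) = 2 * Real.pi * g 0 := by
  have h1 := hg.circleIntegral_sub_inv_smul (mem_ball_self one_pos)
  rw [circleIntegral] at h1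
  simp only [deriv_circleMap, circleMap, sub_zero, zero_add, Complex.ofReal_one, one_mul,
    smul_eq_mul] at h1
  have h2 : ∀ θ : ℝ, Complex.exp (θ * Complex.I) * Complex.I *
      ((Complex.exp (θ * Complex.I))⁻¹ * g (Complex.exp (θ * Complex.I))) =
      Complex.I * g (Complex.exp (θ * Complex.I)) := fun θ => by
    have := Complex.exp_ne_zero (θ * Complex.I)
    field_simp
  simp only [h2] at h1
  rw [intervalIntegral.integral_const_mul] at h1
  have h3 : Complex.I * (∫ θ in (0 : ℝ)..2 * Real.pi, g (Complex.exp (θ * Complex.I))) =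
      Complex.I * (2 * Real.pi * g 0) := by rw [h1]; ring
  exact mul_left_cancel₀ Complex.I_ne_zero h3

theorem norm_exp_mul_I_mem_closedBall (θ : ℝ) :
    Complex.exp (θ * Complex.I) ∈ closedBall (0 : ℂ) 1 := by
  rw [mem_closedBall_zero_iff, Complex.norm_exp_ofReal_mul_I]

theorem hasFDerivAt_mul_conj {g k : ℂ → ℂ} {g' k' z : ℂ} (hg : HasDerivAt g g' z)
    (hk : HasDerivAt k k' z) :
    HasFDerivAt (fun z => g z * conj (k z)) (g z • (Complex.conjCLE : ℂ →L[ℝ] ℂ).comp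
      (k' • (1 : ℂ →L[ℝ] ℂ)) + conj (k z) • (g' • (1 : ℂ →L[ℝ] ℂ))) z := by
  have h1 := hg.complexToReal_fderiv
  have h2 := ((Complex.conjCLE : ℂ →L[ℝ] ℂ).hasFDerivAt (x := k z)).comp z hk.complexToReal_fderiv
  exact h1.mul h2

/-- The Jacobian `|f'|²` of `f = polyMap a`. -/
noncomputable def jac (a : Coord N) (z : ℂ) : ℝ := Complex.normSq (polyDeriv a z)

/-- The derivative of the Jacobian of `polyMap a` in the direction `b`. -/
noncomputable def jacVar (a b : Coord N) (z : ℂ) : ℝ :=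
  2 * (polyDeriv b z * conj (polyDeriv a z)).re

/-- The normal velocity of the boundary, times the length element, when `a` moves with
velocity `b`. -/
noncomputable def normalVar (a b : Coord N) (θ : ℝ) : ℝ :=
  (polyMap b (Complex.exp (θ * Complex.I)) * conj (Complex.exp (θ * Complex.I) *
    polyDeriv a (Complex.exp (θ * Complex.I)))).re

theorem continuous_normalVar (a b : Coord N) : Continuous (normalVar a b) := by
  unfold normalVar
  have h1 := continuous_polyMap b
  have h2 := continuous_polyDeriv a
  fun_prop

theorem contDiff_jac {n : WithTop ℕ∞} : ContDiff ℝ n (fun p : Coord N × ℂ => jac p.1 p.2) := by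
  have h : ContDiff ℝ n (fun z : ℂ => Complex.normSq z) := by
    simp only [Complex.normSq_apply]
    exact (Complex.reCLM.contDiff.mul Complex.reCLM.contDiff).add
      (Complex.imCLM.contDiff.mul Complex.imCLM.contDiff)
  exact h.comp contDiff_polyDeriv

theorem continuous_jac (a : Coord N) : Continuous (jac a) :=
  (contDiff_jac (n := 0)).continuous.comp (by fun_prop : Continuous fun z : ℂ => (a, z))

theorem continuous_jacVar (a b : Coord N) : Continuous (jacVar a b) := by
  unfold jacVar
  have h1 := continuous_polyDeriv b
  have h2 := continuous_polyDeriv a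
  fun_prop

theorem hasDerivAt_polyMap_line (a b : Coord N) (z : ℂ) :
    HasDerivAt (fun t : ℝ => polyMap (a + t • b) z) (polyMap b z) 0 := by
  simp only [polyMap_add_smul]
  simpa using ((Complex.ofRealCLM.hasDerivAt (x := (0 : ℝ))).mul_const (polyMap b z)).const_add
    (polyMap a z)

theorem hasDerivAt_polyDeriv_line (a b : Coord N) (z : ℂ) :
    HasDerivAt (fun t : ℝ => polyDeriv (a + t • b) z) (polyDeriv b z) 0 := by
  simp only [polyDeriv_add_smul]
  simpa using ((Complex.ofRealCLM.hasDerivAt (x := (0 : ℝ))).mul_const (polyDeriv b z)).const_add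
    (polyDeriv a z)

theorem hasDerivAt_divDiff_line (a b : Coord N) (z w : ℂ) :
    HasDerivAt (fun t : ℝ => divDiff (a + t • b) z w) (divDiff b z w) 0 := by
  simp only [divDiff_add_smul]
  simpa using ((Complex.ofRealCLM.hasDerivAt (x := (0 : ℝ))).mul_const (divDiff b z w)).const_add
    (divDiff a z w)

theorem hasDerivAt_jac_line (a b : Coord N) (z : ℂ) :
    HasDerivAt (fun t : ℝ => jac (a + t • b) z) (jacVar a b z) 0 := by
  have h := hasDerivAt_polyDeriv_line a b z
  have hre := Complex.reCLM.hasFDerivAt.comp_hasDerivAt (0 : ℝ) h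
  have him := Complex.imCLM.hasFDerivAt.comp_hasDerivAt (0 : ℝ) h
  have := (hre.mul hre).add (him.mul him)
  refine this.congr_deriv ?_
  simp [jacVar]
  ring

/-- The flux of `ψ` times the vector field `ḟ conj f'` through the unit circle. -/
theorem integral_flux {E : Type*} [NormedAddCommGroup E] [NormedSpace ℝ E] [CompleteSpace E]
    (a b : Coord N) {ψ : ℂ → E} {ψ' : ℂ → ℂ →L[ℝ] E} (hψ : ContinuousOn ψ (closedBall 0 1))
    (hψ' : ∀ z ∈ ball (0 : ℂ) 1, HasFDerivAt ψ (ψ' z) z)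
    (hi : IntegrableOn (fun z => ψ' z (polyMap b z * conj (polyDeriv a z)) + jacVar a b z • ψ z)
      (ball 0 1)) :
    ∫ z in ball (0 : ℂ) 1, (ψ' z (polyMap b z * conj (polyDeriv a z)) + jacVar a b z • ψ z) =
      ∫ θ in (0 : ℝ)..2 * Real.pi, normalVar a b θ • ψ (Complex.exp (θ * Complex.I)) := by
  set X : ℂ → ℂ := fun z => polyMap b z * conj (polyDeriv a z) with hX
  set X' : ℂ → ℂ →L[ℝ] ℂ := fun z => polyMap b z • (Complex.conjCLE : ℂ →L[ℝ] ℂ).comp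
      (deriv (polyDeriv a) z • (1 : ℂ →L[ℝ] ℂ)) +
      conj (polyDeriv a z) • (polyDeriv b z • (1 : ℂ →L[ℝ] ℂ)) with hX'
  have hXd : ∀ z, HasFDerivAt X (X' z) z := fun z =>
    hasFDerivAt_mul_conj (hasDerivAt_polyMap b z) (differentiable_polyDeriv a z).hasDerivAt
  have hXc : Continuous X := by
    have h1 := continuous_polyMap b
    have h2 := continuous_polyDeriv a
    fun_prop
  have hre : ∀ z, HasFDerivAt (fun z => (X z).re) (Complex.reCLM.comp (X' z)) z := fun z =>
    Complex.reCLM.hasFDerivAt.comp z (hXd z)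
  have him : ∀ z, HasFDerivAt (fun z => (X z).im) (Complex.imCLM.comp (X' z)) z := fun z =>
    Complex.imCLM.hasFDerivAt.comp z (hXd z)
  -- This is `div (ψ X) = dψ(X) + ψ div X`. The divergence of `X = ḟ conj f'` is `2 Re ∂_z X = 2 Re
  -- (ḟ' conj f')`, that is `jacVar`, since the antiholomorphic factor does not contribute to `∂_z`.
  have hsum : ∀ z, ((X z).re • ψ' z + (Complex.reCLM.comp (X' z)).smulRight (ψ z)) 1 +
      ((X z).im • ψ' z + (Complex.imCLM.comp (X' z)).smulRight (ψ z)) Complex.I =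
      ψ' z (X z) + jacVar a b z • ψ z := by
    intro z
    have h1 : X z = (X z).re • (1 : ℂ) + (X z).im • Complex.I := by
      simp [Complex.re_add_im]
    conv_rhs => rw [h1]
    have h2 : (X' z 1).re + (X' z Complex.I).im = jacVar a b z := by
      simp [hX', jacVar]
      ring
    simp only [add_apply, smul_apply, ContinuousLinearMap.smulRight_apply,
      ContinuousLinearMap.comp_apply, Complex.reCLM_apply, Complex.imCLM_apply, map_add, map_smul,
      ← h2, add_smul]
    abel
  have key := integral_divergence_ball_one (P := fun z => (X z).re • ψ z)
    (Q := fun z => (X z).im • ψ z)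
    (P' := fun z => (X z).re • ψ' z + (Complex.reCLM.comp (X' z)).smulRight (ψ z))
    (Q' := fun z => (X z).im • ψ' z + (Complex.imCLM.comp (X' z)).smulRight (ψ z))
    countable_empty
    ((Complex.continuous_re.comp hXc).continuousOn.smul hψ)
    ((Complex.continuous_im.comp hXc).continuousOn.smul hψ)
    (fun z hz => (hre z).smul (hψ' z hz.1)) (fun z hz => (him z).smul (hψ' z hz.1))
    (by simpa only [hsum] using hi)
  simp only [hsum] at key
  rw [key]
  refine intervalIntegral.integral_congr fun θ _ => ?_
  simp only [smul_smul, ← add_smul]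
  congr 1
  have h3 : conj (Complex.exp (θ * Complex.I)) = Real.cos θ - Real.sin θ * Complex.I := by
    rw [Complex.exp_mul_I]
    simp [← Complex.cos_conj, ← Complex.sin_conj, sub_eq_add_neg]
  rw [normalVar, map_mul, h3, hX]
  simp [-Complex.ofReal_cos, -Complex.ofReal_sin]
  ring

theorem det_smul_one (c : ℂ) : (c • (1 : ℂ →L[ℝ] ℂ)).det = Complex.normSq c := by
  rw [← Algebra.norm_complex_apply, Algebra.norm_apply]
  rfl

theorem DivDiffNeZero.injOn {a : Coord N} (ha : DivDiffNeZero a) :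
    InjOn (polyMap a) (closedBall 0 1) := by
  intro z hz w hw h
  have := divDiff_mul_sub a z w
  rw [h, sub_self, mul_eq_zero] at this
  exact sub_eq_zero.1 (this.resolve_left (ha z hz w hw))

theorem setIntegral_domainOf {E : Type*} [NormedAddCommGroup E] [NormedSpace ℝ E] {a : Coord N}
    (ha : DivDiffNeZero a) (g : ℂ → E) :
    ∫ z in domainOf a, g z = ∫ z in ball (0 : ℂ) 1, jac a z • g (polyMap a z) := by
  rw [domainOf, integral_image_eq_integral_abs_det_fderiv_smul volume measurableSet_ball
    (fun z _ => (hasDerivAt_polyMap a z).complexToReal_fderiv.hasFDerivWithinAt)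
    (ha.injOn.mono ball_subset_closedBall)]
  simp only [det_smul_one, abs_of_nonneg (Complex.normSq_nonneg _), jac]

theorem ae_mem_closedBall : ∀ᵐ z ∂(volume.restrict (ball (0 : ℂ) 1)), z ∈ closedBall (0 : ℂ) 1 :=
  (ae_restrict_mem measurableSet_ball).mono fun _ hz => ball_subset_closedBall hz

instance : IsFiniteMeasure (volume.restrict (ball (0 : ℂ) 1)) :=
  ⟨by rw [Measure.restrict_apply_univ]; exact measure_ball_lt_top⟩

theorem Continuous.integrableOn_ball_one {E : Type*} [NormedAddCommGroup E] {g : ℂ → E}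
    (hg : Continuous g) : IntegrableOn g (ball 0 1) :=
  (hg.continuousOn.integrableOn_compact (isCompact_closedBall _ _)).mono_set ball_subset_closedBall

/-- The variation of `∫_Ω φ dm`. -/
theorem exists_hasFDerivAt_integral_comp_polyMap {E : Type*} [NormedAddCommGroup E]
    [NormedSpace ℝ E] [CompleteSpace E] {φ : ℂ → E} (hφ : ContDiff ℝ 1 φ) (a : Coord N) :
    ∃ L : Coord N →L[ℝ] E,
      HasFDerivAt (fun b => ∫ z in ball (0 : ℂ) 1, jac b z • φ (polyMap b z)) L a ∧
      ∀ b, L b = ∫ θ in (0 : ℝ)..2 * Real.pi,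
        normalVar a b θ • φ (polyMap a (Complex.exp (θ * Complex.I))) := by
  have hline : ∀ b : Coord N, ∀ z, HasDerivAt (fun t : ℝ => jac (a + t • b) z •
      φ (polyMap (a + t • b) z)) (fderiv ℝ φ (polyMap a z) (jac a z • polyMap b z) +
        jacVar a b z • φ (polyMap a z)) 0 := by
    intro b z
    have h1 := HasFDerivAt.comp_hasDerivAt_of_eq (0 : ℝ)
      (hφ.differentiable one_ne_zero (polyMap a z)).hasFDerivAt (hasDerivAt_polyMap_line a b z)
      (by simp)
    refine ((hasDerivAt_jac_line a b z).smul h1).congr_deriv ?_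
    simp only [map_smul, zero_smul, add_zero, Function.comp]
  obtain ⟨L, hL, hLb⟩ := exists_hasFDerivAt_integral (μ := volume.restrict (ball (0 : ℂ) 1))
    (ρ := fun _ => (1 : ℝ)) (a := a) (isCompact_closedBall (0 : ℂ) 1) measurableSet_closedBall
    ae_mem_closedBall (integrable_const 1) isOpen_univ (fun _ _ => mem_univ _)
    (k := fun p : Coord N × ℂ => jac p.1 p.2 • φ (polyMap p.1 p.2))
    (contDiff_jac.smul (hφ.comp contDiff_polyMap)).contDiffOn (fun b z _ => hline b z)
  simp only [one_smul] at hL hLb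
  refine ⟨L, hL, fun b => ?_⟩
  rw [hLb]
  -- The differential of `f` maps the field `ḟ conj f'` to `|f'|² ḟ`. Therefore the derivative of
  -- `|f'|² φ(f)` along the motion is a divergence on the disk, and only the flux through the circle
  -- survives.
  have hX : ∀ z, polyDeriv a z * (polyMap b z * conj (polyDeriv a z)) = jac a z • polyMap b z := by
    intro z
    rw [jac, Complex.real_smul, Complex.normSq_eq_conj_mul_self]
    ring
  have hpc := continuous_polyMap a
  have key := integral_flux a b (ψ := fun z => φ (polyMap a z))
    (ψ' := fun z => (fderiv ℝ φ (polyMap a z)).comp (polyDeriv a z • (1 : ℂ →L[ℝ] ℂ)))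
    (hφ.continuous.comp hpc).continuousOn
    (fun z _ => (hφ.differentiable one_ne_zero (polyMap a z)).hasFDerivAt.comp z
      (hasDerivAt_polyMap a z).complexToReal_fderiv)
  simp only [ContinuousLinearMap.comp_apply, smul_apply,
    one_apply_eq_self, smul_eq_mul, hX] at key
  refine key (Continuous.integrableOn_ball_one ?_)
  have h1 := hφ.continuous_fderiv one_ne_zero
  have h2 := continuous_jac a
  have h3 := continuous_polyMap b
  have h4 := continuous_jacVar a b
  have h5 := hφ.continuous
  exact ((h1.comp hpc).clm_apply (h2.smul h3)).add (h4.smul (h5.comp hpc))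

/-! ### Smoothness of the moments and their differential. -/

/-- The derivative of the integral is again an integral of the same kind, with values in a space of
linear maps; this is why the spaces are quantified inside the induction. -/
theorem contDiff_integral_ball_one_nat (n : ℕ) : ∀ {E H : Type} [NormedAddCommGroup E]
    [NormedSpace ℝ E] [CompleteSpace E] [NormedAddCommGroup H] [NormedSpace ℝ H] {k : H × ℂ → E},
    ContDiff ℝ ∞ k → ContDiff ℝ n (fun b => ∫ z in ball (0 : ℂ) 1, k (b, z)) := by
  induction n with
  | zero =>
    intro E H _ _ _ _ _ k hk
    refine contDiff_zero.2 (continuous_iff_continuousAt.2 fun a => ?_)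
    have hk1 : ContDiff ℝ 1 k := hk.of_le (by norm_cast)
    have hd : ∀ p, HasFDerivAt (fun b => k (b, p.2))
        ((fderiv ℝ k p).comp (ContinuousLinearMap.inl ℝ H ℂ)) p.1 := fun p =>
      HasFDerivAt.comp (g := k) (f := fun b : H => (b, p.2)) p.1
        (hk1.differentiable one_ne_zero p).hasFDerivAt (hasFDerivAt_prodMk_left p.1 p.2)
    have := hasFDerivAt_integral_weight (a := a) (isCompact_closedBall (0 : ℂ) 1)
      measurableSet_closedBall
      ae_mem_closedBall (integrable_const (1 : ℝ)) isOpen_univ (fun _ _ => mem_univ _)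
      (fun p _ => hd p) hk.continuous.continuousOn
      ((hk1.continuous_fderiv one_ne_zero).clm_comp continuous_const).continuousOn
    simpa only [one_smul] using this.continuousAt
  | succ n ih =>
    intro E H _ _ _ _ _ k hk
    have hk1 : ContDiff ℝ 1 k := hk.of_le (by norm_cast)
    set k' : H × ℂ → H →L[ℝ] E := fun p =>
      (fderiv ℝ k p).comp (ContinuousLinearMap.inl ℝ H ℂ) with hk'
    have hd : ∀ p, HasFDerivAt (fun b => k (b, p.2)) (k' p) p.1 := fun p =>
      HasFDerivAt.comp (g := k) (f := fun b : H => (b, p.2)) p.1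
        (hk1.differentiable one_ne_zero p).hasFDerivAt (hasFDerivAt_prodMk_left p.1 p.2)
    have hk's : ContDiff ℝ ∞ k' := (hk.fderiv_right (m := ∞) (by norm_cast)).clm_comp contDiff_const
    have h1 : ∀ a, HasFDerivAt (fun b => ∫ z in ball (0 : ℂ) 1, k (b, z))
        (∫ z in ball (0 : ℂ) 1, k' (a, z)) a := fun a => by
      have := hasFDerivAt_integral_weight (a := a) (isCompact_closedBall (0 : ℂ) 1)
        measurableSet_closedBall
        ae_mem_closedBall (integrable_const (1 : ℝ)) isOpen_univ (fun _ _ => mem_univ _)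
        (fun p _ => hd p) hk.continuous.continuousOn hk's.continuous.continuousOn
      simpa only [one_smul] using this
    push_cast
    rw [contDiff_succ_iff_fderiv]
    refine ⟨fun a => (h1 a).differentiableAt, by simp, ?_⟩
    have h2 : fderiv ℝ (fun b => ∫ z in ball (0 : ℂ) 1, k (b, z)) =
        fun a => ∫ z in ball (0 : ℂ) 1, k' (a, z) := funext fun a => (h1 a).fderiv
    rw [h2]
    exact ih hk's

theorem contDiff_integral_ball_one {E H : Type} [NormedAddCommGroup E]
    [NormedSpace ℝ E] [CompleteSpace E] [NormedAddCommGroup H] [NormedSpace ℝ H] {k : H × ℂ → E}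
    (hk : ContDiff ℝ ∞ k) : ContDiff ℝ ∞ (fun b => ∫ z in ball (0 : ℂ) 1, k (b, z)) :=
  contDiff_infty.2 fun n => contDiff_integral_ball_one_nat n hk

/-- The moment `(1/π) ∫_Ω z^k dm`, pulled back to the unit disk. -/
noncomputable def diskMoment (k : ℕ) (a : Coord N) : ℂ :=
  (1 / (Real.pi : ℂ)) * ∫ z in ball (0 : ℂ) 1, jac a z • polyMap a z ^ k

theorem harmonicMoment_domainOf {a : Coord N} (ha : DivDiffNeZero a) (k : ℕ) :
    harmonicMoment (domainOf a) k = diskMoment k a := by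
  rw [harmonicMoment, setIntegral_domainOf ha, diskMoment]

theorem contDiff_diskMoment (k : ℕ) : ContDiff ℝ ∞ (diskMoment (N := N) k) := by
  refine contDiff_const.mul (contDiff_integral_ball_one
    (k := fun p : Coord N × ℂ => jac p.1 p.2 • polyMap p.1 p.2 ^ k) ?_)
  exact contDiff_jac.smul (contDiff_polyMap.pow k)

theorem exists_hasFDerivAt_diskMoment (k : ℕ) (a : Coord N) :
    ∃ L : Coord N →L[ℝ] ℂ, HasFDerivAt (diskMoment k) L a ∧
      ∀ b, L b = (1 / (Real.pi : ℂ)) * ∫ θ in (0 : ℝ)..2 * Real.pi,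
        (normalVar a b θ : ℂ) * polyMap a (Complex.exp (θ * Complex.I)) ^ k := by
  obtain ⟨L, hL, hLb⟩ := exists_hasFDerivAt_integral_comp_polyMap (φ := fun z : ℂ => z ^ k)
    (by fun_prop) a
  refine ⟨(1 / (Real.pi : ℂ)) • L, hL.const_mul _, fun b => ?_⟩
  rw [smul_apply, hLb, smul_eq_mul]
  simp only [Complex.real_smul]

/-- The moments as functions of the coefficients, pulled back to the unit disk. -/
noncomputable def diskMomentMap (a : Coord N) : Coord N :=
  ((diskMoment 0 a).re, fun k => diskMoment ((k : ℕ) + 1) a)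

/-- The change of variables needs injectivity of `f`, but the integrals over the disk are smooth on
the whole coefficient space. All calculus is therefore done with `diskMomentMap`. -/
theorem momentMap_eq {a : Coord N} (ha : DivDiffNeZero a) : momentMap a = diskMomentMap a := by
  simp only [momentMap, diskMomentMap, harmonicMoment_domainOf ha]

theorem contDiff_diskMomentMap : ContDiff ℝ ∞ (diskMomentMap (N := N)) :=
  (Complex.reCLM.contDiff.comp (contDiff_diskMoment 0)).prodMk
    (contDiff_pi.2 fun _ => contDiff_diskMoment _)

theorem exists_hasFDerivAt_diskMomentMap (a : Coord N) :
    ∃ L : Coord N →L[ℝ] Coord N, HasFDerivAt diskMomentMap L a ∧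
      ∀ b, (((L b).1 : ℂ) = (1 / (Real.pi : ℂ)) * ∫ θ in (0 : ℝ)..2 * Real.pi,
        (normalVar a b θ : ℂ)) ∧
      ∀ k, (L b).2 k = (1 / (Real.pi : ℂ)) * ∫ θ in (0 : ℝ)..2 * Real.pi,
        (normalVar a b θ : ℂ) * polyMap a (Complex.exp (θ * Complex.I)) ^ ((k : ℕ) + 1) := by
  choose L hL hLb using fun k => exists_hasFDerivAt_diskMoment k a
  refine ⟨(Complex.reCLM.comp (L 0)).prod (ContinuousLinearMap.pi fun k : Fin N => L (k + 1)),
    (Complex.reCLM.hasFDerivAt.comp a (hL 0)).prodMk (hasFDerivAt_pi.2 fun _ => hL _),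
    fun b => ⟨?_, fun k => hLb _ b⟩⟩
  -- The first coordinate of the moment map is a real part; since the variation of `M₀` is real, no
  -- information is lost.
  have h : (L 0 b).im = 0 := by
    rw [hLb]
    simp only [pow_zero, mul_one, intervalIntegral.integral_ofReal]
    rw [← Complex.ofReal_one, ← Complex.ofReal_div, ← Complex.ofReal_mul, Complex.ofReal_im]
  have h2 : ((L 0 b).re : ℂ) = L 0 b := Complex.ext (by simp) (by simp [h])
  simpa [hLb] using h2

/-! ### Injectivity of the differential of the moment map. -/

/-- `ζ^{N+1}` times the conjugate of `polyMap b`, on the unit circle. -/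
noncomputable def revMap (b : Coord N) (ζ : ℂ) : ℂ :=
  (b.1 : ℂ) * ζ ^ N + ∑ k : Fin N, conj (b.2 k) * ζ ^ (N - 1 - (k : ℕ))

/-- `ζ^{N+1}` times the conjugate of `ζ ↦ ζ * polyDeriv a ζ`, on the unit circle. -/
noncomputable def revDeriv (a : Coord N) (ζ : ℂ) : ℂ :=
  (a.1 : ℂ) * ζ ^ N + ∑ k : Fin N, conj (a.2 k) * (((k : ℂ) + 2) * ζ ^ (N - 1 - (k : ℕ)))

theorem pow_mul_conj_pow {ζ : ℂ} (hζ : ‖ζ‖ = 1) {m n : ℕ} (h : n ≤ m) :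
    ζ ^ m * conj ζ ^ n = ζ ^ (m - n) := by
  have h1 : ζ * conj ζ = 1 := by rw [Complex.mul_conj, Complex.normSq_eq_norm_sq, hζ]; simp
  obtain ⟨l, rfl⟩ := Nat.exists_eq_add_of_le' h
  rw [pow_add, mul_assoc, ← mul_pow, h1, one_pow, mul_one, Nat.add_sub_cancel]

theorem pow_mul_conj_polyMap (b : Coord N) {ζ : ℂ} (hζ : ‖ζ‖ = 1) :
    ζ ^ (N + 1) * conj (polyMap b ζ) = revMap b ζ := by
  simp only [polyMap, revMap, map_add, map_mul, map_sum, map_pow, Complex.conj_ofReal, mul_add,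
    Finset.mul_sum]
  congr 1
  · rw [mul_left_comm, ← pow_one (conj ζ), pow_mul_conj_pow hζ (by omega)]; rfl
  · refine Finset.sum_congr rfl fun k _ => ?_
    rw [mul_left_comm, pow_mul_conj_pow hζ (by omega)]
    congr 2
    omega

theorem pow_mul_conj_polyDeriv (a : Coord N) {ζ : ℂ} (hζ : ‖ζ‖ = 1) :
    ζ ^ (N + 1) * conj (ζ * polyDeriv a ζ) = revDeriv a ζ := by
  simp only [polyDeriv, revDeriv, map_add, map_mul, map_sum, map_pow, Complex.conj_ofReal, mul_add,
    Finset.mul_sum, Complex.conj_natCast, map_ofNat]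
  congr 1
  · rw [mul_comm (conj ζ), mul_left_comm, ← pow_one (conj ζ), pow_mul_conj_pow hζ (by omega)]; rfl
  · refine Finset.sum_congr rfl fun k _ => ?_
    have := pow_mul_conj_pow hζ (show (k : ℕ) + 2 ≤ N + 1 by omega)
    rw [show N - 1 - (k : ℕ) = N + 1 - ((k : ℕ) + 2) by omega, ← this]
    ring

/-- `ζ^{N+1}` times the normal variation is the restriction of a polynomial without constant
term. -/
noncomputable def normalPoly (a b : Coord N) (ζ : ℂ) : ℂ :=
  (1 / 2) * (polyMap b ζ * revDeriv a ζ + ζ * polyDeriv a ζ * revMap b ζ)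

theorem normalPoly_zero_right (a b : Coord N) : normalPoly a b 0 = 0 := by
  simp [normalPoly, polyMap_zero_right]

theorem differentiable_normalPoly (a b : Coord N) : Differentiable ℂ (normalPoly a b) := by
  have h1 := differentiable_polyMap b
  have h2 := differentiable_polyDeriv a
  unfold normalPoly revDeriv revMap
  fun_prop

/-- On the circle `conj ζ = 1/ζ`, and both `ḟ` and `ζ f'` have degree at most `N + 1`, so
multiplication by `ζ^(N+1)` clears all negative powers. There is no constant term because `ḟ` and `ζ
f'` vanish at `0`. -/
theorem pow_mul_normalVar (a b : Coord N) (θ : ℝ) :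
    Complex.exp (θ * Complex.I) ^ (N + 1) * normalVar a b θ =
      normalPoly a b (Complex.exp (θ * Complex.I)) := by
  have h := Complex.norm_exp_ofReal_mul_I θ
  rw [normalVar, Complex.re_eq_add_conj, normalPoly, ← pow_mul_conj_polyMap b h,
    ← pow_mul_conj_polyDeriv a h]
  simp only [map_mul, Complex.conj_conj]
  ring

theorem exists_eq_mul_of_differentiable {r : ℂ → ℂ} (hr : Differentiable ℂ r) :
    ∃ s : ℂ → ℂ, Differentiable ℂ s ∧ ∀ z, r z = r 0 + z * s z := by
  refine ⟨dslope r 0, ?_, fun z => ?_⟩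
  · rw [← differentiableOn_univ] at hr ⊢
    exact (Complex.differentiableOn_dslope Filter.univ_mem).2 hr
  · have := sub_smul_dslope r 0 z
    rw [sub_zero, smul_eq_mul] at this
    rw [this]
    ring

theorem intervalIntegrable_of_continuous_exp {g : ℂ → ℂ} (hg : Continuous g) (a b : Coord N) :
    IntervalIntegrable (fun θ : ℝ => (normalVar a b θ : ℂ) * g (Complex.exp (θ * Complex.I)))
      volume 0 (2 * Real.pi) := by
  have h := continuous_normalVar a b
  exact Continuous.intervalIntegrable (by fun_prop) _ _

/-- If the pairings of the normal variation with `1, f, …, f^N` vanish, so do those with all entire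
functions. -/
theorem integral_normalVar_mul_eq_zero {a b : Coord N} (ha : a.1 ≠ 0)
    (h : ∀ k ≤ N, ∫ θ in (0 : ℝ)..2 * Real.pi,
      (normalVar a b θ : ℂ) * polyMap a (Complex.exp (θ * Complex.I)) ^ k = 0)
    {r : ℂ → ℂ} (hr : Differentiable ℂ r) :
    ∫ θ in (0 : ℝ)..2 * Real.pi, (normalVar a b θ : ℂ) * r (Complex.exp (θ * Complex.I)) = 0 := by
  suffices H : ∀ j ≤ N + 1, ∀ r : ℂ → ℂ, Differentiable ℂ r → ∫ θ in (0 : ℝ)..2 * Real.pi,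
      (normalVar a b θ : ℂ) * (Complex.exp (θ * Complex.I) ^ (N + 1 - j) *
        r (Complex.exp (θ * Complex.I))) = 0 by
    simpa using H (N + 1) le_rfl r hr
  intro j
  induction j with
  | zero =>
    intro _ r hr
    -- The top power `ζ^(N+1)` needs no hypothesis on the moments: it is the mean value property for
    -- `normalPoly a b * r`, which vanishes at the origin.
    have h1 := integral_exp_mul_I_of_diffContOnCl
      ((differentiable_normalPoly a b).mul hr).diffContOnCl
    simp only [Pi.mul_apply, normalPoly_zero_right, zero_mul, mul_zero, ← pow_mul_normalVar] at h1
    rw [← h1]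
    refine intervalIntegral.integral_congr fun θ _ => ?_
    simp only [Nat.sub_zero]
    ring
  | succ j ih =>
    intro hj r hr
    set k := N + 1 - (j + 1) with hk
    have hk1 : N + 1 - j = k + 1 := by omega
    set f₁ : ℂ → ℂ := fun z => divDiff a z 0 with hf₁
    have hf₁d : Differentiable ℂ f₁ := differentiable_divDiff_left a 0
    have hf₁0 : f₁ 0 = a.1 := by rw [hf₁]; simp only [divDiff_self, polyDeriv_zero_right]
    have hne : f₁ 0 ^ k ≠ 0 := by
      rw [hf₁0]
      exact pow_ne_zero _ (Complex.ofReal_ne_zero.2 ha)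
    -- Since `f = ζ f₁` with `f₁(0) = a₀ ≠ 0`, a multiple of `f^k` removes the `ζ^k` term of `ζ^k
    -- r`. What remains is divisible by `ζ^(k+1)`, where the induction hypothesis applies.
    obtain ⟨s, hs, hrs⟩ := exists_eq_mul_of_differentiable
      (r := fun z => r z - (r 0 / f₁ 0 ^ k) * f₁ z ^ k) (by fun_prop)
    have hrz : ∀ z, z ^ k * r z = (r 0 / f₁ 0 ^ k) * polyMap a z ^ k + z ^ (k + 1) * s z := by
      intro z
      have h1 := hrs z
      simp only [div_mul_cancel₀ _ hne, sub_self, zero_add] at h1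
      rw [sub_eq_iff_eq_add] at h1
      rw [h1, ← divDiff_zero_right_mul a z, mul_pow]
      ring
    have hc := intervalIntegrable_of_continuous_exp (g := fun z => polyMap a z ^ k)
      ((continuous_polyMap a).pow k) a b
    have hc2 := intervalIntegrable_of_continuous_exp (g := fun z => z ^ (k + 1) * s z)
      ((continuous_pow (k + 1)).mul hs.continuous) a b
    have h2 := ih (by omega) s hs
    rw [hk1] at h2
    calc _ = ∫ θ in (0 : ℝ)..2 * Real.pi, ((r 0 / f₁ 0 ^ k) * ((normalVar a b θ : ℂ) *
          polyMap a (Complex.exp (θ * Complex.I)) ^ k) + (normalVar a b θ : ℂ) *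
          (Complex.exp (θ * Complex.I) ^ (k + 1) * s (Complex.exp (θ * Complex.I)))) := by
          refine intervalIntegral.integral_congr fun θ _ => ?_
          simp only [hrz]
          ring
      _ = 0 := by
          rw [intervalIntegral.integral_add (hc.const_mul _) hc2,
            intervalIntegral.integral_const_mul, h k (by omega), h2, mul_zero, add_zero]

/-- Write `r = r(0) + ζ s`. In the second term `ζ conj ζ = 1` lowers the power of the conjugate; the
first is a pure power of the conjugate, dealt with by the reality of the normal variation. -/
theorem integral_normalVar_mul_conj_pow_eq_zero {a b : Coord N} (n : ℕ)
    (h : ∀ r : ℂ → ℂ, Differentiable ℂ r → ∫ θ in (0 : ℝ)..2 * Real.pi,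
      (normalVar a b θ : ℂ) * r (Complex.exp (θ * Complex.I)) = 0) :
    ∀ r : ℂ → ℂ, Differentiable ℂ r → ∫ θ in (0 : ℝ)..2 * Real.pi, (normalVar a b θ : ℂ) *
      (r (Complex.exp (θ * Complex.I)) * conj (Complex.exp (θ * Complex.I)) ^ n) = 0 := by
  induction n with
  | zero => simpa using h
  | succ n ih =>
    intro r hr
    obtain ⟨s, hs, hrs⟩ := exists_eq_mul_of_differentiable hr
    have h1 : ∀ θ : ℝ, Complex.exp (θ * Complex.I) * conj (Complex.exp (θ * Complex.I)) = 1 := by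
      intro θ
      rw [Complex.mul_conj, Complex.normSq_eq_norm_sq, Complex.norm_exp_ofReal_mul_I]
      simp
    have hc := intervalIntegrable_of_continuous_exp (g := fun z => conj z ^ (n + 1))
      (by fun_prop) a b
    have hsc := hs.continuous
    have hc2 := intervalIntegrable_of_continuous_exp (g := fun z => s z * conj z ^ n)
      (by fun_prop) a b
    have h3 : ∫ θ in (0 : ℝ)..2 * Real.pi, (normalVar a b θ : ℂ) *
        conj (Complex.exp (θ * Complex.I)) ^ (n + 1) = 0 := by
      have h4 := congrArg conj (h (fun z => z ^ (n + 1)) (by fun_prop))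
      have h5 := (Complex.conjCLE : ℂ →L[ℝ] ℂ).intervalIntegral_comp_comm
        (intervalIntegrable_of_continuous_exp (g := fun z => z ^ (n + 1)) (by fun_prop) a b)
      simp only [ContinuousLinearEquiv.coe_coe, Complex.conjCLE_apply] at h5
      rw [← h5] at h4
      simpa using h4
    calc _ = ∫ θ in (0 : ℝ)..2 * Real.pi, (r 0 * ((normalVar a b θ : ℂ) *
          conj (Complex.exp (θ * Complex.I)) ^ (n + 1)) + (normalVar a b θ : ℂ) *
          (s (Complex.exp (θ * Complex.I)) * conj (Complex.exp (θ * Complex.I)) ^ n)) := by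
          refine intervalIntegral.integral_congr fun θ _ => ?_
          simp only [hrs (Complex.exp (θ * Complex.I)), pow_succ]
          linear_combination ((normalVar a b θ : ℂ) * s (Complex.exp (θ * Complex.I)) *
            conj (Complex.exp (θ * Complex.I)) ^ n) * h1 θ
      _ = 0 := by
          rw [intervalIntegral.integral_add (hc.const_mul _) hc2,
            intervalIntegral.integral_const_mul, h3, ih s hs, mul_zero, add_zero]

/-- The normal variation is itself the real part of a sum of entire functions times powers of `conj
ζ`, all orthogonal to it. Its square integral is thus zero. -/
theorem normalVar_eq_zero {a b : Coord N} (ha : a.1 ≠ 0)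
    (h : ∀ k ≤ N, ∫ θ in (0 : ℝ)..2 * Real.pi,
      (normalVar a b θ : ℂ) * polyMap a (Complex.exp (θ * Complex.I)) ^ k = 0) :
    ∀ θ ∈ Icc (0 : ℝ) (2 * Real.pi), normalVar a b θ = 0 := by
  have h0 : ∀ r : ℂ → ℂ, Differentiable ℂ r → ∫ θ in (0 : ℝ)..2 * Real.pi,
      (normalVar a b θ : ℂ) * r (Complex.exp (θ * Complex.I)) = 0 := fun r hr =>
    integral_normalVar_mul_eq_zero ha h hr
  have h1 : ∫ θ in (0 : ℝ)..2 * Real.pi, (normalVar a b θ : ℂ) *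
      (polyMap b (Complex.exp (θ * Complex.I)) * conj (Complex.exp (θ * Complex.I) *
        polyDeriv a (Complex.exp (θ * Complex.I)))) = 0 := by
    have hpc := continuous_polyMap b
    have hc := fun n : ℕ => intervalIntegrable_of_continuous_exp
      (g := fun z => polyMap b z * conj z ^ n) (by fun_prop) a b
    have hi := fun n : ℕ => integral_normalVar_mul_conj_pow_eq_zero n h0 _ (differentiable_polyMap b)
    calc _ = ∫ θ in (0 : ℝ)..2 * Real.pi, ((a.1 : ℂ) * ((normalVar a b θ : ℂ) *
          (polyMap b (Complex.exp (θ * Complex.I)) * conj (Complex.exp (θ * Complex.I)) ^ 1)) +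
          ∑ k : Fin N, conj (a.2 k) * ((k : ℂ) + 2) * ((normalVar a b θ : ℂ) *
          (polyMap b (Complex.exp (θ * Complex.I)) *
            conj (Complex.exp (θ * Complex.I)) ^ ((k : ℕ) + 2)))) := by
          refine intervalIntegral.integral_congr fun θ _ => ?_
          simp only [polyDeriv, map_add, map_mul, map_sum, map_pow, Complex.conj_ofReal,
            Complex.conj_natCast, map_ofNat, mul_add, Finset.mul_sum]
          congr 1
          · ring
          · refine Finset.sum_congr rfl fun k _ => ?_
            ring
      _ = 0 := by
          rw [intervalIntegral.integral_add ((hc 1).const_mul _),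
            intervalIntegral.integral_const_mul, hi, intervalIntegral.integral_finsetSum]
          · simp only [intervalIntegral.integral_const_mul, hi, mul_zero, Finset.sum_const_zero,
              add_zero]
          · exact fun k _ => (hc _).const_mul _
          · have := continuous_normalVar a b
            exact Continuous.intervalIntegrable (by fun_prop) _ _
  have h2 : ∫ θ in (0 : ℝ)..2 * Real.pi, normalVar a b θ ^ 2 = 0 := by
    have h3 := congrArg Complex.re h1
    have hg : Continuous fun z : ℂ => polyMap b z * conj (z * polyDeriv a z) := by
      have h5 := continuous_polyMap b
      have h6 := continuous_polyDeriv a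
      fun_prop
    have h4 := Complex.reCLM.intervalIntegral_comp_comm
      (intervalIntegrable_of_continuous_exp hg a b)
    simp only [Complex.reCLM_apply] at h4
    rw [← h4] at h3
    rw [Complex.zero_re] at h3
    refine Eq.trans ?_ h3
    refine intervalIntegral.integral_congr fun θ _ => ?_
    simp only [Complex.re_ofReal_mul]
    rw [sq]
    rfl
  intro θ hθ
  by_contra hne
  have h5 := intervalIntegral.integral_pos (f := fun θ => normalVar a b θ ^ 2) Real.two_pi_pos
    ((continuous_normalVar a b).pow 2).continuousOn (fun _ _ => sq_nonneg _)
    ⟨θ, hθ, by positivity⟩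
  exact h5.ne' h2

theorem eq_zero_of_polyMap_eq_zero {b : Coord N}
    (h : ∀ θ ∈ Icc (0 : ℝ) (2 * Real.pi), polyMap b (Complex.exp (θ * Complex.I)) = 0) : b = 0 := by
  set p : Polynomial ℂ := Polynomial.C (b.1 : ℂ) * Polynomial.X +
    ∑ k : Fin N, Polynomial.C (b.2 k) * Polynomial.X ^ ((k : ℕ) + 2) with hp
  have hev : ∀ z, p.eval z = polyMap b z := by
    intro z
    simp [hp, polyMap, Polynomial.eval_finsetSum]
  have hp0 : p = 0 := by
    refine Polynomial.eq_zero_of_infinite_isRoot p ?_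
    have hinj : InjOn (fun θ : ℝ => Complex.exp (θ * Complex.I)) (Ico 0 (0 + 2 * Real.pi)) := by
      have := injOn_circleMap_of_abs_sub_le' (c := 0) (R := 1) one_ne_zero
        (a := 0) (b := 0 + 2 * Real.pi) (by simp)
      refine this.congr fun θ _ => ?_
      simp [circleMap]
    refine ((Ico_infinite (by linarith [Real.two_pi_pos])).image hinj).mono ?_
    rintro _ ⟨θ, hθ, rfl⟩
    rw [zero_add] at hθ
    exact (hev _).trans (h θ ⟨hθ.1, hθ.2.le⟩)
  refine Prod.ext ?_ (funext fun k => ?_)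
  · have := congrArg (fun q => Polynomial.coeff q 1) hp0
    simpa [hp, Polynomial.coeff_X_pow] using this
  · have := congrArg (fun q => Polynomial.coeff q ((k : ℕ) + 2)) hp0
    simpa [hp, Polynomial.coeff_X_pow, Polynomial.coeff_X, Fin.val_inj] using this

/-- The holomorphic function `v = ḟ / (ζ f')` satisfies `normalVar = |f'|² Re v` on the circle, so
its real part vanishes there; `v(0) = b₀ / a₀` is real because the leading coefficients are real.
This is where the normalisation of `f` excludes the rotations `ḟ = i ζ f'`. -/
theorem eq_zero_of_normalVar_eq_zero {a b : Coord N} (ha : DivDiffNeZero a)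
    (h : ∀ θ ∈ Icc (0 : ℝ) (2 * Real.pi), normalVar a b θ = 0) : b = 0 := by
  have hD : ∀ z ∈ closedBall (0 : ℂ) 1, polyDeriv a z ≠ 0 := fun z hz => by
    rw [← divDiff_self]
    exact ha z hz z hz
  set v : ℂ → ℂ := fun z => divDiff b z 0 * (polyDeriv a z)⁻¹ with hv
  have hvd : DiffContOnCl ℂ v (ball 0 1) := by
    refine (differentiable_divDiff_left b 0).diffContOnCl.smul
      (DiffContOnCl.inv (differentiable_polyDeriv a).diffContOnCl ?_)
    rw [closure_ball _ one_ne_zero]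
    exact hD
  have hv0 : v 0 = ((b.1 / a.1 : ℝ) : ℂ) := by
    simp only [hv, divDiff_self, polyDeriv_zero_right]
    push_cast
    rw [div_eq_mul_inv]
  have hvc : Continuous fun θ : ℝ => v (Complex.exp (θ * Complex.I)) := by
    have := hvd.continuousOn
    rw [closure_ball _ one_ne_zero] at this
    exact this.comp_continuous (by fun_prop) norm_exp_mul_I_mem_closedBall
  have hre : ∀ θ ∈ Icc (0 : ℝ) (2 * Real.pi), (v (Complex.exp (θ * Complex.I))).re = 0 := by
    intro θ hθ
    have h1 := h θ hθ
    set ζ := Complex.exp (θ * Complex.I) with hζ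
    have hζ1 : Complex.normSq ζ = 1 := by
      rw [Complex.normSq_eq_norm_sq, hζ, Complex.norm_exp_ofReal_mul_I, one_pow]
    have hne := hD ζ (norm_exp_mul_I_mem_closedBall θ)
    have h2 : polyMap b ζ * conj (ζ * polyDeriv a ζ) =
        (Complex.normSq (polyDeriv a ζ) : ℝ) * v ζ := by
      rw [← divDiff_zero_right_mul b ζ, map_mul, hv, ← Complex.mul_conj]
      have h3 : ζ * conj ζ = 1 := by rw [Complex.mul_conj, hζ1, Complex.ofReal_one]
      field_simp
      linear_combination (divDiff b ζ 0) * conj (polyDeriv a ζ) * h3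
    rw [normalVar, ← hζ, h2, Complex.re_ofReal_mul] at h1
    exact (mul_eq_zero.1 h1).resolve_left (by simpa using hne)
  have hpi := Real.two_pi_pos
  have hv0' : v 0 = 0 := by
    have h1 := congrArg Complex.re (integral_exp_mul_I_of_diffContOnCl hvd)
    have h2 := Complex.reCLM.intervalIntegral_comp_comm
      (hvc.intervalIntegrable (μ := volume) 0 (2 * Real.pi))
    simp only [Complex.reCLM_apply] at h2
    rw [← h2, intervalIntegral.integral_congr (g := fun _ => (0 : ℝ))
      (fun θ hθ => hre θ (by rwa [uIcc_of_le hpi.le] at hθ)), intervalIntegral.integral_zero, hv0,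
      ← Complex.ofReal_ofNat, ← Complex.ofReal_mul, ← Complex.ofReal_mul, Complex.ofReal_re] at h1
    rw [hv0, (mul_eq_zero.1 h1.symm).resolve_left hpi.ne', Complex.ofReal_zero]
  -- The mean of `v²` is `v(0)² = 0`, and on the circle `Re v² = -(Im v)²`.
  have him : ∀ θ ∈ Icc (0 : ℝ) (2 * Real.pi), (v (Complex.exp (θ * Complex.I))).im = 0 := by
    have h1 := congrArg Complex.re (integral_exp_mul_I_of_diffContOnCl (hvd.smul hvd))
    have h2 := Complex.reCLM.intervalIntegral_comp_comm
      ((hvc.mul hvc).intervalIntegrable (μ := volume) 0 (2 * Real.pi))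
    simp only [Complex.reCLM_apply, Pi.mul_apply] at h2
    simp only [smul_eq_mul, hv0', mul_zero, Complex.zero_re] at h1
    rw [← h2] at h1
    intro θ hθ
    by_contra hne
    have h5 := intervalIntegral.integral_pos
      (f := fun θ : ℝ => (v (Complex.exp (θ * Complex.I))).im ^ 2) Real.two_pi_pos
      ((Complex.continuous_im.comp hvc).pow 2).continuousOn (fun _ _ => sq_nonneg _)
      ⟨θ, hθ, by positivity⟩
    have h6 : ∫ θ in (0 : ℝ)..2 * Real.pi, (v (Complex.exp (θ * Complex.I))).im ^ 2 =
        - ∫ θ in (0 : ℝ)..2 * Real.pi, (v (Complex.exp (θ * Complex.I)) *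
          v (Complex.exp (θ * Complex.I))).re := by
      rw [← intervalIntegral.integral_neg]
      refine intervalIntegral.integral_congr fun θ hθ => ?_
      rw [uIcc_of_le hpi.le] at hθ
      simp only [Complex.mul_re, hre θ hθ]
      ring
    rw [h6, h1, neg_zero] at h5
    exact lt_irrefl _ h5
  refine eq_zero_of_polyMap_eq_zero fun θ hθ => ?_
  have h1 : v (Complex.exp (θ * Complex.I)) = 0 := Complex.ext (hre θ hθ) (him θ hθ)
  rw [hv] at h1
  rw [← divDiff_zero_right_mul, (mul_eq_zero.1 h1).resolve_right
    (inv_ne_zero (hD _ (norm_exp_mul_I_mem_closedBall θ))), zero_mul]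

/-! ### The inverse function theorem. -/

theorem exists_hasFDerivAt_equiv_diskMomentMap {a : Coord N} (ha : a ∈ univalentSet N) :
    ∃ L : Coord N ≃L[ℝ] Coord N, HasFDerivAt diskMomentMap (L : Coord N →L[ℝ] Coord N) a := by
  obtain ⟨ha0, ha⟩ := mem_univalentSet_iff.1 ha
  obtain ⟨L, hL, hLb⟩ := exists_hasFDerivAt_diskMomentMap a
  have hpi : (1 / (Real.pi : ℂ)) ≠ 0 := by simp [Real.pi_ne_zero]
  have hinj : LinearMap.ker (L : Coord N →ₗ[ℝ] Coord N) = ⊥ := by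
    rw [LinearMap.ker_eq_bot']
    intro b hb
    have hb' : L b = 0 := hb
    refine eq_zero_of_normalVar_eq_zero ha (normalVar_eq_zero ha0.ne' fun k hk => ?_)
    obtain ⟨h1, h2⟩ := hLb b
    rw [hb'] at h1 h2
    rcases k with _ | k
    · simpa [Real.pi_ne_zero, eq_comm] using h1
    · have := h2 ⟨k, hk⟩
      simpa [Real.pi_ne_zero, eq_comm] using this
  exact ⟨(LinearEquiv.ofInjectiveEndo (L : Coord N →ₗ[ℝ] Coord N)
    (LinearMap.ker_eq_bot.1 hinj)).toContinuousLinearEquiv, hL⟩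

theorem exists_isMomentChart {a : Coord N} (ha : a ∈ univalentSet N) :
    ∃ e : OpenPartialHomeomorph (Coord N) (Coord N), IsMomentChart e ∧ a ∈ e.source := by
  obtain ⟨L, hL⟩ := exists_hasFDerivAt_equiv_diskMomentMap ha
  have hs := contDiff_diskMomentMap (N := N)
  set e₀ := (hs.contDiffAt (x := a)).toOpenPartialHomeomorph diskMomentMap hL (by simp) with he₀
  have he₀c : (e₀ : Coord N → Coord N) = diskMomentMap :=
    (hs.contDiffAt (x := a)).toOpenPartialHomeomorph_coe hL (by simp)
  set e := e₀.restrOpen (univalentSet N) isOpen_univalentSet with he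
  have hec : (e : Coord N → Coord N) = diskMomentMap := he₀c
  have hsrc : e.source ⊆ univalentSet N := fun x hx => by
    rw [he, OpenPartialHomeomorph.restrOpen_source] at hx
    exact hx.2
  refine ⟨e, ⟨hsrc, fun x hx => ?_, ?_, fun y hy => ?_⟩, ?_⟩
  · rw [hec, momentMap_eq (mem_univalentSet_iff.1 (hsrc hx)).2]
  · rw [hec]
    exact hs.contDiffOn
  -- Smoothness of the inverse on the whole target needs an invertible differential at every point
  -- of the source; this is the reason for restricting the chart to `univalentSet N`.
  · obtain ⟨L', hL'⟩ := exists_hasFDerivAt_equiv_diskMomentMap (hsrc (e.map_target hy))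
    refine (e.contDiffAt_symm hy (f₀' := L') ?_ ?_).contDiffWithinAt
    · rw [hec]; exact hL'
    · rw [hec]; exact hs.contDiffAt
  · rw [he, OpenPartialHomeomorph.restrOpen_source]
    exact ⟨(hs.contDiffAt (x := a)).mem_toOpenPartialHomeomorph_source hL (by simp), ha⟩

/-! ### The logarithmic potential of the domain as a boundary integral. -/

theorem continuous_conj_mul_log_norm : Continuous fun x : ℂ => conj x * (Real.log ‖x‖ : ℂ) := by
  rw [continuous_iff_continuousAt]
  intro x
  by_cases hx : x = 0
  · subst hx
    have h1 : Filter.Tendsto (fun x : ℂ => |‖x‖ * Real.log ‖x‖|) (nhds 0) (nhds 0) := by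
      have : Continuous fun x : ℂ => |‖x‖ * Real.log ‖x‖| :=
        (Real.continuous_mul_log.comp continuous_norm).abs
      simpa using this.tendsto 0
    refine ContinuousAt.congr_of_eventuallyEq (f := fun x : ℂ => conj x * (Real.log ‖x‖ : ℂ)) ?_
      Filter.EventuallyEq.rfl
    rw [ContinuousAt, map_zero, zero_mul]
    refine squeeze_zero_norm (fun y => ?_) h1
    rw [norm_mul, Complex.norm_conj, Complex.norm_real, abs_mul, abs_norm, Real.norm_eq_abs]
  · have h1 : ContinuousAt (fun x : ℂ => Real.log ‖x‖) x :=
      continuous_norm.continuousAt.log (norm_ne_zero_iff.2 hx)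
    exact Complex.continuous_conj.continuousAt.mul
      (Complex.continuous_ofReal.continuousAt.comp h1)

theorem hasFDerivAt_log_norm {u : ℂ} (hu : u ≠ 0) :
    HasFDerivAt (fun z : ℂ => Real.log ‖z‖) (Complex.reCLM.comp (u⁻¹ • (1 : ℂ →L[ℝ] ℂ))) u := by
  have h1 : HasDerivAt (fun z : ℂ => Complex.log (z / u)) u⁻¹ u := by
    have := ((hasDerivAt_id u).div_const u).clog (by simp [hu])
    simpa [hu] using this
  have h2 := (Complex.reCLM.hasFDerivAt.comp u h1.complexToReal_fderiv).const_add (Real.log ‖u‖)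
  refine h2.congr_of_eventuallyEq ?_
  filter_upwards [isOpen_ne.mem_nhds hu] with z hz
  have hz' : z ≠ 0 := hz
  simp only [Function.comp, Complex.reCLM_apply, Complex.log_re, norm_div]
  rw [Real.log_div (norm_ne_zero_iff.2 hz') (norm_ne_zero_iff.2 hu)]
  ring

/-- The product statement over a one-point space, where a Dirac mass makes "almost every" mean "the
only". -/
theorem integrableOn_log_norm_sub (c : ℂ) (r : ℝ) :
    IntegrableOn (fun w : ℂ => Real.log ‖c - w‖) (ball 0 r) := by
  have h := integrable_log_norm_sub_prod (ν := Measure.dirac ()) (g := fun _ => c)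
    measurable_const (R := ‖c‖) (by simp) r
  exact (((integrable_prod_iff h.aestronglyMeasurable).1 h).1).exists.choose_spec

/-- The logarithmic kernel of the image domain, pulled back by `polyMap a`. -/
noncomputable def logKer (a : Coord N) (z w : ℂ) : ℝ := Real.log ‖polyMap a z - polyMap a w‖

theorem logKer_comm (a : Coord N) (z w : ℂ) : logKer a z w = logKer a w z := by
  rw [logKer, norm_sub_rev, logKer]

theorem measurable_logKer (a : Coord N) : Measurable fun p : ℂ × ℂ => logKer a p.1 p.2 := by
  have := (continuous_polyMap a).measurable
  unfold logKer
  fun_prop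

theorem logKer_eq {a : Coord N} (ha : DivDiffNeZero a) {z w : ℂ} (hz : z ∈ closedBall (0 : ℂ) 1)
    (hw : w ∈ closedBall (0 : ℂ) 1) (hzw : z ≠ w) :
    logKer a z w = Real.log ‖z - w‖ + Real.log ‖divDiff a z w‖ := by
  rw [logKer, ← divDiff_mul_sub, norm_mul, add_comm, Real.log_mul]
  · exact norm_ne_zero_iff.2 (ha z hz w hw)
  · exact norm_ne_zero_iff.2 (sub_ne_zero.2 hzw)

theorem exists_abs_logKer_le {a : Coord N} (ha : DivDiffNeZero a) :
    ∃ C, ∀ z ∈ closedBall (0 : ℂ) 1, ∀ w ∈ closedBall (0 : ℂ) 1,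
      ‖logKer a z w‖ ≤ ‖Real.log ‖z - w‖‖ + C := by
  have hc : ContinuousOn (fun p : ℂ × ℂ => Real.log ‖divDiff a p.1 p.2‖)
      (closedBall 0 1 ×ˢ closedBall 0 1) :=
    (continuous_divDiff a).norm.continuousOn.log
      fun p hp => norm_ne_zero_iff.2 (ha p.1 hp.1 p.2 hp.2)
  obtain ⟨C, hC⟩ := ((isCompact_closedBall (0 : ℂ) 1).prod
    (isCompact_closedBall (0 : ℂ) 1)).exists_bound_of_continuousOn hc
  refine ⟨C, fun z hz w hw => ?_⟩
  -- On the diagonal both logarithms are `Real.log 0 = 0`, and only `0 ≤ C` is needed.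
  by_cases hzw : z = w
  · subst hzw
    have := (norm_nonneg _).trans (hC (z, z) ⟨hz, hz⟩)
    simpa [logKer] using this
  · rw [logKer_eq ha hz hw hzw]
    have h1 := hC (z, w) ⟨hz, hw⟩
    exact (norm_add_le _ _).trans (by simpa using h1)

theorem integrable_logKer_prod {a : Coord N} (ha : DivDiffNeZero a) {Y : Type*}
    [MeasurableSpace Y] {ν : Measure Y} [IsFiniteMeasure ν] {g : Y → ℂ} (hg : Measurable g)
    (hK : ∀ᵐ y ∂ν, g y ∈ closedBall (0 : ℂ) 1) :
    Integrable (fun p : Y × ℂ => logKer a (g p.1) p.2) (ν.prod (volume.restrict (ball 0 1))) := by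
  obtain ⟨C, hC⟩ := exists_abs_logKer_le ha
  have h1 := integrable_log_norm_sub_prod hg (R := 1)
    (hK.mono fun y hy => mem_closedBall_zero_iff.1 hy) 1
  refine (h1.norm.add (integrable_const C)).mono'
    (((measurable_logKer a).comp ((hg.comp measurable_fst).prodMk
      measurable_snd)).aestronglyMeasurable) ?_
  filter_upwards [Measure.quasiMeasurePreserving_fst.ae hK,
    Measure.quasiMeasurePreserving_snd.ae ae_mem_closedBall] with p h2 h3
  exact hC _ h2 _ h3

theorem integrableOn_logKer {a : Coord N} (ha : DivDiffNeZero a) {w : ℂ}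
    (hw : w ∈ closedBall (0 : ℂ) 1) : IntegrableOn (fun z => logKer a z w) (ball 0 1) := by
  obtain ⟨C, hC⟩ := exists_abs_logKer_le ha
  refine ((integrableOn_log_norm_sub w 1).norm.add (integrable_const C)).mono'
    (((measurable_logKer a).comp (measurable_id.prodMk measurable_const)).aestronglyMeasurable) ?_
  filter_upwards [ae_mem_closedBall] with z hz
  have := hC z hz w hw
  rwa [norm_sub_rev] at this

theorem integrableOn_mul_logKer {a : Coord N} (ha : DivDiffNeZero a) {w : ℂ}
    (hw : w ∈ closedBall (0 : ℂ) 1) {g : ℂ → ℝ} (hg : Continuous g) :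
    IntegrableOn (fun z => g z * logKer a z w) (ball 0 1) := by
  obtain ⟨C, hC⟩ := (isCompact_closedBall (0 : ℂ) 1).exists_bound_of_continuousOn hg.continuousOn
  exact (integrableOn_logKer ha hw).bdd_mul hg.aestronglyMeasurable
    (ae_mem_closedBall.mono fun z hz => hC z hz)

/-- Minus the logarithmic potential of the image domain, pulled back by `polyMap a`. -/
noncomputable def logPot (a : Coord N) (w : ℂ) : ℝ := ∫ z in ball (0 : ℂ) 1, jac a z * logKer a z w

/-- The integrand of the representation of `logPot a` as a boundary integral. -/
noncomputable def bdryKer (a : Coord N) (w : ℂ) (θ : ℝ) : ℂ :=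
  Complex.exp (θ * Complex.I) * polyDeriv a (Complex.exp (θ * Complex.I)) *
    (conj (polyMap a (Complex.exp (θ * Complex.I)) - polyMap a w) *
      (logKer a (Complex.exp (θ * Complex.I)) w : ℂ))

/-- The representation of `logPot a` as a boundary integral. -/
noncomputable def bdryPot (a : Coord N) (w : ℂ) : ℂ :=
  (1 / 2) * (∫ θ in (0 : ℝ)..2 * Real.pi, bdryKer a w θ) -
    (1 / 2) * ((∫ z in ball (0 : ℂ) 1, jac a z : ℝ) : ℂ)

theorem continuous_bdryKer (a : Coord N) : Continuous fun p : ℂ × ℝ => bdryKer a p.1 p.2 := by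
  have h1 := continuous_polyMap a
  have h2 := continuous_polyDeriv a
  have h3 := continuous_conj_mul_log_norm.comp (f := fun p : ℂ × ℝ =>
    polyMap a (Complex.exp (p.2 * Complex.I)) - polyMap a p.1) (by fun_prop)
  unfold bdryKer logKer
  exact (by fun_prop : Continuous fun p : ℂ × ℝ => Complex.exp (p.2 * Complex.I) *
    polyDeriv a (Complex.exp (p.2 * Complex.I))).mul h3

theorem continuous_bdryPot (a : Coord N) : Continuous (bdryPot a) := by
  have := intervalIntegral.continuous_parametric_intervalIntegral_of_continuous'
    (μ := volume) (f := bdryKer a) (continuous_bdryKer a) 0 (2 * Real.pi)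
  unfold bdryPot
  fun_prop

/-- In the variable `u = f(z) - f(w)` one has `(∂_x + i ∂_y)(conj u · log |u|) = 2 log |u| + 1`, and
`conj u · log |u|` is continuous at its pole. The divergence theorem with `P = Φ` and `Q = iΦ`
integrates this. The boundary form is continuous up to the circle and can be differentiated inside
the disk without meeting the singularity. -/
theorem logPot_eq_bdryPot {a : Coord N} (ha : DivDiffNeZero a) {w : ℂ}
    (hw : w ∈ closedBall (0 : ℂ) 1) : (logPot a w : ℂ) = bdryPot a w := by
  set ℓ : ℂ → ℝ := fun z => logKer a z w with hℓ
  set g : ℂ → ℂ := fun z => conj (polyMap a z - polyMap a w) * (ℓ z : ℂ) with hg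
  set Φ : ℂ → ℂ := fun z => polyDeriv a z * g z with hΦ
  have hcg : Continuous g := continuous_conj_mul_log_norm.comp
    ((continuous_polyMap a).sub continuous_const)
  have hcΦ : Continuous Φ := (continuous_polyDeriv a).mul hcg
  set ℓ' : ℂ → ℂ →L[ℝ] ℂ := fun z => Complex.ofRealCLM.comp ((Complex.reCLM.comp
    ((polyMap a z - polyMap a w)⁻¹ • (1 : ℂ →L[ℝ] ℂ))).comp
      (polyDeriv a z • (1 : ℂ →L[ℝ] ℂ))) with hℓ'
  set Φ' : ℂ → ℂ →L[ℝ] ℂ := fun z => polyDeriv a z •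
    (conj (polyMap a z - polyMap a w) • ℓ' z + (ℓ z : ℂ) •
      (Complex.conjCLE : ℂ →L[ℝ] ℂ).comp (polyDeriv a z • (1 : ℂ →L[ℝ] ℂ))) +
    g z • (deriv (polyDeriv a) z • (1 : ℂ →L[ℝ] ℂ)) with hΦ'
  have hne : ∀ z ∈ closedBall (0 : ℂ) 1, z ≠ w → polyMap a z - polyMap a w ≠ 0 := fun z hz hzw => by
    rw [← divDiff_mul_sub]
    exact mul_ne_zero (ha z hz w hw) (sub_ne_zero.2 hzw)
  have hd : ∀ z ∈ ball (0 : ℂ) 1 \ {w}, HasFDerivAt Φ (Φ' z) z := by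
    rintro z ⟨hz, hzw⟩
    have hu := hne z (ball_subset_closedBall hz) hzw
    have h1 := ((hasDerivAt_polyMap a z).sub_const (polyMap a w)).complexToReal_fderiv
    have h2 := (Complex.ofRealCLM.hasFDerivAt).comp z ((hasFDerivAt_log_norm hu).comp z h1)
    have h3 := (Complex.conjCLE : ℂ →L[ℝ] ℂ).hasFDerivAt.comp z h1
    exact (differentiable_polyDeriv a z).hasDerivAt.complexToReal_fderiv.mul (h3.mul h2)
  have hsum : ∀ z ∈ ball (0 : ℂ) 1, z ≠ w → Φ' z 1 + (Complex.I • Φ' z) Complex.I =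
      ((jac a z + 2 * (jac a z * ℓ z) : ℝ) : ℂ) := by
    intro z hz hzw
    have hu := hne z (ball_subset_closedBall hz) hzw
    have hJ : (jac a z : ℂ) = polyDeriv a z * conj (polyDeriv a z) := by
      rw [jac, Complex.mul_conj]
    have h1 : ∀ x : ℂ, (x.re : ℂ) + Complex.I * ((x * Complex.I).re : ℂ) = conj x := by
      intro x
      apply Complex.ext <;> simp
    have h2 := h1 ((polyMap a z - polyMap a w)⁻¹ * polyDeriv a z)
    have hI := Complex.I_mul_I
    have hu' : conj (polyMap a z - polyMap a w) ≠ 0 := (map_ne_zero _).2 hu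
    have h3 : conj (polyMap a z - polyMap a w) *
        conj ((polyMap a z - polyMap a w)⁻¹ * polyDeriv a z) = conj (polyDeriv a z) := by
      rw [map_mul, map_inv₀, mul_inv_cancel_left₀ hu']
    rw [← h2] at h3
    simp only [hΦ', hℓ', add_apply, smul_apply, ContinuousLinearMap.comp_apply,
      one_apply_eq_self, smul_eq_mul, Complex.reCLM_apply, Complex.ofRealCLM_apply, mul_one,
      ContinuousLinearEquiv.coe_coe, Complex.conjCLE_apply, map_mul, Complex.conj_I]
    push_cast
    rw [hJ]
    simp only [← mul_assoc] at h3 ⊢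
    linear_combination (polyDeriv a z) * h3 + (g z * deriv (polyDeriv a) z -
      polyDeriv a z * conj (polyDeriv a z) * (ℓ z : ℂ)) * hI
  have hae : ∀ᵐ z ∂(volume.restrict (ball (0 : ℂ) 1)),
      ((jac a z + 2 * (jac a z * ℓ z) : ℝ) : ℂ) = Φ' z 1 + (Complex.I • Φ' z) Complex.I := by
    have h1 : ∀ᵐ z ∂(volume.restrict (ball (0 : ℂ) 1)), z ≠ w :=
      ae_restrict_of_ae (Measure.ae_ne volume w)
    filter_upwards [h1, ae_restrict_mem measurableSet_ball] with z hz1 hz2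
    exact (hsum z hz2 hz1).symm
  have hi1 : IntegrableOn (jac a) (ball 0 1) := Continuous.integrableOn_ball_one (continuous_jac a)
  have hi2 := integrableOn_mul_logKer ha hw (continuous_jac a)
  have hi : IntegrableOn (fun z => ((jac a z + 2 * (jac a z * ℓ z) : ℝ) : ℂ)) (ball 0 1) :=
    (hi1.add (hi2.const_mul 2)).ofReal
  have key := integral_divergence_ball_one (P := Φ) (Q := Complex.I • Φ) (P' := Φ')
    (Q' := fun z => Complex.I • Φ' z) (countable_singleton w) hcΦ.continuousOn
    (hcΦ.const_smul _).continuousOn hd (fun z hz => (hd z hz).const_smul _) (hi.congr hae)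
  rw [← integral_congr_ae hae, integral_complex_ofReal, integral_add hi1 (hi2.const_mul 2),
    integral_const_mul] at key
  have h4 : ∀ θ : ℝ, Real.cos θ • Φ (Complex.exp (θ * Complex.I)) +
      Real.sin θ • Complex.I • Φ (Complex.exp (θ * Complex.I)) = bdryKer a w θ := by
    intro θ
    rw [bdryKer, Complex.exp_mul_I]
    simp only [Complex.real_smul, smul_eq_mul, hΦ, hg, hℓ]
    push_cast
    ring
  simp only [Pi.smul_apply, h4] at key
  rw [bdryPot, ← key, logPot]
  push_cast
  ring

theorem continuousOn_logPot {a : Coord N} (ha : DivDiffNeZero a) :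
    ContinuousOn (logPot a) (closedBall 0 1) :=
  (Complex.continuous_re.comp (continuous_bdryPot a)).continuousOn.congr fun w hw => by
    rw [Function.comp, ← logPot_eq_bdryPot ha hw, Complex.ofReal_re]

/-- The circle integral of `log |f - f(w)|` against `f'(ζ) dζ / i`. -/
noncomputable def bdryLog (a : Coord N) (w : ℂ) : ℂ :=
  ∫ θ in (0 : ℝ)..2 * Real.pi, Complex.exp (θ * Complex.I) *
    polyDeriv a (Complex.exp (θ * Complex.I)) * (logKer a (Complex.exp (θ * Complex.I)) w : ℂ)

/-- The circle integral of `conj (f - f(w)) / (f - f(w))` against `f'(ζ) dζ / i`. -/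
noncomputable def bdryQuot (a : Coord N) (w : ℂ) : ℂ :=
  ∫ θ in (0 : ℝ)..2 * Real.pi, Complex.exp (θ * Complex.I) *
    polyDeriv a (Complex.exp (θ * Complex.I)) *
      (conj (polyMap a (Complex.exp (θ * Complex.I)) - polyMap a w) /
        (polyMap a (Complex.exp (θ * Complex.I)) - polyMap a w))

theorem exp_mul_I_ne_of_mem_ball {w : ℂ} (hw : w ∈ ball (0 : ℂ) 1) (θ : ℝ) :
    Complex.exp (θ * Complex.I) ≠ w := by
  rintro rfl
  rw [mem_ball_zero_iff, Complex.norm_exp_ofReal_mul_I] at hw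
  exact lt_irrefl _ hw

theorem polyMap_exp_sub_ne_zero {a : Coord N} (ha : DivDiffNeZero a) {w : ℂ}
    (hw : w ∈ ball (0 : ℂ) 1) (θ : ℝ) :
    polyMap a (Complex.exp (θ * Complex.I)) - polyMap a w ≠ 0 := by
  rw [← divDiff_mul_sub]
  exact mul_ne_zero (ha _ (norm_exp_mul_I_mem_closedBall θ) _ (ball_subset_closedBall hw))
    (sub_ne_zero.2 (exp_mul_I_ne_of_mem_ball hw θ))

theorem integral_exp_mul_polyDeriv (a : Coord N) :
    ∫ θ in (0 : ℝ)..2 * Real.pi, Complex.exp (θ * Complex.I) *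
      polyDeriv a (Complex.exp (θ * Complex.I)) = 0 := by
  have := integral_exp_mul_I_of_diffContOnCl
    (differentiable_id.mul (differentiable_polyDeriv a)).diffContOnCl
  simpa using this

theorem contDiff_exp_ofReal_mul_I {E : Type*} [NormedAddCommGroup E] [NormedSpace ℝ E] {f : E → ℝ}
    {n : WithTop ℕ∞} (hf : ContDiff ℝ n f) :
    ContDiff ℝ n (fun x => Complex.exp ((f x : ℂ) * Complex.I)) :=
  ((contDiff_ofReal_comp hf).mul contDiff_const).cexp

/-- Two expressions of one derivative: that with `bdryLog` matches the variation of the energy, that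
with `bdryQuot` leads to the Cauchy transform. -/
theorem exists_hasFDerivAt_logPot {a : Coord N} (ha : DivDiffNeZero a) {w : ℂ}
    (hw : w ∈ ball (0 : ℂ) 1) :
    ∃ L : ℂ →L[ℝ] ℝ, HasFDerivAt (logPot a) L w ∧
      (∀ v, L v = -(polyDeriv a w * v * conj (bdryLog a w)).re) ∧
      ∀ v, L v = -(1 / 2) * (polyDeriv a w * v * bdryQuot a w).re := by
  have hpc := continuous_polyMap a
  have hdc := continuous_polyDeriv a
  set O : Set (ℂ × ℝ) := {p | polyMap a (Complex.exp (p.2 * Complex.I)) - polyMap a p.1 ≠ 0}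
  have hO : IsOpen O := isOpen_ne_fun (by fun_prop) continuous_const
  have hpm : ∀ {f : ℂ × ℝ → ℂ}, ContDiff ℝ 1 f → ContDiff ℝ 1 fun p => polyMap a (f p) :=
    fun hf => contDiff_polyMap.comp (contDiff_const.prodMk hf)
  have hpd : ∀ {f : ℂ × ℝ → ℂ}, ContDiff ℝ 1 f → ContDiff ℝ 1 fun p => polyDeriv a (f p) :=
    fun hf => contDiff_polyDeriv.comp (contDiff_const.prodMk hf)
  have he : ContDiff ℝ 1 fun p : ℂ × ℝ => Complex.exp (p.2 * Complex.I) :=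
    contDiff_exp_ofReal_mul_I contDiff_snd
  have hu : ContDiff ℝ 1 fun p : ℂ × ℝ =>
    polyMap a (Complex.exp (p.2 * Complex.I)) - polyMap a p.1 := (hpm he).sub (hpm contDiff_fst)
  have hk : ContDiffOn ℝ 1 (fun p : ℂ × ℝ => bdryKer a p.1 p.2) O := by
    intro p hp
    have h1 : ContDiffAt ℝ 1 (fun p : ℂ × ℝ => (logKer a (Complex.exp (p.2 * Complex.I)) p.1 : ℂ))
        p := Complex.ofRealCLM.contDiff.contDiffAt.comp p
      ((hu.contDiffAt.norm ℝ hp).log (norm_ne_zero_iff.2 hp))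
    exact ((he.mul (hpd he)).contDiffAt.mul
      (((Complex.conjCLE : ℂ →L[ℝ] ℂ).contDiff.comp hu).contDiffAt.mul h1)).contDiffWithinAt
  have hd : ∀ v : ℂ, ∀ θ ∈ Icc (0 : ℝ) (2 * Real.pi),
      HasDerivAt (fun t : ℝ => bdryKer a (w + t • v) θ)
        (Complex.exp (θ * Complex.I) * polyDeriv a (Complex.exp (θ * Complex.I)) *
          (conj (-(polyDeriv a w * v)) * (logKer a (Complex.exp (θ * Complex.I)) w : ℂ) +
          conj (polyMap a (Complex.exp (θ * Complex.I)) - polyMap a w) *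
          (((polyMap a (Complex.exp (θ * Complex.I)) - polyMap a w)⁻¹ *
            (-(polyDeriv a w * v))).re : ℂ))) 0 := by
    intro v θ _
    have h1 : HasDerivAt (fun t : ℝ => w + t • v) v 0 := by
      simpa using ((hasDerivAt_id (0 : ℝ)).smul_const v).const_add w
    have h2 : HasDerivAt (fun t : ℝ => polyMap a (Complex.exp (θ * Complex.I)) -
        polyMap a (w + t • v)) (-(polyDeriv a w * v)) 0 := by
      have := HasFDerivAt.comp_hasDerivAt_of_eq (0 : ℝ)
        (hasDerivAt_polyMap a w).complexToReal_fderiv h1 (by simp)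
      simpa using this.const_sub (polyMap a (Complex.exp (θ * Complex.I)))
    have h3 := HasFDerivAt.comp_hasDerivAt_of_eq (0 : ℝ)
      (hasFDerivAt_log_norm (polyMap_exp_sub_ne_zero ha hw θ)) h2 (by simp)
    have h4 := Complex.ofRealCLM.hasFDerivAt.comp_hasDerivAt (0 : ℝ) h3
    have h5 := (Complex.conjCLE : ℂ →L[ℝ] ℂ).hasFDerivAt.comp_hasDerivAt (0 : ℝ) h2
    refine ((h5.mul h4).const_mul _).congr_deriv ?_
    simp [logKer]
  obtain ⟨L, hL, hLv⟩ := exists_hasFDerivAt_intervalIntegral Real.two_pi_pos.le hO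
    (fun θ _ => polyMap_exp_sub_ne_zero ha hw θ) hk hd
  have hbd : HasFDerivAt (bdryPot a) ((1 / 2 : ℂ) • L) w := (hL.const_mul _).sub_const _
  have hev : bdryPot a =ᶠ[nhds w] fun z => (logPot a z : ℂ) := by
    filter_upwards [isOpen_ball.mem_nhds hw] with z hz
    exact (logPot_eq_bdryPot ha (ball_subset_closedBall hz)).symm
  have hre : HasFDerivAt (logPot a) (Complex.reCLM.comp ((1 / 2 : ℂ) • L)) w := by
    refine (Complex.reCLM.hasFDerivAt.comp w hbd).congr_of_eventuallyEq ?_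
    filter_upwards [hev] with z hz
    simp [hz]
  -- The boundary integral agrees near `w` with the real function `logPot a`, so its imaginary part
  -- has zero derivative.
  have him : ∀ v, (L v).im = 0 := by
    have h1 : HasFDerivAt (fun z => (bdryPot a z).im) (Complex.imCLM.comp ((1 / 2 : ℂ) • L)) w :=
      Complex.imCLM.hasFDerivAt.comp w hbd
    have h2 : HasFDerivAt (fun z => (bdryPot a z).im) (0 : ℂ →L[ℝ] ℝ) w := by
      refine (hasFDerivAt_const (0 : ℝ) w).congr_of_eventuallyEq ?_
      filter_upwards [hev] with z hz
      simp [hz]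
    intro v
    have h3 := congrArg (fun T : ℂ →L[ℝ] ℝ => T v) (h1.unique h2)
    have h4 : (1 / 2 : ℂ) = ((1 / 2 : ℝ) : ℂ) := by norm_num
    simp only [ContinuousLinearMap.comp_apply, smul_apply, smul_eq_mul, Complex.imCLM_apply, h4,
      Complex.im_ofReal_mul, zero_apply] at h3
    linarith
  have hLv' : ∀ v, L v = -(conj (polyDeriv a w * v) * bdryLog a w) -
      (1 / 2) * (polyDeriv a w * v * bdryQuot a w) := by
    intro v
    have hu0 := polyMap_exp_sub_ne_zero ha hw
    have c1 : Continuous fun θ : ℝ => Complex.exp (θ * Complex.I) *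
        polyDeriv a (Complex.exp (θ * Complex.I)) := by fun_prop
    have c2 : Continuous fun θ : ℝ => (logKer a (Complex.exp (θ * Complex.I)) w : ℂ) := by
      refine Complex.continuous_ofReal.comp ?_
      exact Continuous.log (by fun_prop) fun θ => norm_ne_zero_iff.2 (hu0 θ)
    have c3 : Continuous fun θ : ℝ =>
        conj (polyMap a (Complex.exp (θ * Complex.I)) - polyMap a w) /
          (polyMap a (Complex.exp (θ * Complex.I)) - polyMap a w) :=
      Continuous.div (by fun_prop) (by fun_prop) hu0
    have i1 := ((c1.mul c2).intervalIntegrable (μ := volume) 0 (2 * Real.pi)).const_mul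
      (-conj (polyDeriv a w * v))
    have i2 := ((c1.mul c3).intervalIntegrable (μ := volume) 0 (2 * Real.pi)).const_mul
      (-(1 / 2) * (polyDeriv a w * v))
    have i3 := (c1.intervalIntegrable (μ := volume) 0 (2 * Real.pi)).const_mul
      (-(1 / 2) * conj (polyDeriv a w * v))
    rw [hLv, bdryLog, bdryQuot]
    trans ∫ θ in (0 : ℝ)..2 * Real.pi, ((-conj (polyDeriv a w * v) *
      (Complex.exp (θ * Complex.I) * polyDeriv a (Complex.exp (θ * Complex.I)) *
        (logKer a (Complex.exp (θ * Complex.I)) w : ℂ)) +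
      -(1 / 2) * (polyDeriv a w * v) *
      (Complex.exp (θ * Complex.I) * polyDeriv a (Complex.exp (θ * Complex.I)) *
        (conj (polyMap a (Complex.exp (θ * Complex.I)) - polyMap a w) /
          (polyMap a (Complex.exp (θ * Complex.I)) - polyMap a w)))) +
      -(1 / 2) * conj (polyDeriv a w * v) *
      (Complex.exp (θ * Complex.I) * polyDeriv a (Complex.exp (θ * Complex.I))))
    · refine intervalIntegral.integral_congr fun θ _ => ?_
      have hu1 := hu0 θ
      have hu2 : conj (polyMap a (Complex.exp (θ * Complex.I)) - polyMap a w) ≠ 0 :=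
        (map_ne_zero _).2 hu1
      simp only [Complex.re_eq_add_conj, map_neg]
      generalize polyMap a (Complex.exp (θ * Complex.I)) - polyMap a w = u at *
      generalize polyDeriv a w * v = c
      rw [map_mul, map_neg, map_inv₀]
      field_simp
      ring
    · have e1 := intervalIntegral.integral_add (i1.add i2) i3
      have e2 := intervalIntegral.integral_add i1 i2
      simp only [intervalIntegral.integral_const_mul, Pi.mul_apply] at e1 e2
      rw [integral_exp_mul_polyDeriv] at e1
      refine e1.trans ?_
      refine (congrArg (· + _) e2).trans ?_
      ring
  have hD : polyDeriv a w ≠ 0 := by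
    rw [← divDiff_self]
    exact ha w (ball_subset_closedBall hw) w (ball_subset_closedBall hw)
  -- With `c = f'(w) v`, the number `conj c · bdryLog + c · bdryQuot / 2` is real for every `c`. The
  -- values `c = 1` and `c = i` determine `bdryQuot`.
  have hBH : bdryQuot a w = 2 * conj (bdryLog a w) := by
    have h1 := him ((polyDeriv a w)⁻¹)
    have h2 := him ((polyDeriv a w)⁻¹ * Complex.I)
    rw [hLv', mul_inv_cancel₀ hD] at h1
    rw [hLv', mul_inv_cancel_left₀ hD] at h2
    simp at h1 h2
    apply Complex.ext
    · simp; linarith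
    · simp; linarith
  have hfin : ∀ v, (Complex.reCLM.comp ((1 / 2 : ℂ) • L)) v =
      -(polyDeriv a w * v * conj (bdryLog a w)).re := by
    intro v
    simp only [ContinuousLinearMap.comp_apply, smul_apply, smul_eq_mul, Complex.reCLM_apply, hLv',
      hBH]
    generalize polyDeriv a w * v = c
    simp
    ring
  refine ⟨_, hre, hfin, fun v => ?_⟩
  rw [hfin, hBH]
  generalize polyDeriv a w * v = c
  simp
  ring

/-! ### The variation of the logarithmic energy. -/

/-- The divergence theorem for the logarithmic kernel with pole at `w` times the vector field of
the variation, translated so as to vanish at `w`. -/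
theorem integral_flux_logKer {a : Coord N} (ha : DivDiffNeZero a) (b : Coord N) {w : ℂ}
    (hw : w ∈ closedBall (0 : ℂ) 1) :
    ∫ z in ball (0 : ℂ) 1, ((divDiff b z w / divDiff a z w).re * jac a z +
        jacVar a b z * logKer a z w) =
      ∫ θ in (0 : ℝ)..2 * Real.pi,
        ((polyMap b (Complex.exp (θ * Complex.I)) - polyMap b w) *
          conj (Complex.exp (θ * Complex.I) * polyDeriv a (Complex.exp (θ * Complex.I)))).re *
        logKer a (Complex.exp (θ * Complex.I)) w := by
  have hcD := differentiable_divDiff_left a w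
  have hcD' := differentiable_divDiff_left b w
  have hpb := continuous_polyMap b
  have hdb := continuous_polyDeriv b
  have hda := continuous_polyDeriv a
  set ℓ : ℂ → ℝ := fun z => logKer a z w with hℓ
  -- Subtracting `ḟ(w)` makes the field vanish at the pole. Its product with the logarithm is then
  -- continuous there, and the gradient term becomes the quotient of divided differences, which is
  -- bounded.
  set Y : ℂ → ℂ := fun z => (polyMap b z - polyMap b w) * conj (polyDeriv a z) with hY
  set Φ : ℂ → ℂ := fun z => Y z * (ℓ z : ℂ) with hΦ
  have hq : ContinuousOn (fun z => divDiff b z w / divDiff a z w) (closedBall 0 1) :=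
    hcD'.continuous.continuousOn.div hcD.continuous.continuousOn fun z hz => ha z hz w hw
  have hcΦ : ContinuousOn Φ (closedBall 0 1) := by
    have hcg : Continuous fun z => conj (conj (polyMap a z - polyMap a w) * (ℓ z : ℂ)) :=
      Complex.continuous_conj.comp (continuous_conj_mul_log_norm.comp
        ((continuous_polyMap a).sub continuous_const))
    have hcda : Continuous fun z => conj (polyDeriv a z) := Complex.continuous_conj.comp hda
    refine ((hcg.continuousOn.mul hq).mul hcda.continuousOn).congr fun z hz => ?_
    have h1 := ha z hz w hw
    simp only [hΦ, hY, map_mul, Complex.conj_conj, Complex.conj_ofReal, ← divDiff_mul_sub,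
      Pi.mul_apply]
    field_simp
  set ℓ' : ℂ → ℂ →L[ℝ] ℂ := fun z => Complex.ofRealCLM.comp ((Complex.reCLM.comp
    ((polyMap a z - polyMap a w)⁻¹ • (1 : ℂ →L[ℝ] ℂ))).comp
      (polyDeriv a z • (1 : ℂ →L[ℝ] ℂ))) with hℓ'
  set Φ' : ℂ → ℂ →L[ℝ] ℂ := fun z => Y z • ℓ' z + (ℓ z : ℂ) • ((polyMap b z - polyMap b w) •
    (Complex.conjCLE : ℂ →L[ℝ] ℂ).comp (deriv (polyDeriv a) z • (1 : ℂ →L[ℝ] ℂ)) +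
      conj (polyDeriv a z) • (polyDeriv b z • (1 : ℂ →L[ℝ] ℂ))) with hΦ'
  have hne : ∀ z ∈ closedBall (0 : ℂ) 1, z ≠ w → polyMap a z - polyMap a w ≠ 0 := fun z hz hzw => by
    rw [← divDiff_mul_sub]
    exact mul_ne_zero (ha z hz w hw) (sub_ne_zero.2 hzw)
  have hd : ∀ z ∈ ball (0 : ℂ) 1 \ {w}, HasFDerivAt Φ (Φ' z) z := by
    rintro z ⟨hz, hzw⟩
    have hu := hne z (ball_subset_closedBall hz) hzw
    have h1 := ((hasDerivAt_polyMap a z).sub_const (polyMap a w)).complexToReal_fderiv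
    have h2 := (Complex.ofRealCLM.hasFDerivAt).comp z ((hasFDerivAt_log_norm hu).comp z h1)
    have h3 := hasFDerivAt_mul_conj ((hasDerivAt_polyMap b z).sub_const (polyMap b w))
      (differentiable_polyDeriv a z).hasDerivAt
    exact h3.mul h2
  set D : ℂ → ℂ := fun z => divDiff b z w / divDiff a z w * (jac a z : ℂ) +
    2 * (polyDeriv b z * conj (polyDeriv a z)) * (ℓ z : ℂ) with hD
  -- The choice `Q = -iΦ` makes the left-hand side `2 ∂_z Φ`; the wanted identity is the real part
  -- of the resulting complex one.
  have hsum : ∀ z ∈ ball (0 : ℂ) 1, z ≠ w → Φ' z 1 + ((-Complex.I) • Φ' z) Complex.I = D z := by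
    intro z hz hzw
    have hzc := ball_subset_closedBall hz
    have hu := hne z hzc hzw
    have hF := ha z hzc w hw
    have hzw' := sub_ne_zero.2 hzw
    have hJ : (jac a z : ℂ) = polyDeriv a z * conj (polyDeriv a z) := by
      rw [jac, Complex.mul_conj]
    have h1 : ∀ x : ℂ, (x.re : ℂ) - Complex.I * ((x * Complex.I).re : ℂ) = x := by
      intro x
      apply Complex.ext <;> simp
    have h2 := h1 ((polyMap a z - polyMap a w)⁻¹ * polyDeriv a z)
    have hI := Complex.I_mul_I
    have h3 : (polyMap b z - polyMap b w) * ((polyMap a z - polyMap a w)⁻¹ * polyDeriv a z) =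
        divDiff b z w / divDiff a z w * polyDeriv a z := by
      rw [← divDiff_mul_sub, ← divDiff_mul_sub]
      field_simp
    rw [← h2] at h3
    simp only [hΦ', hℓ', hD, hY, add_apply, smul_apply, ContinuousLinearMap.comp_apply,
      one_apply_eq_self, smul_eq_mul, Complex.reCLM_apply, Complex.ofRealCLM_apply, mul_one,
      ContinuousLinearEquiv.coe_coe, Complex.conjCLE_apply, map_mul, Complex.conj_I]
    rw [hJ]
    simp only [← mul_assoc] at h3 ⊢
    linear_combination conj (polyDeriv a z) * h3 + (ℓ z : ℂ) * ((polyMap b z - polyMap b w) *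
      conj (deriv (polyDeriv a) z) - conj (polyDeriv a z) * polyDeriv b z) * hI
  have hae : ∀ᵐ z ∂(volume.restrict (ball (0 : ℂ) 1)),
      D z = Φ' z 1 + ((-Complex.I) • Φ' z) Complex.I := by
    have h1 : ∀ᵐ z ∂(volume.restrict (ball (0 : ℂ) 1)), z ≠ w :=
      ae_restrict_of_ae (Measure.ae_ne volume w)
    filter_upwards [h1, ae_restrict_mem measurableSet_ball] with z hz1 hz2
    exact (hsum z hz2 hz1).symm
  have hi : IntegrableOn D (ball 0 1) := by
    refine Integrable.add ?_ ?_
    · exact ((hq.mul (Complex.continuous_ofReal.comp (continuous_jac a)).continuousOn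
        ).integrableOn_compact (isCompact_closedBall _ _)).mono_set ball_subset_closedBall
    · have hc : Continuous fun z => 2 * (polyDeriv b z * conj (polyDeriv a z)) := by fun_prop
      obtain ⟨C, hC⟩ := (isCompact_closedBall (0 : ℂ) 1).exists_bound_of_continuousOn
        hc.continuousOn
      exact (integrableOn_logKer ha hw).ofReal.bdd_mul hc.aestronglyMeasurable
        (ae_mem_closedBall.mono fun z hz => hC z hz)
  have key := integral_divergence_ball_one (P := Φ) (Q := (-Complex.I) • Φ) (P' := Φ')
    (Q' := fun z => (-Complex.I) • Φ' z) (countable_singleton w) hcΦ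
    (hcΦ.const_smul _) hd (fun z hz => (hd z hz).const_smul _) (hi.congr hae)
  rw [← integral_congr_ae hae] at key
  have h4 : ∀ θ : ℝ, Real.cos θ • Φ (Complex.exp (θ * Complex.I)) +
      Real.sin θ • ((-Complex.I) • Φ) (Complex.exp (θ * Complex.I)) =
        conj (Complex.exp (θ * Complex.I)) * Φ (Complex.exp (θ * Complex.I)) := by
    intro θ
    have h5 : conj (Complex.exp (θ * Complex.I)) = Real.cos θ - Real.sin θ * Complex.I := by
      rw [Complex.exp_mul_I]
      simp [← Complex.cos_conj, ← Complex.sin_conj, sub_eq_add_neg]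
    rw [h5]
    simp only [Complex.real_smul, smul_eq_mul, Pi.smul_apply]
    ring
  simp only [h4] at key
  have hcb : Continuous fun θ : ℝ => conj (Complex.exp (θ * Complex.I)) *
      Φ (Complex.exp (θ * Complex.I)) :=
    (by fun_prop : Continuous fun θ : ℝ => conj (Complex.exp (θ * Complex.I))).mul
      (hcΦ.comp_continuous (by fun_prop) norm_exp_mul_I_mem_closedBall)
  have key2 := congrArg Complex.re key
  have e1 := Complex.reCLM.integral_comp_comm hi
  have e2 := Complex.reCLM.intervalIntegral_comp_comm
    (hcb.intervalIntegrable (μ := volume) 0 (2 * Real.pi))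
  simp only [Complex.reCLM_apply] at e1 e2
  rw [← e1, ← e2] at key2
  refine Eq.trans ?_ (key2.trans ?_)
  · refine integral_congr_ae (Filter.Eventually.of_forall fun z => ?_)
    simp only [hD, jacVar, hℓ, Complex.add_re, Complex.re_mul_ofReal]
    rw [← Complex.ofReal_ofNat, Complex.re_ofReal_mul]
  · refine intervalIntegral.integral_congr fun θ _ => ?_
    simp only [hΦ, hY, hℓ]
    rw [← mul_assoc, Complex.re_mul_ofReal, map_mul]
    congr 2
    ring

theorem ae_prod_ne : ∀ᵐ p : ℂ × ℂ ∂((volume.restrict (ball (0 : ℂ) 1)).prod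
    (volume.restrict (ball (0 : ℂ) 1))), p.1 ≠ p.2 := by
  have hm : MeasurableSet {p : ℂ × ℂ | p.1 = p.2} := measurableSet_eq_fun measurable_fst
    measurable_snd
  rw [ae_iff]
  simp only [ne_eq, not_not]
  rw [Measure.measure_prod_null hm]
  refine Filter.Eventually.of_forall fun x => ?_
  have : Prod.mk x ⁻¹' {p : ℂ × ℂ | p.1 = p.2} = {x} := by
    ext y
    simp [eq_comm]
  simp [this]

theorem ae_prod_mem_closedBall : ∀ᵐ p : ℂ × ℂ ∂((volume.restrict (ball (0 : ℂ) 1)).prod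
    (volume.restrict (ball (0 : ℂ) 1))),
    p ∈ (closedBall (0 : ℂ) 1 ×ˢ closedBall (0 : ℂ) 1 : Set (ℂ × ℂ)) := by
  filter_upwards [Measure.quasiMeasurePreserving_fst.ae ae_mem_closedBall,
    Measure.quasiMeasurePreserving_snd.ae ae_mem_closedBall] with p h2 h3
  exact ⟨h2, h3⟩

theorem integrable_mul_logKer_prod {a : Coord N} (ha : DivDiffNeZero a) {g : ℂ × ℂ → ℝ}
    (hg : Continuous g) : Integrable (fun p => g p * logKer a p.1 p.2)
      ((volume.restrict (ball (0 : ℂ) 1)).prod (volume.restrict (ball (0 : ℂ) 1))) := by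
  obtain ⟨C, hC⟩ := ((isCompact_closedBall (0 : ℂ) 1).prod
    (isCompact_closedBall (0 : ℂ) 1)).exists_bound_of_continuousOn hg.continuousOn
  exact (integrable_logKer_prod ha measurable_id ae_mem_closedBall).bdd_mul
    hg.aestronglyMeasurable (ae_prod_mem_closedBall.mono fun z hz => hC z hz)

/-- Minus the logarithmic energy of the image domain. -/
noncomputable def selfEnergy (a : Coord N) : ℝ := ∫ w in ball (0 : ℂ) 1, jac a w * logPot a w

theorem selfEnergy_eq {a : Coord N} (ha : DivDiffNeZero a) :
    selfEnergy a = ∫ p, jac a p.1 * jac a p.2 * logKer a p.1 p.2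
      ∂((volume.restrict (ball (0 : ℂ) 1)).prod (volume.restrict (ball (0 : ℂ) 1))) := by
  have hj := continuous_jac a
  rw [integral_prod _ (integrable_mul_logKer_prod ha (by fun_prop))]
  unfold selfEnergy logPot
  simp only [← integral_const_mul, mul_assoc]
  refine integral_congr_ae (Filter.Eventually.of_forall fun w => ?_)
  refine integral_congr_ae (Filter.Eventually.of_forall fun z => ?_)
  simp only [logKer_comm a z w]

theorem integrable_re_divDiff_div {a : Coord N} (ha : DivDiffNeZero a) (b : Coord N) :
    Integrable (fun p : ℂ × ℂ =>
        (divDiff b p.1 p.2 / divDiff a p.1 p.2).re * (jac a p.1 * jac a p.2))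
      ((volume.restrict (ball (0 : ℂ) 1)).prod (volume.restrict (ball (0 : ℂ) 1))) := by
  have hKc := (isCompact_closedBall (0 : ℂ) 1).prod (isCompact_closedBall (0 : ℂ) 1)
  have hj := continuous_jac a
  have hc : ContinuousOn (fun p : ℂ × ℂ =>
      (divDiff b p.1 p.2 / divDiff a p.1 p.2).re * (jac a p.1 * jac a p.2))
      (closedBall 0 1 ×ˢ closedBall 0 1) :=
    (Complex.continuous_re.comp_continuousOn ((continuous_divDiff b).continuousOn.div
      (continuous_divDiff a).continuousOn fun p hp => ha p.1 hp.1 p.2 hp.2)).mul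
      (by fun_prop)
  have h4 := aestronglyMeasurable_smul_of_isCompact hKc
    (measurableSet_closedBall.prod measurableSet_closedBall) ae_prod_mem_closedBall
    (integrable_const (1 : ℝ)).aestronglyMeasurable hc
  simp only [one_smul] at h4
  obtain ⟨C, hC⟩ := hKc.exists_bound_of_continuousOn hc
  exact (integrable_const C).mono' h4 (ae_prod_mem_closedBall.mono fun z hz => hC z hz)

/-- The factorisation `log |f(z) - f(w)| = log |z - w| + log |F(z, w)|` separates a singular weight
independent of the coefficients from a kernel smooth on the closed bidisk. Each half is
differentiated under the integral sign. -/
theorem exists_hasFDerivAt_selfEnergy_aux {a : Coord N} (ha : DivDiffNeZero a) :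
    ∃ L : Coord N →L[ℝ] ℝ, HasFDerivAt selfEnergy L a ∧ ∀ b,
      L b = ∫ p : ℂ × ℂ, ((divDiff b p.1 p.2 / divDiff a p.1 p.2).re * (jac a p.1 * jac a p.2) +
        (jacVar a b p.1 * jac a p.2 + jac a p.1 * jacVar a b p.2) * logKer a p.1 p.2)
      ∂((volume.restrict (ball (0 : ℂ) 1)).prod (volume.restrict (ball (0 : ℂ) 1))) := by
  set μ := (volume.restrict (ball (0 : ℂ) 1)).prod (volume.restrict (ball (0 : ℂ) 1)) with hμ
  have hKc := (isCompact_closedBall (0 : ℂ) 1).prod (isCompact_closedBall (0 : ℂ) 1)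
  have hKm : MeasurableSet (closedBall (0 : ℂ) 1 ×ˢ closedBall (0 : ℂ) 1 : Set (ℂ × ℂ)) :=
    measurableSet_closedBall.prod measurableSet_closedBall
  have hlog : Integrable (fun p : ℂ × ℂ => Real.log ‖p.1 - p.2‖) μ :=
    integrable_log_norm_sub_prod measurable_id (R := 1)
      (ae_mem_closedBall.mono fun y hy => mem_closedBall_zero_iff.1 hy) 1
  have hj1 : ContDiff ℝ 1 fun q : Coord N × ℂ × ℂ => jac q.1 q.2.1 :=
    contDiff_jac.comp (contDiff_fst.prodMk (contDiff_fst.comp contDiff_snd))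
  have hj2 : ContDiff ℝ 1 fun q : Coord N × ℂ × ℂ => jac q.1 q.2.2 :=
    contDiff_jac.comp (contDiff_fst.prodMk (contDiff_snd.comp contDiff_snd))
  have hjline : ∀ (b : Coord N) (p : ℂ × ℂ), HasDerivAt
      (fun t : ℝ => jac (a + t • b) p.1 * jac (a + t • b) p.2)
      (jacVar a b p.1 * jac a p.2 + jac a p.1 * jacVar a b p.2) 0 := fun b p => by
    exact ((hasDerivAt_jac_line a b p.1).mul (hasDerivAt_jac_line a b p.2)).congr_deriv (by simp)
  set O : Set (Coord N × ℂ × ℂ) := {q | divDiff q.1 q.2.1 q.2.2 ≠ 0}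
  have hcd : ContDiff ℝ 1 fun q : Coord N × ℂ × ℂ => divDiff q.1 q.2.1 q.2.2 := contDiff_divDiff
  have hO : IsOpen O := isOpen_ne_fun hcd.continuous continuous_const
  obtain ⟨L₁, hL₁, hL₁b⟩ := exists_hasFDerivAt_integral (a := a) hKc hKm ae_prod_mem_closedBall hlog
    isOpen_univ (fun _ _ => mem_univ _) (hj1.mul hj2).contDiffOn (fun b p _ => hjline b p)
  have hk2 : ContDiffOn ℝ 1 (fun q : Coord N × ℂ × ℂ =>
      Real.log ‖divDiff q.1 q.2.1 q.2.2‖ * (jac q.1 q.2.1 * jac q.1 q.2.2)) O := fun q hq =>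
    (((hcd.contDiffAt.norm ℝ hq).log (norm_ne_zero_iff.2 hq)).mul
      (hj1.mul hj2).contDiffAt).contDiffWithinAt
  obtain ⟨L₂, hL₂, hL₂b⟩ := exists_hasFDerivAt_integral (a := a) hKc hKm ae_prod_mem_closedBall
    (integrable_const (1 : ℝ)) hO (fun p hp => ha p.1 hp.1 p.2 hp.2) hk2
    (d := fun b p => (divDiff b p.1 p.2 / divDiff a p.1 p.2).re * (jac a p.1 * jac a p.2) +
      Real.log ‖divDiff a p.1 p.2‖ * (jacVar a b p.1 * jac a p.2 + jac a p.1 * jacVar a b p.2))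
    (by
      intro b p hp
      have h1 := HasFDerivAt.comp_hasDerivAt_of_eq (0 : ℝ)
        (hasFDerivAt_log_norm (ha p.1 hp.1 p.2 hp.2)) (hasDerivAt_divDiff_line a b p.1 p.2)
        (by simp)
      refine (h1.mul (hjline b p)).congr_deriv ?_
      simp [div_eq_inv_mul])
  have hsplit : ∀ c : Coord N, DivDiffNeZero c → ∀ᵐ p ∂μ, logKer c p.1 p.2 =
      Real.log ‖p.1 - p.2‖ + Real.log ‖divDiff c p.1 p.2‖ := fun c hc => by
    filter_upwards [ae_prod_ne, ae_prod_mem_closedBall] with p h1 h2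
    exact logKer_eq hc h2.1 h2.2 h1
  have hint : ∀ c : Coord N, DivDiffNeZero c → ∀ g : ℂ × ℂ → ℝ, Continuous g →
      Integrable (fun p => Real.log ‖p.1 - p.2‖ • g p) μ ∧
      Integrable (fun p => Real.log ‖divDiff c p.1 p.2‖ * g p) μ := fun c hc g hg => by
    have h1 : Integrable (fun p => Real.log ‖p.1 - p.2‖ • g p) μ := by
      obtain ⟨C, hC⟩ := hKc.exists_bound_of_continuousOn hg.continuousOn
      exact hlog.mul_bdd hg.aestronglyMeasurable
        (ae_prod_mem_closedBall.mono fun z hz => hC z hz)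
    refine ⟨h1, ((integrable_mul_logKer_prod hc hg).sub h1).congr ?_⟩
    filter_upwards [hsplit c hc] with p hp
    simp only [Pi.sub_apply, smul_eq_mul, hp]
    ring
  refine ⟨L₁ + L₂, (hL₁.add hL₂).congr_of_eventuallyEq ?_, fun b => ?_⟩
  · filter_upwards [isOpen_divDiffNeZero.mem_nhds ha] with c hc
    have hj := continuous_jac c
    obtain ⟨h1, h2⟩ := hint c hc (fun p => jac c p.1 * jac c p.2) (by fun_prop)
    simp only [Pi.add_apply, one_smul]
    rw [selfEnergy_eq hc, ← integral_add h1 h2]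
    refine integral_congr_ae ?_
    filter_upwards [hsplit c hc] with p hp
    rw [hp, smul_eq_mul]
    ring
  · have hj := continuous_jac a
    have hjv := continuous_jacVar a b
    obtain ⟨h1, h2⟩ := hint a ha
      (fun p => jacVar a b p.1 * jac a p.2 + jac a p.1 * jacVar a b p.2) (by fun_prop)
    have h3 := integrable_re_divDiff_div ha b
    simp only [one_smul] at hL₂b
    rw [add_apply, hL₁b, hL₂b]
    refine (integral_add h1 (h3.add h2)).symm.trans (integral_congr_ae ?_)
    filter_upwards [hsplit a ha] with p hp
    rw [hp, smul_eq_mul, Pi.add_apply]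
    ring

theorem integrable_logKer_exp_smul {E : Type*} [NormedAddCommGroup E] [NormedSpace ℝ E]
    [SecondCountableTopology E] {a : Coord N} (ha : DivDiffNeZero a) {c : ℝ × ℂ → E}
    (hc : Continuous c) :
    Integrable (fun p : ℝ × ℂ => logKer a (Complex.exp (p.1 * Complex.I)) p.2 • c p)
      ((volume.restrict (Ioc 0 (2 * Real.pi))).prod (volume.restrict (ball (0 : ℂ) 1))) := by
  have h1 : Integrable (fun p : ℝ × ℂ => logKer a (Complex.exp (p.1 * Complex.I)) p.2)
      ((volume.restrict (Ioc 0 (2 * Real.pi))).prod (volume.restrict (ball (0 : ℂ) 1))) :=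
    integrable_logKer_prod (g := fun θ : ℝ => Complex.exp (θ * Complex.I)) ha
      (by fun_prop : Continuous fun θ : ℝ => Complex.exp (θ * Complex.I)).measurable
      (Filter.Eventually.of_forall norm_exp_mul_I_mem_closedBall)
  obtain ⟨C, hC⟩ := ((isCompact_Icc (a := (0 : ℝ)) (b := 2 * Real.pi)).prod
    (isCompact_closedBall (0 : ℂ) 1)).exists_bound_of_continuousOn hc.continuousOn
  refine (h1.norm.mul_const C).mono' (h1.aestronglyMeasurable.smul hc.aestronglyMeasurable) ?_
  filter_upwards [Measure.quasiMeasurePreserving_fst.ae (ae_restrict_mem measurableSet_Ioc),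
    Measure.quasiMeasurePreserving_snd.ae ae_mem_closedBall] with p h2 h3
  rw [norm_smul]
  exact mul_le_mul_of_nonneg_left (hC p ⟨⟨h2.1.le, h2.2⟩, h3⟩) (norm_nonneg _)

/-- The variation of the logarithmic energy of the image domain. -/
theorem exists_hasFDerivAt_selfEnergy {a : Coord N} (ha : DivDiffNeZero a) :
    ∃ L : Coord N →L[ℝ] ℝ, HasFDerivAt selfEnergy L a ∧ ∀ b,
      L b = 2 * ∫ θ in (0 : ℝ)..2 * Real.pi,
        normalVar a b θ * logPot a (Complex.exp (θ * Complex.I)) := by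
  obtain ⟨L, hL, hLb⟩ := exists_hasFDerivAt_selfEnergy_aux ha
  refine ⟨L, hL, fun b => ?_⟩
  have hj := continuous_jac a
  have hjv := continuous_jacVar a b
  have hpb := continuous_polyMap b
  have hpa := continuous_polyMap a
  have hda := continuous_polyDeriv a
  have hn := continuous_normalVar a b
  have hpi := Real.two_pi_pos
  choose! S' hS' hS'v _ using fun w (hw : w ∈ ball (0 : ℂ) 1) => exists_hasFDerivAt_logPot ha hw
  -- the integral over the disk of the boundary integral
  set A : ℂ → ℝ := fun w => ∫ θ in (0 : ℝ)..2 * Real.pi,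
    logKer a (Complex.exp (θ * Complex.I)) w • (normalVar a b θ * jac a w) with hA
  have hiA := integrable_logKer_exp_smul (c := fun p : ℝ × ℂ => normalVar a b p.1 * jac a p.2) ha
    (by fun_prop)
  have hiB := integrable_logKer_exp_smul (c := fun p : ℝ × ℂ => Complex.exp (p.1 * Complex.I) *
    polyDeriv a (Complex.exp (p.1 * Complex.I))) ha (by fun_prop)
  have hA1 : IntegrableOn A (ball 0 1) := by
    have := hiA.integral_prod_right
    simp only [hA, intervalIntegral.integral_of_le hpi.le]
    exact this
  have hA2 : ∫ w in ball (0 : ℂ) 1, A w = ∫ θ in (0 : ℝ)..2 * Real.pi,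
      normalVar a b θ * logPot a (Complex.exp (θ * Complex.I)) := by
    simp only [hA, intervalIntegral.integral_of_le hpi.le]
    rw [integral_integral_swap (f := fun (w : ℂ) (θ : ℝ) =>
      logKer a (Complex.exp (θ * Complex.I)) w • (normalVar a b θ * jac a w)) hiA.swap]
    refine integral_congr_ae (Filter.Eventually.of_forall fun θ => ?_)
    simp only [logPot, ← integral_const_mul, smul_eq_mul]
    refine integral_congr_ae (Filter.Eventually.of_forall fun z => ?_)
    simp only [logKer_comm a z]
    ring
  have hB1 : IntegrableOn (bdryLog a) (ball 0 1) := by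
    have := hiB.integral_prod_right
    refine Integrable.congr this (Filter.Eventually.of_forall fun w => ?_)
    simp only [bdryLog, intervalIntegral.integral_of_le hpi.le]
    refine integral_congr_ae (Filter.Eventually.of_forall fun θ => ?_)
    simp only [Complex.real_smul]
    ring
  -- the flux of the potential
  set T : ℂ → ℝ := fun w => -(jac a w * (polyMap b w * conj (bdryLog a w)).re) +
    jacVar a b w * logPot a w with hT
  have hTi : IntegrableOn T (ball 0 1) := by
    refine Integrable.add ?_ ?_
    · have hB2 : IntegrableOn (fun w => conj (bdryLog a w)) (ball 0 1) :=
        (Complex.conjCLE : ℂ →L[ℝ] ℂ).integrable_comp hB1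
      obtain ⟨C, hC⟩ := (isCompact_closedBall (0 : ℂ) 1).exists_bound_of_continuousOn
        hpb.continuousOn
      have h1 := hB2.bdd_mul hpb.aestronglyMeasurable (ae_mem_closedBall.mono fun z hz => hC z hz)
      obtain ⟨C', hC'⟩ := (isCompact_closedBall (0 : ℂ) 1).exists_bound_of_continuousOn
        hj.continuousOn
      exact (h1.re.bdd_mul hj.aestronglyMeasurable
        (ae_mem_closedBall.mono fun z hz => hC' z hz)).neg
    · exact ((hjv.continuousOn.mul (continuousOn_logPot ha)).integrableOn_compact
        (isCompact_closedBall _ _)).mono_set ball_subset_closedBall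
  -- The term produced by translating the field by `ḟ(w)` is exactly the derivative of `logPot a`
  -- along `ḟ conj f'`, by the `bdryLog` form of that derivative; hence `T` is a divergence.
  have hST : ∀ w ∈ ball (0 : ℂ) 1, S' w (polyMap b w * conj (polyDeriv a w)) +
      jacVar a b w • logPot a w = T w := by
    intro w hw
    rw [hS'v w hw, hT, smul_eq_mul]
    congr 2
    have h1 : polyDeriv a w * (polyMap b w * conj (polyDeriv a w)) * conj (bdryLog a w) =
        (jac a w : ℂ) * (polyMap b w * conj (bdryLog a w)) := by
      rw [jac, ← Complex.mul_conj]
      ring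
    rw [h1, Complex.re_ofReal_mul]
  have hflux := integral_flux a b (continuousOn_logPot ha) hS'
    (hTi.congr_fun (fun w hw => (hST w hw).symm) measurableSet_ball)
  rw [setIntegral_congr_fun measurableSet_ball hST] at hflux
  -- the inner integral
  have hinner : ∀ w ∈ ball (0 : ℂ) 1, ∫ z in ball (0 : ℂ) 1,
      ((divDiff b z w / divDiff a z w).re * (jac a z * jac a w) +
        (jacVar a b z * jac a w + jac a z * jacVar a b w) * logKer a z w) = A w + T w := by
    intro w hw
    have hwc := ball_subset_closedBall hw
    have hu0 := polyMap_exp_sub_ne_zero ha hw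
    have c2 : Continuous fun θ : ℝ => logKer a (Complex.exp (θ * Complex.I)) w :=
      Continuous.log (by fun_prop) fun θ => norm_ne_zero_iff.2 (hu0 θ)
    have c1 : Continuous fun θ : ℝ => Complex.exp (θ * Complex.I) *
        polyDeriv a (Complex.exp (θ * Complex.I)) := by fun_prop
    have e1 : ∫ θ in (0 : ℝ)..2 * Real.pi,
        ((polyMap b (Complex.exp (θ * Complex.I)) - polyMap b w) *
          conj (Complex.exp (θ * Complex.I) * polyDeriv a (Complex.exp (θ * Complex.I)))).re *
        logKer a (Complex.exp (θ * Complex.I)) w =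
        (∫ θ in (0 : ℝ)..2 * Real.pi,
          logKer a (Complex.exp (θ * Complex.I)) w * normalVar a b θ) -
        (polyMap b w * conj (bdryLog a w)).re := by
      have e2 := ((Complex.reCLM.comp (polyMap b w • (1 : ℂ →L[ℝ] ℂ))).comp
        (Complex.conjCLE : ℂ →L[ℝ] ℂ)).intervalIntegral_comp_comm
          ((c1.mul (Complex.continuous_ofReal.comp c2)).intervalIntegrable
            (μ := volume) 0 (2 * Real.pi))
      simp only [ContinuousLinearMap.comp_apply, smul_apply, one_apply_eq_self,
        ContinuousLinearEquiv.coe_coe, Complex.conjCLE_apply, smul_eq_mul, Complex.reCLM_apply,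
        Pi.mul_apply, Function.comp] at e2
      rw [bdryLog, ← e2, ← intervalIntegral.integral_sub]
      · refine intervalIntegral.integral_congr fun θ _ => ?_
        simp only [normalVar, map_mul _ (_ * _) (Complex.ofReal _), Complex.conj_ofReal,
          ← mul_assoc, Complex.re_mul_ofReal, sub_mul, Complex.sub_re]
        ring
      · exact (c2.mul hn).intervalIntegrable _ _
      · exact Continuous.intervalIntegrable (by fun_prop) _ _
    have i1 : IntegrableOn (fun z => (divDiff b z w / divDiff a z w).re * jac a z +
        jacVar a b z * logKer a z w) (ball 0 1) := by
      refine Integrable.add ?_ (integrableOn_mul_logKer ha hwc hjv)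
      exact (((Complex.continuous_re.comp_continuousOn
        ((differentiable_divDiff_left b w).continuous.continuousOn.div
        (differentiable_divDiff_left a w).continuous.continuousOn
          fun z hz => ha z hz w hwc)).mul hj.continuousOn).integrableOn_compact
            (isCompact_closedBall _ _)).mono_set ball_subset_closedBall
    have i2 := integrableOn_mul_logKer ha hwc hj
    have e3 := integral_add (i1.const_mul (jac a w)) (i2.const_mul (jacVar a b w))
    rw [integral_const_mul, integral_const_mul, integral_flux_logKer ha b hwc, e1] at e3
    refine (Eq.trans ?_ e3).trans ?_
    · refine integral_congr_ae (Filter.Eventually.of_forall fun z => ?_)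
      simp only
      ring
    · have e4 : A w = jac a w * ∫ θ in (0 : ℝ)..2 * Real.pi,
          logKer a (Complex.exp (θ * Complex.I)) w * normalVar a b θ := by
        simp only [hA, ← intervalIntegral.integral_const_mul, smul_eq_mul]
        refine intervalIntegral.integral_congr fun θ _ => ?_
        ring
      rw [e4, hT, ← logPot]
      ring
  have hint : Integrable (fun p : ℂ × ℂ =>
      (divDiff b p.1 p.2 / divDiff a p.1 p.2).re * (jac a p.1 * jac a p.2) +
        (jacVar a b p.1 * jac a p.2 + jac a p.1 * jacVar a b p.2) * logKer a p.1 p.2)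
      ((volume.restrict (ball (0 : ℂ) 1)).prod (volume.restrict (ball (0 : ℂ) 1))) :=
    (integrable_re_divDiff_div ha b).add (integrable_mul_logKer_prod ha (by fun_prop))
  -- The factor `2`: the flux at fixed `w`, integrated over `w` by Fubini, and the flux of the
  -- potential are the same boundary integral.
  rw [hLb, integral_prod_symm _ hint, setIntegral_congr_fun measurableSet_ball hinner,
    integral_add hA1 hTi, hA2, hflux]
  simp only [smul_eq_mul]
  ring

/-! ### Negative moments and the Cauchy transform of `conj z`. -/

theorem differentiableAt_intervalIntegral_div_sub {g u : ℝ → ℂ} (hg : Continuous g)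
    (hu : Continuous u) {s t : ℝ} (hst : s ≤ t) {x : ℂ} (hx : ∀ θ, u θ ≠ x) :
    DifferentiableAt ℂ (fun x => ∫ θ in s..t, g θ / (u θ - x)) x := by
  set O : Set (ℂ × ℝ) := {p | u p.2 - p.1 ≠ 0} with hO
  have hd : ∀ p ∈ O, HasFDerivAt (fun b => g p.2 / (u p.2 - b))
      ((g p.2 / (u p.2 - p.1) ^ 2) • (1 : ℂ →L[ℂ] ℂ)) p.1 := by
    intro p hp
    have h1 := ((hasDerivAt_const p.1 (g p.2)).div ((hasDerivAt_id p.1).const_sub (u p.2))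
      hp).hasFDerivAt
    refine h1.congr_fderiv ?_
    ext
    simp
  have hc1 : ContinuousOn (fun p : ℂ × ℝ => g p.2 / (u p.2 - p.1)) O :=
    (Continuous.continuousOn (by fun_prop)).div (Continuous.continuousOn (by fun_prop))
      fun p hp => hp
  have hc2 : ContinuousOn (fun p : ℂ × ℝ => g p.2 / (u p.2 - p.1) ^ 2) O :=
    (Continuous.continuousOn (by fun_prop)).div (Continuous.continuousOn (by fun_prop))
      fun p hp => pow_ne_zero 2 hp
  have := hasFDerivAt_integral_weight (𝕜 := ℂ) (μ := volume.restrict (Ioc s t))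
    (ρ := fun _ => (1 : ℝ)) (a := x) isCompact_Icc measurableSet_Icc
    ((ae_restrict_mem measurableSet_Ioc).mono fun x hx => ⟨hx.1.le, hx.2⟩)
    (integrable_const 1) (O := O) (isOpen_ne_fun (by fun_prop) continuous_const)
    (fun θ _ => sub_ne_zero.2 (hx θ)) hd hc1 (hc2.smul continuousOn_const)
  simp only [one_smul] at this
  simpa only [intervalIntegral.integral_of_le hst] using this.differentiableAt

theorem intervalIntegral_swap {E : Type*} [NormedAddCommGroup E] [NormedSpace ℝ E] {a b c d : ℝ}
    (hab : a ≤ b) (hcd : c ≤ d) {f : ℝ → ℝ → E}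
    (hf : ContinuousOn (Function.uncurry f) (Icc a b ×ˢ Icc c d)) :
    ∫ x in a..b, ∫ y in c..d, f x y = ∫ y in c..d, ∫ x in a..b, f x y := by
  simp only [intervalIntegral.integral_of_le hab, intervalIntegral.integral_of_le hcd]
  refine integral_integral_swap ?_
  rw [Measure.prod_restrict, ← Measure.volume_eq_prod]
  exact (hf.integrableOn_compact (isCompact_Icc.prod isCompact_Icc)).mono_set
    (prod_mono Ioc_subset_Icc_self Ioc_subset_Icc_self)

theorem mul_exp_mul_I_mem_ball {r : ℝ} (h0 : 0 ≤ r) (h1 : r < 1) (θ : ℝ) :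
    r * Complex.exp (θ * Complex.I) ∈ ball (0 : ℂ) 1 := by
  rw [mem_ball_zero_iff, norm_mul, Complex.norm_exp_ofReal_mul_I, mul_one, Complex.norm_real,
    Real.norm_of_nonneg h0]
  exact h1

/-- A function whose gradient is the real part of `w^N` times a holomorphic function has the same
pairing with the normal variation as its value at the origin. -/
theorem integral_normalVar_mul_eq (a b : Coord N) {Y : ℂ → ℝ} {q : ℂ → ℂ}
    (hY : ContinuousOn Y (closedBall 0 1)) (hq : DifferentiableOn ℂ q (ball 0 1))
    (hd : ∀ w ∈ ball (0 : ℂ) 1, ∃ L : ℂ →L[ℝ] ℝ, HasFDerivAt Y L w ∧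
      ∀ v, L v = (w ^ N * q w * v).re) :
    ∫ θ in (0 : ℝ)..2 * Real.pi, normalVar a b θ * Y (Complex.exp (θ * Complex.I)) =
      Y 0 * ∫ θ in (0 : ℝ)..2 * Real.pi, normalVar a b θ := by
  have hpi := Real.two_pi_pos.le
  have hn := continuous_normalVar a b
  have hqc := hq.continuousOn
  -- Clamping the radius to `[0, 1]` makes `I` continuous on the whole line, so that its value at
  -- `1` can be reached as a limit.
  set c : ℝ → ℝ := fun r => max 0 (min r 1) with hc
  have hcc : Continuous c := by fun_prop
  have hc0 : ∀ r, 0 ≤ c r := fun r => le_max_left _ _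
  have hc1 : ∀ r, c r ≤ 1 := fun r => max_le zero_le_one (min_le_right _ _)
  have hci : ∀ r ∈ Icc (0 : ℝ) 1, c r = r := fun r hr => by
    rw [hc]
    simp [hr.1, hr.2]
  have hmem : ∀ r θ : ℝ, (c r : ℂ) * Complex.exp (θ * Complex.I) ∈ closedBall (0 : ℂ) 1 := by
    intro r θ
    rw [mem_closedBall_zero_iff, norm_mul, Complex.norm_exp_ofReal_mul_I, mul_one,
      Complex.norm_real, Real.norm_of_nonneg (hc0 r)]
    exact hc1 r
  set I : ℝ → ℝ := fun r => ∫ θ in (0 : ℝ)..2 * Real.pi,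
    normalVar a b θ * Y (c r * Complex.exp (θ * Complex.I)) with hI
  have hIc : Continuous I := by
    refine intervalIntegral.continuous_parametric_intervalIntegral_of_continuous'
      (f := fun r θ => normalVar a b θ * Y (c r * Complex.exp (θ * Complex.I))) ?_ _ _
    refine (hn.comp continuous_snd).mul ?_
    exact hY.comp_continuous (f := fun p : ℝ × ℝ => (c p.1 : ℂ) * Complex.exp (p.2 * Complex.I))
      (by fun_prop) fun p => hmem p.1 p.2
  have hconst : ∀ ρ ∈ Ico (0 : ℝ) 1, I ρ = I 0 := by
    intro ρ hρ
    have hray : ∀ r ∈ Icc (0 : ℝ) ρ, ∀ θ : ℝ,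
        (r : ℂ) * Complex.exp (θ * Complex.I) ∈ ball (0 : ℂ) 1 := fun r hr θ =>
      mul_exp_mul_I_mem_ball hr.1 (hr.2.trans_lt hρ.2) θ
    set d : ℝ → ℝ → ℝ := fun r θ => (((r : ℂ) * Complex.exp (θ * Complex.I)) ^ N *
      q (r * Complex.exp (θ * Complex.I)) * Complex.exp (θ * Complex.I)).re with hdd
    have hqr : ContinuousOn (fun p : ℝ × ℝ => q (p.1 * Complex.exp (p.2 * Complex.I)))
        (Icc 0 ρ ×ˢ Icc 0 (2 * Real.pi)) :=
      hqc.comp (by fun_prop) fun p hp => hray p.1 hp.1 p.2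
    have hdc : ContinuousOn (fun p : ℝ × ℝ => d p.1 p.2) (Icc 0 ρ ×ˢ Icc 0 (2 * Real.pi)) :=
      Complex.continuous_re.comp_continuousOn
        (((Continuous.continuousOn (by fun_prop)).mul hqr).mul (Continuous.continuousOn (by fun_prop)))
    have hftc : ∀ θ ∈ Icc (0 : ℝ) (2 * Real.pi), Y (ρ * Complex.exp (θ * Complex.I)) - Y 0 =
        ∫ r in (0 : ℝ)..ρ, d r θ := by
      intro θ hθ
      have h1 := intervalIntegral.integral_eq_sub_of_hasDerivAt (a := 0) (b := ρ)
        (f := fun r : ℝ => Y (r * Complex.exp (θ * Complex.I))) (f' := fun r => d r θ) ?_ ?_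
      · simp only [Complex.ofReal_zero, zero_mul] at h1
        rw [h1]
      · intro r hr
        rw [uIcc_of_le hρ.1] at hr
        obtain ⟨L, hL, hLv⟩ := hd _ (hray r hr θ)
        have h2 : HasDerivAt (fun r : ℝ => (r : ℂ) * Complex.exp (θ * Complex.I))
            (Complex.exp (θ * Complex.I)) r := by
          simpa using (Complex.ofRealCLM.hasDerivAt (x := r)).mul_const (Complex.exp (θ * Complex.I))
        exact (hL.comp_hasDerivAt r h2).congr_deriv (hLv _)
      · refine ContinuousOn.intervalIntegrable ?_
        rw [uIcc_of_le hρ.1]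
        exact hdc.comp (f := fun r : ℝ => (r, θ)) (by fun_prop) fun r hr => ⟨hr, hθ⟩
    -- The radial derivative contributes `ζ^(N+1)`: `N` factors from `w^N` and one from the
    -- direction `e^{iθ}`. Multiplied by `n` this is `normalPoly`, and the mean value property gives
    -- zero.
    have hzero : ∀ r ∈ Icc (0 : ℝ) ρ, ∫ θ in (0 : ℝ)..2 * Real.pi, normalVar a b θ * d r θ = 0 := by
      intro r hr
      have h1 : ∀ θ : ℝ, normalVar a b θ * d r θ = Complex.reCLM ((r : ℂ) ^ N *
          (q (r * Complex.exp (θ * Complex.I)) *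
            normalPoly a b (Complex.exp (θ * Complex.I)))) := by
        intro θ
        rw [← pow_mul_normalVar, hdd, Complex.reCLM_apply, ← Complex.re_ofReal_mul]
        congr 1
        ring
      have h2 : DifferentiableOn ℂ (fun z => q (r * z) * normalPoly a b z) (closedBall 0 1) := by
        refine DifferentiableOn.mul (hq.comp (by fun_prop) fun z hz => ?_)
          (differentiable_normalPoly a b).differentiableOn
        rw [mem_closedBall_zero_iff] at hz
        rw [mem_ball_zero_iff, norm_mul, Complex.norm_real, Real.norm_of_nonneg hr.1]
        calc r * ‖z‖ ≤ r * 1 := mul_le_mul_of_nonneg_left hz hr.1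
          _ < 1 := by linarith [hr.2, hρ.2]
      have h3 := integral_exp_mul_I_of_diffContOnCl
        (DifferentiableOn.diffContOnCl (by rwa [closure_ball _ one_ne_zero]))
      simp only [h1]
      rw [Complex.reCLM.intervalIntegral_comp_comm, intervalIntegral.integral_const_mul, h3,
        normalPoly_zero_right]
      · simp
      · refine ContinuousOn.intervalIntegrable ?_
        exact continuousOn_const.mul (h2.continuousOn.comp (by fun_prop)
          fun θ _ => norm_exp_mul_I_mem_closedBall θ)
    have h1 : I ρ - I 0 = ∫ θ in (0 : ℝ)..2 * Real.pi, ∫ r in (0 : ℝ)..ρ,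
        normalVar a b θ * d r θ := by
      have hic : ∀ r, IntervalIntegrable (fun θ => normalVar a b θ *
          Y (c r * Complex.exp (θ * Complex.I))) volume 0 (2 * Real.pi) := fun r =>
        (hn.mul (hY.comp_continuous (by fun_prop) fun θ => hmem r θ)).intervalIntegrable _ _
      rw [hI]
      simp only
      rw [← intervalIntegral.integral_sub (hic ρ) (hic 0)]
      refine intervalIntegral.integral_congr fun θ hθ => ?_
      rw [uIcc_of_le hpi] at hθ
      simp only [intervalIntegral.integral_const_mul, ← hftc θ hθ, hci ρ ⟨hρ.1, hρ.2.le⟩,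
        hci 0 ⟨le_rfl, zero_le_one⟩, Complex.ofReal_zero, zero_mul]
      ring
    rw [← intervalIntegral_swap hρ.1 hpi] at h1
    · have h2 : ∫ r in (0 : ℝ)..ρ, ∫ θ in (0 : ℝ)..2 * Real.pi, normalVar a b θ * d r θ =
          ∫ r in (0 : ℝ)..ρ, (0 : ℝ) := intervalIntegral.integral_congr fun r hr => by
        rw [uIcc_of_le hρ.1] at hr
        exact hzero r hr
      rw [h2, intervalIntegral.integral_zero] at h1
      linarith
    · exact (hn.comp continuous_snd).continuousOn.mul hdc
  -- The gradient is only controlled inside the disk, so radius `1` is reached by continuity of `Y`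
  -- up to the circle.
  have hlim : I 1 = I 0 := by
    have hcl : (1 : ℝ) ∈ closure (Ico 0 1) := by rw [closure_Ico zero_ne_one]; simp
    have hcl' : closure (Ico (0 : ℝ) 1) ⊆ {r | I r = I 0} :=
      (isClosed_eq hIc continuous_const).closure_subset_iff.2 hconst
    exact hcl' hcl
  simp only [hI, hci 1 ⟨zero_le_one, le_rfl⟩, hci 0 ⟨le_rfl, zero_le_one⟩, Complex.ofReal_one,
    one_mul, Complex.ofReal_zero, zero_mul] at hlim
  rw [hlim, intervalIntegral.integral_mul_const, mul_comm]

theorem negMoment_eq (a : Coord N) (k : ℕ) :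
    negMoment a k = (1 / (2 * (Real.pi : ℂ))) * ∫ θ in (0 : ℝ)..2 * Real.pi,
      Complex.exp (θ * Complex.I) * polyDeriv a (Complex.exp (θ * Complex.I)) *
        conj (polyMap a (Complex.exp (θ * Complex.I))) /
          polyMap a (Complex.exp (θ * Complex.I)) ^ k := by
  have hd : ∀ θ : ℝ, deriv (boundaryCurve a) θ =
      polyDeriv a (Complex.exp (θ * Complex.I)) * (Complex.exp (θ * Complex.I) * Complex.I) := by
    intro θ
    have h1 : HasDerivAt (fun θ : ℝ => Complex.exp (θ * Complex.I))
        (Complex.exp (θ * Complex.I) * Complex.I) θ := by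
      simpa using ((Complex.ofRealCLM.hasDerivAt (x := θ)).mul_const Complex.I).cexp
    exact ((hasDerivAt_polyMap a _).comp θ h1).deriv
  have h2 : ∀ θ : ℝ, boundaryCurve a θ ^ (-(k : ℤ)) * conj (boundaryCurve a θ) *
      deriv (boundaryCurve a) θ = Complex.I * (Complex.exp (θ * Complex.I) *
        polyDeriv a (Complex.exp (θ * Complex.I)) *
        conj (polyMap a (Complex.exp (θ * Complex.I))) /
          polyMap a (Complex.exp (θ * Complex.I)) ^ k) := by
    intro θ
    rw [hd, boundaryCurve, zpow_neg, zpow_natCast, div_eq_mul_inv]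
    ring
  simp only [negMoment, contourMoment, h2]
  rw [intervalIntegral.integral_const_mul, ← mul_assoc]
  congr 1
  have := Complex.I_ne_zero
  have := Complex.ofReal_ne_zero.2 Real.pi_ne_zero
  field_simp

/-- Cauchy's formula for `f' / F(·, w)`, where `F` is the divided difference: its value at `w` is
`1` because `F(w, w) = f'(w)`. -/
theorem integral_exp_mul_polyDeriv_div {a : Coord N} (ha : DivDiffNeZero a) {w : ℂ}
    (hw : w ∈ ball (0 : ℂ) 1) :
    ∫ θ in (0 : ℝ)..2 * Real.pi, Complex.exp (θ * Complex.I) *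
      polyDeriv a (Complex.exp (θ * Complex.I)) /
        (polyMap a (Complex.exp (θ * Complex.I)) - polyMap a w) = 2 * Real.pi := by
  have hwc := ball_subset_closedBall hw
  have hg : DifferentiableOn ℂ (fun z => polyDeriv a z / divDiff a z w) (closedBall 0 1) :=
    (differentiable_polyDeriv a).differentiableOn.div
      (differentiable_divDiff_left a w).differentiableOn fun z hz => ha z hz w hwc
  have h1 := (DifferentiableOn.diffContOnCl
    (by rwa [closure_ball _ one_ne_zero])).circleIntegral_sub_inv_smul hw
  have h2 : ∀ θ : ℝ, deriv (circleMap 0 1) θ • ((circleMap 0 1 θ - w)⁻¹ •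
      (polyDeriv a (circleMap 0 1 θ) / divDiff a (circleMap 0 1 θ) w)) =
      Complex.I * (Complex.exp (θ * Complex.I) *
      polyDeriv a (Complex.exp (θ * Complex.I)) /
        (polyMap a (Complex.exp (θ * Complex.I)) - polyMap a w)) := by
    intro θ
    simp only [deriv_circleMap, circleMap, zero_add, Complex.ofReal_one, one_mul, smul_eq_mul]
    rw [← divDiff_mul_sub, div_eq_mul_inv, div_eq_mul_inv, mul_inv]
    ring
  simp only [circleIntegral, h2] at h1
  rw [intervalIntegral.integral_const_mul, divDiff_self, div_self, smul_eq_mul, mul_one] at h1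
  · refine mul_left_cancel₀ Complex.I_ne_zero (h1.trans ?_)
    ring
  · rw [← divDiff_self]
    exact ha w hwc w hwc

/-- The Cauchy transform of `conj z` along the boundary of the image domain, at `f(w)`. -/
noncomputable def bdryCauchy (a : Coord N) (w : ℂ) : ℂ :=
  ∫ θ in (0 : ℝ)..2 * Real.pi, Complex.exp (θ * Complex.I) *
    polyDeriv a (Complex.exp (θ * Complex.I)) * conj (polyMap a (Complex.exp (θ * Complex.I))) /
      (polyMap a (Complex.exp (θ * Complex.I)) - polyMap a w)

theorem bdryQuot_eq {a : Coord N} (ha : DivDiffNeZero a) {w : ℂ} (hw : w ∈ ball (0 : ℂ) 1) :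
    bdryQuot a w = bdryCauchy a w - 2 * Real.pi * conj (polyMap a w) := by
  have hu := polyMap_exp_sub_ne_zero ha hw
  have hpc := continuous_polyMap a
  have hdc := continuous_polyDeriv a
  rw [← integral_exp_mul_polyDeriv_div ha hw, bdryCauchy, bdryQuot,
    ← intervalIntegral.integral_mul_const, ← intervalIntegral.integral_sub]
  · refine intervalIntegral.integral_congr fun θ _ => ?_
    simp only [map_sub]
    ring
  · exact (Continuous.div (by fun_prop) (by fun_prop) hu).intervalIntegrable _ _
  · exact ((Continuous.div (by fun_prop) (by fun_prop) hu).mul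
      continuous_const).intervalIntegrable _ _

theorem polyMap_exp_ne_zero {a : Coord N} (ha : DivDiffNeZero a) (θ : ℝ) :
    polyMap a (Complex.exp (θ * Complex.I)) ≠ 0 := by
  simpa [polyMap_zero_right] using polyMap_exp_sub_ne_zero ha (mem_ball_self one_pos) θ

/-- The polynomial in `f(w)` whose derivative is `-π` times the Taylor polynomial at the origin of
the Cauchy transform of `conj z`. -/
noncomputable def negPot (a : Coord N) (w : ℂ) : ℂ :=
  ∑ k : Fin N, -(Real.pi * negMoment a ((k : ℕ) + 1) / ((k : ℂ) + 1)) *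
    polyMap a w ^ ((k : ℕ) + 1)

theorem hasDerivAt_negPot (a : Coord N) (w : ℂ) :
    HasDerivAt (negPot a) (-(Real.pi * polyDeriv a w *
      ∑ k : Fin N, negMoment a ((k : ℕ) + 1) * polyMap a w ^ (k : ℕ))) w := by
  have := HasDerivAt.fun_sum (u := Finset.univ) fun (k : Fin N) _ =>
    ((hasDerivAt_polyMap a w).pow ((k : ℕ) + 1)).const_mul
      (-(Real.pi * negMoment a ((k : ℕ) + 1) / ((k : ℂ) + 1)))
  refine this.congr_deriv ?_
  rw [Finset.mul_sum, ← Finset.sum_neg_distrib]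
  refine Finset.sum_congr rfl fun k _ => ?_
  have h : ((k : ℂ) + 1) ≠ 0 := Nat.cast_add_one_ne_zero _
  push_cast
  field_simp

theorem continuous_negPot (a : Coord N) : Continuous (negPot a) :=
  continuous_iff_continuousAt.2 fun w => (hasDerivAt_negPot a w).continuousAt

theorem inv_sub_geom_sum {F x : ℂ} (hF : F ≠ 0) (hx : F - x ≠ 0) (n : ℕ) :
    1 / (F - x) - ∑ k : Fin n, x ^ (k : ℕ) / F ^ ((k : ℕ) + 1) = x ^ n * (1 / (F ^ n * (F - x))) := by
  rw [Fin.sum_univ_eq_sum_range fun k => x ^ k / F ^ (k + 1)]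
  induction n with
  | zero => simp
  | succ n ih =>
    rw [Finset.sum_range_succ, ← sub_sub, ih]
    field_simp
    ring

/-- The remainder of the Taylor polynomial at the origin of the Cauchy transform of `conj z`. -/
noncomputable def bdryRem (a : Coord N) (w : ℂ) : ℂ :=
  ∫ θ in (0 : ℝ)..2 * Real.pi, Complex.exp (θ * Complex.I) *
    polyDeriv a (Complex.exp (θ * Complex.I)) * conj (polyMap a (Complex.exp (θ * Complex.I))) /
      polyMap a (Complex.exp (θ * Complex.I)) ^ N /
      (polyMap a (Complex.exp (θ * Complex.I)) - polyMap a w)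

/-- Expand `1 / (f(ζ) - f(w))` as a finite geometric series in `f(w) / f(ζ)`; the coefficients
integrate to the negative moments. The remainder is exact, so no smallness of `f(w)` is needed. -/
theorem bdryCauchy_sub {a : Coord N} (ha : DivDiffNeZero a) {w : ℂ} (hw : w ∈ ball (0 : ℂ) 1) :
    bdryCauchy a w - 2 * Real.pi *
      ∑ k : Fin N, negMoment a ((k : ℕ) + 1) * polyMap a w ^ (k : ℕ) =
      polyMap a w ^ N * bdryRem a w := by
  have hu := polyMap_exp_sub_ne_zero ha hw
  have hz := polyMap_exp_ne_zero ha
  have hpc := continuous_polyMap a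
  have hdc := continuous_polyDeriv a
  have hpi := Complex.ofReal_ne_zero.2 Real.pi_ne_zero
  set g : ℝ → ℂ := fun θ => Complex.exp (θ * Complex.I) *
    polyDeriv a (Complex.exp (θ * Complex.I)) *
      conj (polyMap a (Complex.exp (θ * Complex.I))) with hg
  have hgc : Continuous g := by fun_prop
  have hk : ∀ k : Fin N, Continuous fun θ : ℝ => g θ * (polyMap a w ^ (k : ℕ) /
      polyMap a (Complex.exp (θ * Complex.I)) ^ ((k : ℕ) + 1)) := fun k =>
    hgc.mul (continuous_const.div (by fun_prop) fun θ => pow_ne_zero _ (hz θ))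
  have h1 : 2 * Real.pi * ∑ k : Fin N, negMoment a ((k : ℕ) + 1) * polyMap a w ^ (k : ℕ) =
      ∫ θ in (0 : ℝ)..2 * Real.pi, ∑ k : Fin N, g θ * (polyMap a w ^ (k : ℕ) /
        polyMap a (Complex.exp (θ * Complex.I)) ^ ((k : ℕ) + 1)) := by
    rw [intervalIntegral.integral_finsetSum fun k _ => (hk k).intervalIntegrable _ _,
      Finset.mul_sum]
    refine Finset.sum_congr rfl fun k _ => ?_
    rw [negMoment_eq, mul_assoc (1 / _), ← intervalIntegral.integral_mul_const, ← mul_assoc,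
      mul_one_div_cancel (by simp), one_mul]
    refine intervalIntegral.integral_congr fun θ _ => ?_
    simp only [hg]
    ring
  rw [h1, bdryCauchy, bdryRem, ← intervalIntegral.integral_const_mul,
    ← intervalIntegral.integral_sub]
  · refine intervalIntegral.integral_congr fun θ _ => ?_
    simp only [← Finset.mul_sum]
    rw [div_eq_mul_one_div, ← mul_sub (g θ), inv_sub_geom_sum (hz θ) (hu θ) N, one_div, mul_inv]
    simp only [hg, div_eq_mul_inv]
    ring
  · exact (hgc.div (by fun_prop) hu).intervalIntegrable _ _
  · refine Continuous.intervalIntegrable (continuous_finsetSum _ fun k _ => hk k) _ _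

theorem differentiableOn_bdryRem {a : Coord N} (ha : DivDiffNeZero a) :
    DifferentiableOn ℂ (bdryRem a) (ball 0 1) := by
  intro w hw
  have hz := polyMap_exp_ne_zero ha
  have hpc := continuous_polyMap a
  have hdc := continuous_polyDeriv a
  have h1 := differentiableAt_intervalIntegral_div_sub
    (g := fun θ => Complex.exp (θ * Complex.I) * polyDeriv a (Complex.exp (θ * Complex.I)) *
      conj (polyMap a (Complex.exp (θ * Complex.I))) /
      polyMap a (Complex.exp (θ * Complex.I)) ^ N)
    (u := fun θ => polyMap a (Complex.exp (θ * Complex.I))) (x := polyMap a w)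
    (Continuous.div (by fun_prop) (by fun_prop) fun θ => pow_ne_zero _ (hz θ)) (by fun_prop)
    Real.two_pi_pos.le fun θ => sub_ne_zero.1 (polyMap_exp_sub_ne_zero ha hw θ)
  exact (h1.comp w (differentiable_polyMap a w)).differentiableWithinAt

theorem hasFDerivAt_normSq_polyMap (a : Coord N) (w : ℂ) :
    HasFDerivAt (fun w => Complex.normSq (polyMap a w))
      (Complex.reCLM.comp (polyMap a w • (Complex.conjCLE : ℂ →L[ℝ] ℂ).comp
        (polyDeriv a w • (1 : ℂ →L[ℝ] ℂ)) + conj (polyMap a w) •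
          (polyDeriv a w • (1 : ℂ →L[ℝ] ℂ)))) w := by
  have := Complex.reCLM.hasFDerivAt.comp w
    (hasFDerivAt_mul_conj (hasDerivAt_polyMap a w) (hasDerivAt_polyMap a w))
  simpa only [Function.comp_def, Complex.mul_conj, Complex.reCLM_apply, Complex.ofReal_re]
    using this

/-- The pairing of the logarithmic potential with the normal variation. -/
theorem integral_normalVar_mul_logPot {a : Coord N} (ha : DivDiffNeZero a) (b : Coord N) :
    ∫ θ in (0 : ℝ)..2 * Real.pi, normalVar a b θ * (logPot a (Complex.exp (θ * Complex.I)) -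
      Real.pi / 2 * Complex.normSq (polyMap a (Complex.exp (θ * Complex.I))) -
        (negPot a (Complex.exp (θ * Complex.I))).re) =
      logPot a 0 * ∫ θ in (0 : ℝ)..2 * Real.pi, normalVar a b θ := by
  have hpc := continuous_polyMap a
  have hnp := continuous_negPot a
  have key := integral_normalVar_mul_eq a b (Y := fun w => logPot a w -
      Real.pi / 2 * Complex.normSq (polyMap a w) - (negPot a w).re)
    (q := fun w => -(1 / 2) * polyDeriv a w * divDiff a w 0 ^ N * bdryRem a w) ?_ ?_ ?_
  · rw [key]
    simp [negPot, polyMap_zero_right]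
  · refine ((continuousOn_logPot ha).sub (Continuous.continuousOn ?_)).sub
      (Complex.continuous_re.comp hnp).continuousOn
    exact continuous_const.mul (Complex.continuous_normSq.comp hpc)
  · exact (((differentiable_polyDeriv a).const_mul _).mul
      ((differentiable_divDiff_left a 0).pow N)).differentiableOn.mul (differentiableOn_bdryRem ha)
  · intro w hw
    obtain ⟨L, hL, -, hLv⟩ := exists_hasFDerivAt_logPot ha hw
    have h1 := hasFDerivAt_normSq_polyMap a w
    have h2 := Complex.reCLM.hasFDerivAt.comp w (hasDerivAt_negPot a w).complexToReal_fderiv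
    refine ⟨_, (hL.sub (h1.const_mul (Real.pi / 2))).sub h2, fun v => ?_⟩
    -- The `conj f` part of the gradient of the potential cancels against `(π/2) |f|²`, and `negPot`
    -- removes the first `N` Taylor terms. The remainder carries `f(w)^N`, which is `w^N` times a
    -- holomorphic function.
    have h3 : w ^ N * (-(1 / 2) * polyDeriv a w * divDiff a w 0 ^ N * bdryRem a w) * v =
        -(1 / 2) * (polyDeriv a w * v * (bdryCauchy a w - 2 * Real.pi *
      ∑ k : Fin N, negMoment a ((k : ℕ) + 1) * polyMap a w ^ (k : ℕ))) := by
      rw [bdryCauchy_sub ha hw, ← divDiff_zero_right_mul]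
      ring
    rw [h3]
    simp only [sub_apply, hLv, bdryQuot_eq ha hw]
    simp
    ring

/-! ### The differential of the prepotential. -/

/-- The part of the energy of the complement of `Ω` that is not affine in the area of `Ω`. -/
noncomputable def prepot (a : Coord N) : ℝ :=
  (1 / Real.pi) * (∫ z in ball (0 : ℂ) 1, jac a z * Complex.normSq (polyMap a z)) -
    (1 / Real.pi ^ 2) * selfEnergy a

/-- The differential of the prepotential, in terms of the differential of the moments. -/
theorem exists_hasFDerivAt_prepot {a : Coord N} (ha : DivDiffNeZero a)
    {D : Coord N →L[ℝ] Coord N} (hD : HasFDerivAt diskMomentMap D a) :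
    ∃ L : Coord N →L[ℝ] ℝ, HasFDerivAt prepot L a ∧ ∀ b,
      L b = -(2 / Real.pi) * logPot a 0 * (D b).1 +
        2 * (∑ k : Fin N, negMoment a ((k : ℕ) + 1) / ((k : ℂ) + 1) * (D b).2 k).re := by
  have hpi := Real.pi_ne_zero
  obtain ⟨L₁, hL₁, hLb₁⟩ := exists_hasFDerivAt_integral_comp_polyMap (φ := Complex.normSq)
    (by
      have : ContDiff ℝ 1 fun z : ℂ => z.re * z.re + z.im * z.im :=
        (Complex.reCLM.contDiff.mul Complex.reCLM.contDiff).add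
          (Complex.imCLM.contDiff.mul Complex.imCLM.contDiff)
      exact this) a
  obtain ⟨L₂, hL₂, hLb₂⟩ := exists_hasFDerivAt_selfEnergy ha
  obtain ⟨D', hD', hDb⟩ := exists_hasFDerivAt_diskMomentMap a
  obtain rfl := hD.unique hD'
  refine ⟨(1 / Real.pi) • L₁ - (1 / Real.pi ^ 2) • L₂,
    (hL₁.const_mul _).sub (hL₂.const_mul _), fun b => ?_⟩
  obtain ⟨hb1, hb2⟩ := hDb b
  have key := integral_normalVar_mul_logPot ha b
  have hn := continuous_normalVar a b
  have hpc := continuous_polyMap a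
  have c1 : Continuous fun θ : ℝ => normalVar a b θ * logPot a (Complex.exp (θ * Complex.I)) :=
    hn.mul ((continuousOn_logPot ha).comp_continuous (by fun_prop) norm_exp_mul_I_mem_closedBall)
  have c2 : Continuous fun θ : ℝ => normalVar a b θ •
      Complex.normSq (polyMap a (Complex.exp (θ * Complex.I))) :=
    hn.mul (Complex.continuous_normSq.comp (by fun_prop))
  have c4 : ∀ k : Fin N, Continuous fun θ : ℝ => -(Real.pi * negMoment a ((k : ℕ) + 1) /
      ((k : ℂ) + 1)) * ((normalVar a b θ : ℂ) *
        polyMap a (Complex.exp (θ * Complex.I)) ^ ((k : ℕ) + 1)) := fun k =>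
    continuous_const.mul ((Complex.continuous_ofReal.comp hn).mul (by fun_prop))
  have c3 : Continuous fun θ : ℝ => ∑ k : Fin N, -(Real.pi * negMoment a ((k : ℕ) + 1) /
      ((k : ℂ) + 1)) * ((normalVar a b θ : ℂ) *
        polyMap a (Complex.exp (θ * Complex.I)) ^ ((k : ℕ) + 1)) :=
    continuous_finsetSum _ fun k _ => c4 k
  have h0 : (∫ θ in (0 : ℝ)..2 * Real.pi, normalVar a b θ) = Real.pi * (D b).1 := by
    rw [intervalIntegral.integral_ofReal, ← Complex.ofReal_one, ← Complex.ofReal_div,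
      ← Complex.ofReal_mul, Complex.ofReal_inj] at hb1
    rw [hb1]
    field_simp
  have h1 : (∫ θ in (0 : ℝ)..2 * Real.pi, (∑ k : Fin N, -(Real.pi * negMoment a ((k : ℕ) + 1) /
      ((k : ℂ) + 1)) * ((normalVar a b θ : ℂ) *
        polyMap a (Complex.exp (θ * Complex.I)) ^ ((k : ℕ) + 1))).re) =
      -Real.pi ^ 2 * (∑ k : Fin N, negMoment a ((k : ℕ) + 1) / ((k : ℂ) + 1) * (D b).2 k).re := by
    have := Complex.reCLM.intervalIntegral_comp_comm (c3.intervalIntegrable (μ := volume) 0 (2 * Real.pi))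
    simp only [Complex.reCLM_apply] at this
    rw [this, intervalIntegral.integral_finsetSum fun k _ => (c4 k).intervalIntegrable _ _,
      ← Complex.re_ofReal_mul, Finset.mul_sum]
    congr 1
    refine Finset.sum_congr rfl fun k _ => ?_
    have hpi' := Complex.ofReal_ne_zero.2 hpi
    have hx : ∀ x t m c : ℂ, x = 1 / (Real.pi : ℂ) * t → -(Real.pi * m / c) * t =
        ((-Real.pi ^ 2 : ℝ) : ℂ) * (m / c * x) := by
      rintro x t m c rfl
      push_cast
      field_simp
    rw [intervalIntegral.integral_const_mul]
    exact hx _ _ _ _ (hb2 k)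
  have h2 : ∀ θ : ℝ, normalVar a b θ * (logPot a (Complex.exp (θ * Complex.I)) -
      Real.pi / 2 * Complex.normSq (polyMap a (Complex.exp (θ * Complex.I))) -
        (negPot a (Complex.exp (θ * Complex.I))).re) =
      normalVar a b θ * logPot a (Complex.exp (θ * Complex.I)) - Real.pi / 2 * (normalVar a b θ •
      Complex.normSq (polyMap a (Complex.exp (θ * Complex.I)))) -
      (∑ k : Fin N, -(Real.pi * negMoment a ((k : ℕ) + 1) /
      ((k : ℂ) + 1)) * ((normalVar a b θ : ℂ) *
        polyMap a (Complex.exp (θ * Complex.I)) ^ ((k : ℕ) + 1))).re := by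
    intro θ
    have : (∑ k : Fin N, -(Real.pi * negMoment a ((k : ℕ) + 1) /
      ((k : ℂ) + 1)) * ((normalVar a b θ : ℂ) *
        polyMap a (Complex.exp (θ * Complex.I)) ^ ((k : ℕ) + 1))) =
        (normalVar a b θ : ℂ) * negPot a (Complex.exp (θ * Complex.I)) := by
      rw [negPot, Finset.mul_sum]
      refine Finset.sum_congr rfl fun k _ => ?_
      ring
    rw [this, Complex.re_ofReal_mul, smul_eq_mul]
    ring
  have c5 : Continuous fun θ : ℝ => Real.pi / 2 * (normalVar a b θ •
      Complex.normSq (polyMap a (Complex.exp (θ * Complex.I)))) := continuous_const.mul c2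
  simp only [h2] at key
  have e1 := intervalIntegral.integral_sub (μ := volume) ((c1.sub c5).intervalIntegrable 0 (2 * Real.pi))
    ((Complex.continuous_re.comp c3).intervalIntegrable 0 (2 * Real.pi))
  have e2 := intervalIntegral.integral_sub (μ := volume) (c1.intervalIntegrable 0 (2 * Real.pi))
    (c5.intervalIntegrable 0 (2 * Real.pi))
  rw [intervalIntegral.integral_const_mul] at e2
  have e3 := key.symm.trans (e1.trans (congr_arg₂ (· - ·) e2 h1))
  rw [h0] at e3
  simp only [sub_apply, smul_apply, smul_eq_mul, hLb₁, hLb₂] at e3 ⊢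
  have h3 : ∫ θ in (0 : ℝ)..2 * Real.pi,
      normalVar a b θ * logPot a (Complex.exp (θ * Complex.I)) =
      logPot a 0 * (Real.pi * (D b).1) - Real.pi ^ 2 *
        (∑ k : Fin N, negMoment a ((k : ℕ) + 1) / ((k : ℂ) + 1) * (D b).2 k).re +
      Real.pi / 2 * ∫ θ in (0 : ℝ)..2 * Real.pi, normalVar a b θ *
        Complex.normSq (polyMap a (Complex.exp (θ * Complex.I))) := by
    linarith
  -- The pairing `q` of the normal variation with `|f|²` cancels: `prepot` weights the two integrals
  -- precisely so that only moments survive.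
  have h4 : ∀ J s d r q : ℝ, J = s * (Real.pi * d) - Real.pi ^ 2 * r + Real.pi / 2 * q →
      1 / Real.pi * q - 1 / Real.pi ^ 2 * (2 * J) = -(2 / Real.pi) * s * d + 2 * r := by
    rintro J s d r q rfl
    field_simp
    ring
  exact h4 _ _ _ _ _ h3

/-! ### Differentiability of the coefficients of the differential. -/

theorem differentiableAt_intervalIntegral {H E : Type*} [NormedAddCommGroup H] [NormedSpace ℝ H]
    [NormedAddCommGroup E] [NormedSpace ℝ E] [CompleteSpace E] {a : H} {s t : ℝ} (hst : s ≤ t)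
    {O : Set (H × ℝ)} (hO : IsOpen O) (hsub : ∀ x ∈ Icc s t, (a, x) ∈ O) {k : H × ℝ → E}
    (hk : ContDiffOn ℝ 1 k O) : DifferentiableAt ℝ (fun b => ∫ x in s..t, k (b, x)) a := by
  obtain ⟨L, hL, -⟩ := exists_hasFDerivAt_intervalIntegral hst hO hsub hk
    (d := fun v x => deriv (fun r : ℝ => k (a + r • v, x)) 0) fun v x hx => by
      have h1 : DifferentiableAt ℝ k (a + (0 : ℝ) • v, x) := by
        rw [zero_smul, add_zero]
        exact (hk.differentiableOn one_ne_zero).differentiableAt (hO.mem_nhds (hsub x hx))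
      exact (DifferentiableAt.comp (g := k) (f := fun r : ℝ => (a + r • v, x)) 0 h1
        (by fun_prop)).hasDerivAt
  exact hL.differentiableAt

theorem contDiff_polyMap_exp :
    ContDiff ℝ 1 fun p : Coord N × ℝ => polyMap p.1 (Complex.exp (p.2 * Complex.I)) :=
  contDiff_polyMap.comp (contDiff_fst.prodMk (contDiff_exp_ofReal_mul_I contDiff_snd))

theorem contDiff_exp_mul_polyDeriv_exp :
    ContDiff ℝ 1 fun p : Coord N × ℝ => Complex.exp (p.2 * Complex.I) *
      polyDeriv p.1 (Complex.exp (p.2 * Complex.I)) :=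
  (contDiff_exp_ofReal_mul_I contDiff_snd).mul
    (contDiff_polyDeriv.comp (contDiff_fst.prodMk (contDiff_exp_ofReal_mul_I contDiff_snd)))

theorem isOpen_polyMap_exp_ne_zero :
    IsOpen {p : Coord N × ℝ | polyMap p.1 (Complex.exp (p.2 * Complex.I)) ≠ 0} :=
  isOpen_ne_fun contDiff_polyMap_exp.continuous continuous_const

theorem differentiableAt_negMoment {a : Coord N} (ha : DivDiffNeZero a) (k : ℕ) :
    DifferentiableAt ℝ (fun b : Coord N => negMoment b k) a := by
  simp only [negMoment_eq]
  refine DifferentiableAt.const_mul (differentiableAt_intervalIntegral Real.two_pi_pos.le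
    isOpen_polyMap_exp_ne_zero (fun θ _ => polyMap_exp_ne_zero ha θ)
    (k := fun p : Coord N × ℝ => Complex.exp (p.2 * Complex.I) *
      polyDeriv p.1 (Complex.exp (p.2 * Complex.I)) *
        conj (polyMap p.1 (Complex.exp (p.2 * Complex.I))) /
          polyMap p.1 (Complex.exp (p.2 * Complex.I)) ^ k) ?_) _
  have hnum : ContDiff ℝ 1 fun p : Coord N × ℝ => Complex.exp (p.2 * Complex.I) *
      polyDeriv p.1 (Complex.exp (p.2 * Complex.I)) *
        conj (polyMap p.1 (Complex.exp (p.2 * Complex.I))) :=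
    contDiff_exp_mul_polyDeriv_exp.mul
      ((Complex.conjCLE : ℂ →L[ℝ] ℂ).contDiff.comp contDiff_polyMap_exp)
  intro p hp
  have hp' : polyMap p.1 (Complex.exp (p.2 * Complex.I)) ≠ 0 := hp
  simp only [div_eq_mul_inv]
  exact (hnum.contDiffAt.mul ((contDiff_polyMap_exp.contDiffAt.pow k).inv
    (pow_ne_zero k hp'))).contDiffWithinAt

/-- The potential at the origin is the coefficient of `dM₀` in the differential of the prepotential.
It must be differentiable too if the second derivative is to exist. -/
theorem differentiableAt_logPot_zero {a : Coord N} (ha : DivDiffNeZero a) :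
    DifferentiableAt ℝ (fun b : Coord N => logPot b 0) a := by
  have h1 : DifferentiableAt ℝ (fun b : Coord N => ∫ θ in (0 : ℝ)..2 * Real.pi, bdryKer b 0 θ) a := by
    refine differentiableAt_intervalIntegral Real.two_pi_pos.le
      isOpen_polyMap_exp_ne_zero (fun θ _ => polyMap_exp_ne_zero ha θ)
      (k := fun p : Coord N × ℝ => bdryKer p.1 0 p.2) ?_
    simp only [bdryKer, logKer, polyMap_zero_right, sub_zero]
    refine contDiff_exp_mul_polyDeriv_exp.contDiffOn.mul (ContDiffOn.mul
      ((Complex.conjCLE : ℂ →L[ℝ] ℂ).contDiff.comp contDiff_polyMap_exp).contDiffOn ?_)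
    exact fun p hp => (Complex.ofRealCLM.contDiff.contDiffAt.comp p
      ((contDiff_polyMap_exp.contDiffAt.norm ℝ hp).log (norm_ne_zero_iff.2 hp))).contDiffWithinAt
  have h2 : DifferentiableAt ℝ (fun b : Coord N => ∫ z in ball (0 : ℂ) 1, jac b z) a :=
    (contDiff_integral_ball_one (k := fun p : Coord N × ℂ => jac p.1 p.2)
      contDiff_jac).contDiffAt.differentiableAt (by simp)
  have h3 : DifferentiableAt ℝ (fun b : Coord N => (bdryPot b 0).re) a :=
    Complex.reCLM.differentiableAt.comp a
      ((h1.const_mul _).sub ((Complex.ofRealCLM.differentiableAt.comp a h2).const_mul _))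
  refine h3.congr_of_eventuallyEq ?_
  filter_upwards [isOpen_divDiffNeZero.mem_nhds ha] with b hb
  rw [← logPot_eq_bdryPot hb (mem_closedBall_self zero_le_one), Complex.ofReal_re]

/-! ### The energy of the complement in a large disk. -/

/-- On the circle the integrand is the conjugate of `z / (1 - conj w z)`, which is holomorphic on
the closed disk and vanishes at the origin. -/
theorem integral_inv_exp_sub {w : ℂ} (hw : w ∈ ball (0 : ℂ) 1) :
    ∫ θ in (0 : ℝ)..2 * Real.pi, (Complex.exp (θ * Complex.I) - w)⁻¹ = 0 := by
  have hne : ∀ z ∈ closedBall (0 : ℂ) 1, 1 - conj w * z ≠ 0 := by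
    intro z hz h
    rw [mem_ball_zero_iff] at hw
    rw [mem_closedBall_zero_iff] at hz
    have h1 : ‖conj w * z‖ = 1 := by rw [← sub_eq_zero.1 h, norm_one]
    rw [norm_mul, RCLike.norm_conj] at h1
    have := mul_le_mul_of_nonneg_left hz (norm_nonneg w)
    linarith
  have h1 : DifferentiableOn ℂ (fun z => z / (1 - conj w * z)) (closedBall 0 1) :=
    differentiableOn_id.div (by fun_prop) hne
  have h2 := integral_exp_mul_I_of_diffContOnCl
    (DifferentiableOn.diffContOnCl (by rwa [closure_ball _ one_ne_zero]))
  have h3 : ∀ θ : ℝ, (Complex.exp (θ * Complex.I) - w)⁻¹ = conj (Complex.exp (θ * Complex.I) /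
      (1 - conj w * Complex.exp (θ * Complex.I))) := by
    intro θ
    have h4 : Complex.exp (θ * Complex.I) * conj (Complex.exp (θ * Complex.I)) = 1 := by
      rw [Complex.mul_conj, Complex.normSq_eq_norm_sq, Complex.norm_exp_ofReal_mul_I]
      simp
    have h5 : (1 - w * conj (Complex.exp (θ * Complex.I))) ≠ 0 := by
      have := (map_ne_zero (starRingEnd ℂ)).2 (hne _ (norm_exp_mul_I_mem_closedBall θ))
      simpa only [map_sub, map_one, map_mul, Complex.conj_conj] using this
    simp only [map_div₀, map_sub, map_one, map_mul, Complex.conj_conj]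
    rw [eq_div_iff h5, inv_mul_eq_iff_eq_mul₀ (sub_ne_zero.2 (exp_mul_I_ne_of_mem_ball hw θ))]
    rw [sub_mul, h4]
  have h6 := (Complex.conjCLE : ℂ →L[ℝ] ℂ).intervalIntegral_comp_comm (μ := volume) (a := 0)
    (b := 2 * Real.pi) (f := fun θ : ℝ => Complex.exp (θ * Complex.I) /
      (1 - conj w * Complex.exp (θ * Complex.I))) (Continuous.intervalIntegrable
        (Continuous.div (by fun_prop) (by fun_prop)
          fun θ => hne _ (norm_exp_mul_I_mem_closedBall θ)) _ _)
  simp only [ContinuousLinearEquiv.coe_coe, Complex.conjCLE_apply] at h6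
  simp only [h3]
  rw [h6, h2]
  simp

/-- The logarithmic potential of a disk is quadratic inside the disk. -/
theorem exists_integral_log_norm_sub_ball {R : ℝ} (hR : 0 < R) :
    ∃ κ : ℝ, ∀ w ∈ ball (0 : ℂ) R,
      ∫ z in ball (0 : ℂ) R, Real.log ‖z - w‖ = Real.pi / 2 * Complex.normSq w + κ := by
  have hR' : (R : ℂ) ≠ 0 := Complex.ofReal_ne_zero.2 hR.ne'
  -- The disk of radius `R` is the domain of the case `N = 0`, so the potential theory above applies
  -- to it.
  set a : Coord 0 := (R, 0) with ha
  have hpm : ∀ z, polyMap a z = R * z := fun z => by simp [polyMap, ha]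
  have hpd : ∀ z, polyDeriv a z = R := fun z => by simp [polyDeriv, ha]
  have hgood : DivDiffNeZero a := fun z _ w _ => by simpa [divDiff, ha] using hR.ne'
  have hdom : domainOf a = ball 0 R := by
    ext w
    simp only [domainOf, mem_image, hpm, mem_ball_zero_iff]
    refine ⟨?_, fun hw => ⟨w / R, ?_, by field_simp⟩⟩
    · rintro ⟨z, hz, rfl⟩
      rw [norm_mul, Complex.norm_real, Real.norm_of_nonneg hR.le]
      exact mul_lt_of_lt_one_right hR hz
    · rw [norm_div, Complex.norm_real, Real.norm_of_nonneg hR.le]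
      exact (div_lt_one hR).2 hw
  have hpot : ∀ w, ∫ z in ball (0 : ℂ) R, Real.log ‖z - R * w‖ = logPot a w := by
    intro w
    rw [← hdom, setIntegral_domainOf hgood, logPot]
    simp only [logKer, hpm, smul_eq_mul]
  -- On the circle of radius `R` one has `conj z = R² / z`, whose Cauchy transform vanishes inside;
  -- so the potential minus `(π/2) |z|²` has zero gradient.
  have hcau : ∀ w ∈ ball (0 : ℂ) 1, bdryCauchy a w = 0 := by
    intro w hw
    have h : ∀ θ : ℝ, Complex.exp (θ * Complex.I) * R * conj (R * Complex.exp (θ * Complex.I)) /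
        (R * Complex.exp (θ * Complex.I) - R * w) = R * (Complex.exp (θ * Complex.I) - w)⁻¹ := by
      intro θ
      have h4 : Complex.exp (θ * Complex.I) * conj (Complex.exp (θ * Complex.I)) = 1 := by
        rw [Complex.mul_conj, Complex.normSq_eq_norm_sq, Complex.norm_exp_ofReal_mul_I]
        simp
      rw [← mul_sub, map_mul, Complex.conj_ofReal, mul_mul_mul_comm, mul_comm (R : ℂ) (conj _),
        mul_mul_mul_comm, h4, one_mul, mul_div_mul_left _ _ hR', div_eq_mul_inv]
    simp only [bdryCauchy, hpm, hpd, h]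
    rw [intervalIntegral.integral_const_mul, integral_inv_exp_sub hw, mul_zero]
  have hconst : ∀ w ∈ ball (0 : ℂ) 1, HasFDerivWithinAt
      (fun w => logPot a w - Real.pi / 2 * Complex.normSq (polyMap a w)) (0 : ℂ →L[ℝ] ℝ)
      (ball 0 1) w := by
    intro w hw
    obtain ⟨L, hL, -, hLv⟩ := exists_hasFDerivAt_logPot hgood hw
    have h1 := (hasFDerivAt_normSq_polyMap a w).const_mul (Real.pi / 2)
    refine ((hL.sub h1).congr_fderiv ?_).hasFDerivWithinAt
    refine ContinuousLinearMap.ext fun v => ?_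
    simp only [sub_apply, hLv, bdryQuot_eq hgood hw, hcau w hw]
    simp
    ring
  refine ⟨logPot a 0, fun w hw => ?_⟩
  have hw1 : w / R ∈ ball (0 : ℂ) 1 := by
    rw [mem_ball_zero_iff] at hw ⊢
    rw [norm_div, Complex.norm_real, Real.norm_of_nonneg hR.le]
    exact (div_lt_one hR).2 hw
  have h1 := (convex_ball (0 : ℂ) 1).norm_image_sub_le_of_norm_hasFDerivWithin_le (C := 0) hconst
    (fun z _ => by simp) (mem_ball_self one_pos) hw1
  rw [zero_mul, norm_le_zero_iff, hpm, hpm, mul_zero, map_zero, mul_zero, sub_zero, sub_eq_zero,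
    mul_div_cancel₀ _ hR'] at h1
  have h2 := hpot (w / R)
  rw [mul_div_cancel₀ _ hR'] at h2
  rw [h2]
  linarith

theorem integrableOn_log_norm_sub_prod (R : ℝ) :
    IntegrableOn (fun p : ℂ × ℂ => Real.log ‖p.1 - p.2‖) (ball 0 R ×ˢ ball 0 R) := by
  have : IsFiniteMeasure (volume.restrict (ball (0 : ℂ) R)) :=
    ⟨by rw [Measure.restrict_apply_univ]; exact measure_ball_lt_top⟩
  have := integrable_log_norm_sub_prod (ν := volume.restrict (ball (0 : ℂ) R)) measurable_id
    (R := R) ((ae_restrict_mem measurableSet_ball).mono fun z hz =>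
      (mem_ball_zero_iff.1 hz).le) R
  rwa [Measure.prod_restrict, ← Measure.volume_eq_prod] at this

theorem measurableSet_domainOf {a : Coord N} (ha : DivDiffNeZero a) :
    MeasurableSet (domainOf a) :=
  measurableSet_ball.image_of_continuousOn_injOn (continuous_polyMap a).continuousOn
    (ha.injOn.mono ball_subset_closedBall)

/-- The energy of the complement of a domain in a disk, in terms of the prepotential. -/
theorem exists_energy_eq {R : ℝ} (hR : 0 < R) :
    ∃ C c : ℝ, ∀ a : Coord N, DivDiffNeZero a → domainOf a ⊆ ball 0 R →
      energy R (domainOf a) = C + c * (diskMomentMap a).1 + prepot a := by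
  obtain ⟨κ, hκ⟩ := exists_integral_log_norm_sub_ball hR
  set B : Set ℂ := ball 0 R with hBR
  refine ⟨-(1 / Real.pi ^ 2) * ∫ w in B, ∫ z in B, Real.log ‖z - w‖, 2 * κ / Real.pi,
    fun a ha hsub => ?_⟩
  set Ω : Set ℂ := domainOf a
  have hΩ : MeasurableSet Ω := measurableSet_domainOf ha
  have hB : MeasurableSet B := measurableSet_ball
  have hpi := Real.pi_ne_zero
  have hj := continuous_jac a
  have hpc := continuous_polyMap a
  have hprod : ∀ A A' : Set ℂ, A ⊆ B → A' ⊆ B → Integrable (fun p : ℂ × ℂ => Real.log ‖p.2 - p.1‖)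
      ((volume.restrict A).prod (volume.restrict A')) := by
    intro A A' hA hA'
    rw [Measure.prod_restrict, ← Measure.volume_eq_prod]
    exact ((integrableOn_log_norm_sub_prod R).mono_set (prod_mono hA hA')).congr
      (Filter.Eventually.of_forall fun p => congr_arg Real.log (norm_sub_rev _ _))
  have hU : IntegrableOn (fun w => ∫ z in B, Real.log ‖z - w‖) B :=
    (hprod B B subset_rfl subset_rfl).integral_prod_left
  have hV : IntegrableOn (fun w => ∫ z in Ω, Real.log ‖z - w‖) B :=
    (hprod B Ω subset_rfl hsub).integral_prod_left
  have hin : ∀ w, ∫ z in B \ Ω, Real.log (1 / ‖z - w‖) =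
      -((∫ z in B, Real.log ‖z - w‖) - ∫ z in Ω, Real.log ‖z - w‖) := by
    intro w
    simp only [one_div, Real.log_inv]
    rw [integral_neg, setIntegral_sdiff hΩ _ hsub]
    exact (integrableOn_log_norm_sub w R).congr
      (Filter.Eventually.of_forall fun p => congr_arg Real.log (norm_sub_rev _ _))
  have hswap : ∫ w in B, ∫ z in Ω, Real.log ‖z - w‖ = ∫ w in Ω, ∫ z in B, Real.log ‖z - w‖ := by
    rw [integral_integral_swap (f := fun w z => Real.log ‖z - w‖) (hprod B Ω subset_rfl hsub)]
    simp only [norm_sub_rev]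
  have hUΩ : ∫ w in Ω, ∫ z in B, Real.log ‖z - w‖ =
      Real.pi / 2 * (∫ z in ball (0 : ℂ) 1, jac a z * Complex.normSq (polyMap a z)) +
        κ * ∫ z in ball (0 : ℂ) 1, jac a z := by
    rw [setIntegral_congr_fun hΩ fun w hw => hκ w (hsub hw), setIntegral_domainOf ha,
      ← integral_const_mul, ← integral_const_mul, ← integral_add]
    · refine integral_congr_ae (Filter.Eventually.of_forall fun z => ?_)
      simp only [smul_eq_mul]
      ring
    · exact (Continuous.integrableOn_ball_one
        (hj.mul (Complex.continuous_normSq.comp hpc))).const_mul _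
    · exact (Continuous.integrableOn_ball_one hj).const_mul _
  have hVΩ : ∫ w in Ω, ∫ z in Ω, Real.log ‖z - w‖ = selfEnergy a := by
    rw [setIntegral_domainOf ha]
    simp only [Ω, setIntegral_domainOf ha, selfEnergy, logPot, logKer, smul_eq_mul]
  have hM : (diskMomentMap a).1 = 1 / Real.pi * ∫ z in ball (0 : ℂ) 1, jac a z := by
    simp only [diskMomentMap, diskMoment, pow_zero, Complex.real_smul, mul_one]
    rw [integral_complex_ofReal, ← Complex.ofReal_one, ← Complex.ofReal_div, ← Complex.ofReal_mul,
      Complex.ofReal_re]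
  rw [energy, ← hBR]
  simp only [hin]
  -- With `B` the large disk, the double integral over `B \ Ω` expands into the `B × B`, `B × Ω` and
  -- `Ω × Ω` terms. The first is constant, the two mixed ones agree by symmetry and are computed
  -- from the quadratic potential, and the last is `selfEnergy a`.
  rw [integral_neg, integral_sub (hU.mono_set sdiff_subset) (hV.mono_set sdiff_subset),
    setIntegral_sdiff hΩ hU hsub, setIntegral_sdiff hΩ hV hsub, hswap, hUΩ, hVΩ, hM, prepot]
  field_simp
  ring

theorem integrableOn_log_one_div_norm_sub {R : ℝ} {A : Set ℂ} (hA : A ⊆ ball 0 R) :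
    IntegrableOn (fun p : ℂ × ℂ => Real.log (1 / ‖p.1 - p.2‖)) (A ×ˢ A) := by
  simp only [one_div, Real.log_inv]
  exact ((integrableOn_log_norm_sub_prod R).mono_set (prod_mono hA hA)).neg

theorem zero_mem_domainOf (a : Coord N) : 0 ∈ domainOf a :=
  ⟨0, mem_ball_self one_pos, polyMap_zero_right a⟩

theorem eventually_domainOf_subset {a : Coord N} {R : ℝ} (h : closure (domainOf a) ⊆ ball 0 R) :
    ∀ᶠ b in nhds a, domainOf b ⊆ ball 0 R := by
  have h1 : ∀ z ∈ closedBall (0 : ℂ) 1, ‖polyMap a z‖ < R := by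
    intro z hz
    rw [← closure_ball _ one_ne_zero] at hz
    exact mem_ball_zero_iff.1
      (h (image_closure_subset_closure_image (continuous_polyMap a) (mem_image_of_mem _ hz)))
  have h2 := (isCompact_closedBall (0 : ℂ) 1).eventually_forall_of_forall_eventually (x₀ := a)
    (P := fun b z => ‖polyMap b z‖ < R) fun z hz =>
      (contDiff_polyMap (n := 0)).continuous.norm.continuousAt.eventually_lt continuousAt_const
        (h1 z hz)
  filter_upwards [h2] with b hb
  rintro _ ⟨z, hz, rfl⟩
  exact mem_ball_zero_iff.2 (hb z (ball_subset_closedBall hz))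

/-! ### Real differentials and Wirtinger derivatives. -/

/-- The real linear form `v ↦ s v₀ + 2 Re ∑ c_k v_k`. -/
noncomputable def momentForm (s : ℝ) (c : Fin N → ℂ) : Coord N →L[ℝ] ℝ :=
  s • ContinuousLinearMap.fst ℝ ℝ (Fin N → ℂ) + ∑ k, (2 : ℝ) • Complex.reCLM.comp
    (c k • (ContinuousLinearMap.proj k).comp (ContinuousLinearMap.snd ℝ ℝ (Fin N → ℂ)))

theorem momentForm_apply (s : ℝ) (c : Fin N → ℂ) (v : Coord N) :
    momentForm s c v = s * v.1 + 2 * (∑ k, c k * v.2 k).re := by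
  rw [Complex.re_sum, Finset.mul_sum]
  simp [momentForm]

theorem momentForm_single (s : ℝ) (c : Fin N → ℂ) (k : Fin N) (x : ℂ) :
    momentForm s c (0, Pi.single k x) = 2 * (c k * x).re := by
  rw [momentForm_apply, mul_zero, zero_add, Finset.sum_eq_single k]
  · simp
  · intro j _ hj
    simp [Pi.single_eq_of_ne hj]
  · simp

theorem DifferentiableAt.momentForm {s : Coord N → ℝ} {c : Coord N → Fin N → ℂ} {p : Coord N}
    (hs : DifferentiableAt ℝ s p) (hc : ∀ k, DifferentiableAt ℝ (fun q => c q k) p) :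
    DifferentiableAt ℝ (fun q => momentForm (s q) (c q)) p := by
  unfold MomentCoordinates.momentForm
  refine (hs.smul_const _).add (DifferentiableAt.fun_sum fun k _ =>
    DifferentiableAt.const_smul ?_ (2 : ℝ))
  exact (differentiableAt_const _).clm_comp ((hc k).smul_const _)

/-- The factor `2` in `momentForm` offsets the `1/2` in the Wirtinger derivative. -/
theorem wirtinger_ofReal {G : Coord N → ℝ} {s : ℝ} {c : Fin N → ℂ} {p : Coord N}
    (h : HasFDerivAt G (momentForm s c) p) (k : Fin N) :
    wirtinger (fun q => (G q : ℂ)) k p = c k := by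
  have h1 := (Complex.ofRealCLM.hasFDerivAt.comp p h).fderiv
  simp only [Function.comp_def, Complex.ofRealCLM_apply] at h1
  rw [wirtinger, h1]
  simp only [ContinuousLinearMap.comp_apply, momentForm_single, Complex.ofRealCLM_apply]
  apply Complex.ext <;> simp

/-- The coefficients of a real gradient satisfy the symmetry of mixed Wirtinger derivatives. -/
theorem wirtinger_comm {G : Coord N → ℝ} {s : Coord N → ℝ} {c : Coord N → Fin N → ℂ} {p : Coord N}
    (h : ∀ᶠ q in nhds p, HasFDerivAt G (momentForm (s q) (c q)) q)
    (hs : DifferentiableAt ℝ s p) (hc : ∀ k, DifferentiableAt ℝ (fun q => c q k) p)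
    (k j : Fin N) : wirtinger (fun q => c q k) j p = wirtinger (fun q => c q j) k p := by
  have hd := (DifferentiableAt.momentForm hs hc).hasFDerivAt
  have hsym := second_derivative_symmetric_of_eventually h hd
  have hval : ∀ (v : Coord N) (l : Fin N) (x : ℂ),
      fderiv ℝ (fun q => momentForm (s q) (c q)) p v (0, Pi.single l x) =
        2 * (fderiv ℝ (fun q => c q l) p v * x).re := by
    intro v l x
    have h1 := hd.clm_apply (hasFDerivAt_const ((0, Pi.single l x) : Coord N) p)
    have h2 := Complex.reCLM.hasFDerivAt.comp p ((hc l).hasFDerivAt.mul_const x)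
    simp only [momentForm_single] at h1
    have h3 := h1.unique (h2.const_mul 2)
    have h4 := DFunLike.congr_fun h3 v
    simpa [mul_comm] using h4
  -- Symmetry of the second derivative, tested in the directions `x` of the `j`-th and `y` of the
  -- `k`-th complex coordinate. The four choices of `x`, `y` in `{1, i}` give the real and imaginary
  -- parts of the claim.
  have key : ∀ x y : ℂ, (fderiv ℝ (fun q => c q k) p (0, Pi.single j x) * y).re =
      (fderiv ℝ (fun q => c q j) p (0, Pi.single k y) * x).re := by
    intro x y
    have := hsym (0, Pi.single j x) (0, Pi.single k y)
    rw [hval, hval] at this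
    linarith
  have h11 := key 1 1
  have h1I := key 1 Complex.I
  have hI1 := key Complex.I 1
  have hII := key Complex.I Complex.I
  simp only [mul_one, Complex.mul_I_re, neg_inj] at h11 h1I hI1 hII
  rw [wirtinger, wirtinger]
  congr 1
  apply Complex.ext
  · simp [h11, hII]
  · simp only [Complex.sub_im, Complex.I_mul_im, hI1, ← h1I]
    ring

theorem wirtinger_const_mul {G : Coord N → ℂ} {p : Coord N} (h : DifferentiableAt ℝ G p) (r : ℂ)
    (k : Fin N) : wirtinger (fun q => r * G q) k p = r * wirtinger G k p := by
  rw [wirtinger, wirtinger, fderiv_const_mul h]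
  simp only [smul_apply, smul_eq_mul]
  ring

/-! ### Transfer to moment coordinates. -/

theorem IsMomentChart.divDiffNeZero {e : OpenPartialHomeomorph (Coord N) (Coord N)}
    (he : IsMomentChart e) {q : Coord N} (hq : q ∈ e.target) : DivDiffNeZero (e.symm q) :=
  (mem_univalentSet_iff.1 (he.source_subset (e.map_target hq))).2

theorem IsMomentChart.diskMomentMap_symm {e : OpenPartialHomeomorph (Coord N) (Coord N)}
    (he : IsMomentChart e) {q : Coord N} (hq : q ∈ e.target) : diskMomentMap (e.symm q) = q := by
  rw [← momentMap_eq (he.divDiffNeZero hq), ← he.eqOn (e.map_target hq), e.right_inv hq]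

theorem IsMomentChart.differentiableAt_symm {e : OpenPartialHomeomorph (Coord N) (Coord N)}
    (he : IsMomentChart e) {q : Coord N} (hq : q ∈ e.target) : DifferentiableAt ℝ e.symm q :=
  (he.contDiffOn_symm.contDiffAt (e.open_target.mem_nhds hq)).differentiableAt (by simp)

theorem IsMomentChart.hasFDerivAt_prepot_symm {e : OpenPartialHomeomorph (Coord N) (Coord N)}
    (he : IsMomentChart e) {q : Coord N} (hq : q ∈ e.target) :
    HasFDerivAt (fun q => prepot (e.symm q))
      (momentForm (-(2 / Real.pi) * logPot (e.symm q) 0)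
        (fun k => 1 / ((k : ℂ) + 1) * negMoment (e.symm q) ((k : ℕ) + 1))) q := by
  have hD := (contDiff_diskMomentMap.differentiable (by simp) (e.symm q)).hasFDerivAt
  have hΨ := (he.differentiableAt_symm hq).hasFDerivAt
  obtain ⟨L, hL, hLb⟩ := exists_hasFDerivAt_prepot (he.divDiffNeZero hq) hD
  refine (hL.comp q hΨ).congr_fderiv (ContinuousLinearMap.ext fun v => ?_)
  -- In the chart the moments are the coordinates, so the differential of the moments composed with
  -- that of the inverse chart is the identity, and `dM_k` becomes the `k`-th coordinate form.
  have hid : (fderiv ℝ diskMomentMap (e.symm q)).comp (fderiv ℝ e.symm q) =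
      ContinuousLinearMap.id ℝ (Coord N) := by
    refine (hD.comp q hΨ).unique ((hasFDerivAt_id q).congr_of_eventuallyEq ?_)
    filter_upwards [e.open_target.mem_nhds hq] with r hr
    exact he.diskMomentMap_symm hr
  have hv := DFunLike.congr_fun hid v
  rw [ContinuousLinearMap.comp_apply, ContinuousLinearMap.id_apply] at hv
  rw [ContinuousLinearMap.comp_apply, hLb, hv, momentForm_apply]
  simp only [div_mul_eq_mul_div, one_mul]

theorem IsMomentChart.hasFDerivAt_energy_symm {e : OpenPartialHomeomorph (Coord N) (Coord N)}
    (he : IsMomentChart e) {q : Coord N} (hq : q ∈ e.target) {R : ℝ}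
    (hR : closure (domainOf (e.symm q)) ⊆ ball 0 R) :
    ∃ s : ℝ, HasFDerivAt (fun q => energy R (domainOf (e.symm q)))
      (momentForm s (fun k => 1 / ((k : ℂ) + 1) * negMoment (e.symm q) ((k : ℕ) + 1))) q := by
  have hR0 : 0 < R := by
    simpa using hR (subset_closure (zero_mem_domainOf (e.symm q)))
  obtain ⟨C, c, hCc⟩ := exists_energy_eq (N := N) hR0
  -- The affine term `c M₀` only alters the coefficient of `dM₀`, which no Wirtinger derivative in
  -- `M_k` with `k ≥ 1` sees.
  refine ⟨c + -(2 / Real.pi) * logPot (e.symm q) 0, ?_⟩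
  have h1 : HasFDerivAt (fun q : Coord N => C + c * q.1 + prepot (e.symm q)) _ q :=
    (((hasFDerivAt_fst (𝕜 := ℝ) (p := q)).const_mul c).const_add C).add (he.hasFDerivAt_prepot_symm hq)
  refine (h1.congr_of_eventuallyEq ?_).congr_fderiv (ContinuousLinearMap.ext fun v => ?_)
  · filter_upwards [e.open_target.mem_nhds hq,
      (he.differentiableAt_symm hq).continuousAt.eventually (eventually_domainOf_subset hR)]
      with r hr hr'
    rw [hCc _ (he.divDiffNeZero hr) hr', he.diskMomentMap_symm hr]
  · simp only [add_apply, momentForm_apply, smul_apply, smul_eq_mul,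
      ContinuousLinearMap.coe_fst']
    ring

theorem IsMomentChart.differentiableAt_negMoment_symm
    {e : OpenPartialHomeomorph (Coord N) (Coord N)}
    (he : IsMomentChart e) {q : Coord N} (hq : q ∈ e.target) (k : ℕ) :
    DifferentiableAt ℝ (fun q => negMoment (e.symm q) k) q :=
  DifferentiableAt.comp (g := fun b : Coord N => negMoment b k) q
    (differentiableAt_negMoment (he.divDiffNeZero hq) k) (he.differentiableAt_symm hq)

/-- The potential function used is `prepot` and not the energy: it needs no `R`, so no disk
containing the neighbouring domains has to be chosen. -/
theorem IsMomentChart.wirtinger_negMoment_comm {e : OpenPartialHomeomorph (Coord N) (Coord N)}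
    (he : IsMomentChart e) {q : Coord N} (hq : q ∈ e.target) (k j : Fin N) :
    1 / ((k : ℂ) + 1) * wirtinger (fun q => negMoment (e.symm q) ((k : ℕ) + 1)) j q =
      1 / ((j : ℂ) + 1) * wirtinger (fun q => negMoment (e.symm q) ((j : ℕ) + 1)) k q := by
  have hd := fun k : Fin N => he.differentiableAt_negMoment_symm hq ((k : ℕ) + 1)
  rw [← wirtinger_const_mul (hd k), ← wirtinger_const_mul (hd j)]
  refine wirtinger_comm (G := fun q => prepot (e.symm q))
    (s := fun q => -(2 / Real.pi) * logPot (e.symm q) 0)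
    (c := fun q k => 1 / ((k : ℂ) + 1) * negMoment (e.symm q) ((k : ℕ) + 1))
    ?_ ?_ (fun k => (hd k).const_mul _) k j
  · filter_upwards [e.open_target.mem_nhds hq] with r hr
    exact he.hasFDerivAt_prepot_symm hr
  · exact (DifferentiableAt.comp (g := fun b : Coord N => logPot b 0) q
      (differentiableAt_logPot_zero (he.divDiffNeZero hq))
      (he.differentiableAt_symm hq)).const_mul _

end MomentCoordinates

theorem mainTheorem6 (N : ℕ) :
    -- the moments are smooth local coordinates near every point
    (∀ a ∈ MomentCoordinates.univalentSet N,
      ∃ e : OpenPartialHomeomorph (MomentCoordinates.Coord N) (MomentCoordinates.Coord N),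
        MomentCoordinates.IsMomentChart e ∧ a ∈ e.source) ∧
    ∀ e : OpenPartialHomeomorph (MomentCoordinates.Coord N) (MomentCoordinates.Coord N),
      MomentCoordinates.IsMomentChart e →
      ∀ p ∈ e.target,
        -- the energy is a prepotential
        (∀ R : ℝ, closure (MomentCoordinates.domainOf (e.symm p)) ⊆ Metric.ball (0 : ℂ) R →
          MeasureTheory.IntegrableOn (fun w : ℂ × ℂ => Real.log (1 / ‖w.1 - w.2‖))
            ((Metric.ball (0 : ℂ) R \ MomentCoordinates.domainOf (e.symm p)) ×ˢ
              (Metric.ball (0 : ℂ) R \ MomentCoordinates.domainOf (e.symm p))) ∧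
          DifferentiableAt ℝ
            (fun q => (MomentCoordinates.energy R
              (MomentCoordinates.domainOf (e.symm q)) : ℂ)) p ∧
          ∀ k : Fin N,
            MomentCoordinates.wirtinger
              (fun q => (MomentCoordinates.energy R
                (MomentCoordinates.domainOf (e.symm q)) : ℂ)) k p =
              MomentCoordinates.negMoment (e.symm p) ((k : ℕ) + 1) / ((k : ℂ) + 1)) ∧
        -- integrability of the moments
        (∀ k : Fin N,
          DifferentiableAt ℝ
            (fun q => MomentCoordinates.negMoment (e.symm q) ((k : ℕ) + 1)) p) ∧
        ∀ k j : Fin N,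
          1 / ((k : ℂ) + 1) * MomentCoordinates.wirtinger
              (fun q => MomentCoordinates.negMoment (e.symm q) ((k : ℕ) + 1)) j p =
            1 / ((j : ℂ) + 1) * MomentCoordinates.wirtinger
              (fun q => MomentCoordinates.negMoment (e.symm q) ((j : ℕ) + 1)) k p := by
  refine ⟨fun a ha => MomentCoordinates.exists_isMomentChart ha, fun e he p hp =>
    ⟨fun R hR => ?_, fun k => he.differentiableAt_negMoment_symm hp _,
      he.wirtinger_negMoment_comm hp⟩⟩
  obtain ⟨s, hs⟩ := he.hasFDerivAt_energy_symm hp hR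
  refine ⟨MomentCoordinates.integrableOn_log_one_div_norm_sub sdiff_subset,
    (Complex.ofRealCLM.hasFDerivAt.comp p hs).differentiableAt, fun k => ?_⟩
  rw [MomentCoordinates.wirtinger_ofReal hs, one_div_mul_eq_div]
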